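/- Let $\mathcal A$ be the algebra of differential superpolynomials over $\mathbb C$ in even fields $v,w$ and odd fields $\alpha,\beta$, i.e. the free supercommutative algebra on the jets $u_i^{(k)}$ ($k\ge 0$) of $u=(v,w,\alpha,\beta)^T$, with the even derivation $\partial=\partial_x$, $\partial u_i^{(k)}=u_i^{(k+1)}$. Functionals $\int h\,dx$ are classes of $h\in\mathcal A$ modulo $\partial\mathcal A$, and $\frac{\delta}{\delta u_i}\int h\,dx=\sum_k(-\partial)^k\big(h\,\overleftarrow{\partial}/\partial u_i^{(k)}\big)$ (right derivatives). Let $$M=\begin{pmatrix}-\lambda+\frac v2&1&\alpha\\-2w-2&\lambda-\frac v2&\beta\\ \beta&-\alpha&0\end{pmatrix},\qquad N=\sum_{m\ge0}N_m\lambda^{-m},\quad N_m=\begin{pmatrix}a_m&b_m&\rho_m\\-2b_m+2c_m&-a_m&\delta_m\\ \delta_m&-\rho_m&0\end{pmatrix},$$ with $a_m,b_m,c_m\in\mathcal A$ even and $\rho_m,\delta_m\in\mathcal A$ odd. Fix $0\ne k_0\in\mathbb C$ and call $N$ a solution if $N_x=[M,N]$, $a_0=k_0$ and $b_0=c_0=\rho_0=\delta_0=0$;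 a solution is determined up to the integration constants in $a_1,a_2,\dots$. Put $G_n=(a_n,-2b_n,-2\delta_n,2\rho_n)^T$, $\mathrm{Str}\,X=X_{11}+X_{22}-X_{33}$ and $N^{(n)}=\sum_{m=0}^nN_m\lambda^{n-m}+b_{n+1}\,\mathrm{diag}(1,-1,0)$. The $n$-th flow ($n\ge0$) of the super generalized Broer--Kaup (gBK) hierarchy is the derivation $\partial_{t_n}$ of $\mathcal A$ that commutes with $\partial$ and satisfies $M_{t_n}-N^{(n)}_x+[M,N^{(n)}]=0$. Let $$J=\begin{pmatrix}0&-\partial&0&0\\-\partial&0&-\frac12\alpha&\frac12\beta\\0&-\frac12\alpha&0&-\frac12\\0&\frac12\beta&-\frac12&0\end{pmatrix},$$ $$\mathcal L=\begin{pmatrix}\frac12\partial^{-1}v\partial+\frac12\partial&\frac12\partial^{-1}w\partial+\frac12w+1&-\frac12\partial^{-1}\alpha\partial+\frac14\alpha&-\frac12\partial^{-1}\beta\partial-\frac14\beta\\2&-\frac12\partial+\frac12v&0&\alpha\\2\beta-2\alpha\partial&-2\alpha(w+1)&\partial+\frac12v&\alpha\beta-(2w+2)\\-2\alpha&\beta&-1&-\partial+\frac12v\end{pmatrix},$$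 $$R=\begin{pmatrix}-2\partial&\frac12\partial^2-\frac12\partial v&0&-\partial\alpha\\-\frac12v\partial-\frac12\partial^2&-\frac12w\partial-\frac12\partial w-\partial&R_1&R_2\\0&\frac14\alpha\partial-\frac14v\alpha-\frac12\beta&\frac12&\frac12\partial-\frac14v\\ \alpha\partial&-\frac14\beta\partial+(w+1)\alpha+\frac14v\beta&-\frac12\partial-\frac14v&(w+1)-\alpha\beta\end{pmatrix},$$ $R_1=-\frac14\partial\alpha-\frac14v\alpha-\frac12\beta$, $R_2=\frac14\partial\beta+(w+1)\alpha+\frac14v\beta$ (products of operators, e.g. $\partial v$ is $f\mapsto(vf)_x$). When $\mathcal L$ is applied to a vector over $\mathcal A$, $\partial^{-1}$ denotes an arbitrary antiderivative of the sum it acts on. Then: 1. $J\mathcal L=R$ as matrices of formal (pseudo)differential operators, and $J$, $R$ are compatible super-Hamiltonian operators: for all $c_1,c_2\in\mathbb C$ the bracket $\{\int f,\int g\}=\int(\delta f/\delta u)^T(c_1J+c_2R)(\delta g/\delta u)\,dx$ of even functionals is even, skew-symmetric and satisfies the Jacobi identity. 2. There is exactly one solution $N$ for which $\mathrm{Str}(N^2)$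 is independent of $\lambda$, i.e. $\mathrm{Str}(N^2)=2k_0^2$ (normalized integration constants). For it the super-trace identity holds with $\gamma=0$, coefficientwise in $\lambda$: $$\frac{\delta}{\delta u}\int\mathrm{Str}\Big(N\frac{\partial M}{\partial\lambda}\Big)dx=\frac{\partial}{\partial\lambda}\mathrm{Str}\Big(N\frac{\partial M}{\partial u}\Big).$$ 3. For this $N$ put $\tilde H_n=\int\frac{2a_{n+1}}n\,dx$ for $n\ge1$ and $\tilde H_0=\int k_0v\,dx$. For every $n\ge0$: $\delta\tilde H_n/\delta u=G_n$; the $n$-th flow exists, is unique and is $$u_{t_n}=\begin{pmatrix}2b_{n+1,x}\\-a_{n+1,x}+\alpha\delta_{n+1}+\beta\rho_{n+1}\\ \alpha b_{n+1}-\rho_{n+1}\\-\beta b_{n+1}+\delta_{n+1}\end{pmatrix};$$ moreover $\delta\tilde H_{n+1}/\delta u$ is a value of $\mathcal L\,\delta\tilde H_n/\delta u$, and $$u_{t_n}=J\frac{\delta\tilde H_{n+1}}{\delta u}=J\mathcal L\frac{\delta\tilde H_n}{\delta u}=R\frac{\delta\tilde H_n}{\delta u}.$$ 4. For any other integration constants,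 i.e. any solution $N'$, there are constants $f_0=1,f_1,f_2,\dots\in\mathbb C$ with $N'=\big(\sum_jf_j\lambda^{-j}\big)N$. With $K_n=\sum_{j=0}^nf_j\tilde H_{n-j}$, for every $n\ge0$: $\delta K_n/\delta u=G'_n$, the $n$-th flow of $N'$ exists and is unique, $\delta K_{n+1}/\delta u$ is a value of $\mathcal L\,\delta K_n/\delta u$, and $u_{t_n}=J\,\delta K_{n+1}/\delta u=J\mathcal L\,\delta K_n/\delta u=R\,\delta K_n/\delta u$. The formula $\delta\tilde H'_n/\delta u=G'_n$ with $\tilde H'_n=\int\frac{2a'_{n+1}}n\,dx$ holds for all $n\ge1$ if and only if $N'$ is normalized as in 2. -/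

import Mathlib

namespace SuperGBK

noncomputable section

/-! ### Differential superpolynomials -/

/-- The Koszul sign `(-1)^{|i||j|}` of two fields with parities `odd i`, `odd j`. -/
def koszul {ι : Type} (odd : ι → Bool) (i j : ι) : ℂ := if odd i && odd j then -1 else 1

/-- The relations `x y = (-1)^{|x||y|} y x` between the jet variables `x = u_i^{(k)}`, encoded as
pairs `(i, k)` (in particular `x² = 0` for odd `x`). -/
inductive JetRel {ι : Type} (odd : ι → Bool) :
    FreeAlgebra ℂ (ι × ℕ) → FreeAlgebra ℂ (ι × ℕ) → Prop
  | comm (x y : ι × ℕ) : JetRel odd (FreeAlgebra.ι ℂ x * FreeAlgebra.ι ℂ y)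
      (koszul odd x.1 y.1 • (FreeAlgebra.ι ℂ y * FreeAlgebra.ι ℂ x))

/-- The free supercommutative complex algebra on the jet variables `u_i^{(k)}`, `i : ι`, `k : ℕ`:
polynomials in the even jets tensored with the Grassmann algebra on the odd jets. -/
def JetAlg {ι : Type} (odd : ι → Bool) : Type := RingQuot (JetRel odd)

instance {ι : Type} (odd : ι → Bool) : Ring (JetAlg odd) :=
  inferInstanceAs (Ring (RingQuot (JetRel odd)))

instance {ι : Type} (odd : ι → Bool) : Algebra ℂ (JetAlg odd) :=
  inferInstanceAs (Algebra ℂ (RingQuot (JetRel odd)))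

namespace JetAlg

variable {ι : Type} {odd : ι → Bool}

/-- The jet variable `u_i^{(k)}`, for `x = (i, k)`. -/
def gen (odd : ι → Bool) (x : ι × ℕ) : JetAlg odd :=
  RingQuot.mkAlgHom ℂ (JetRel odd) (FreeAlgebra.ι ℂ x)

theorem gen_mul_gen (x y : ι × ℕ) :
    gen odd x * gen odd y = koszul odd x.1 y.1 • (gen odd y * gen odd x) := by
  have h := RingQuot.mkAlgHom_rel ℂ (JetRel.comm (odd := odd) x y)
  rw [map_mul, map_smul, map_mul] at h
  exact h

/-- The universal property of the free supercommutative algebra. -/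
def lift {B : Type} [Ring B] [Algebra ℂ B] (f : ι × ℕ → B)
    (hf : ∀ x y, f x * f y = koszul odd x.1 y.1 • (f y * f x)) : JetAlg odd →ₐ[ℂ] B :=
  RingQuot.liftAlgHom ℂ ⟨FreeAlgebra.lift ℂ f, by
    rintro _ _ ⟨x, y⟩
    simpa using hf x y⟩

@[simp] theorem lift_gen {B : Type} [Ring B] [Algebra ℂ B] (f : ι × ℕ → B)
    (hf : ∀ x y, f x * f y = koszul odd x.1 y.1 • (f y * f x)) (x : ι × ℕ) :
    lift f hf (gen odd x) = f x := by
  unfold lift gen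
  erw [RingQuot.liftAlgHom_mkAlgHom_apply]
  simp

/-- The parity automorphism: `+1` on even elements, `-1` on odd elements. -/
def parity (odd : ι → Bool) : JetAlg odd →ₐ[ℂ] JetAlg odd :=
  lift (fun x => (if odd x.1 then (-1 : ℂ) else 1) • gen odd x) (by
    intro x y
    simp only [smul_mul_smul_comm, gen_mul_gen x y]
    simp only [smul_smul]
    congr 1
    ring)

def IsEven (f : JetAlg odd) : Prop := parity odd f = f

def IsOdd (f : JetAlg odd) : Prop := parity odd f = -f

/-- `f ↦ [[f, ∂f], [0, f]]` as an algebra homomorphism, where `∂ u_i^{(k)} = u_i^{(k+1)}`. -/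
def totalHom (odd : ι → Bool) : JetAlg odd →ₐ[ℂ] Matrix (Fin 2) (Fin 2) (JetAlg odd) :=
  lift (fun x => !![gen odd x, gen odd (x.1, x.2 + 1); 0, gen odd x]) (by
    intro x y
    have h1 := gen_mul_gen (odd := odd) x y
    have h2 := gen_mul_gen (odd := odd) x (y.1, y.2 + 1)
    have h3 := gen_mul_gen (odd := odd) (x.1, x.2 + 1) y
    ext i j
    fin_cases i <;> fin_cases j <;>
      simp [h1, h2, h3, Matrix.mul_apply, add_comm])

/-- The total derivative `∂ = d/dx`: the even derivation with `∂ u_i^{(k)} = u_i^{(k+1)}`. -/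
def D (odd : ι → Bool) : JetAlg odd →ₗ[ℂ] JetAlg odd :=
  Matrix.entryLinearMap ℂ (JetAlg odd) 0 1 ∘ₗ (totalHom odd).toLinearMap

theorem koszul_comm (i j : ι) : koszul odd i j = koszul odd j i := by
  simp [koszul, Bool.and_comm]

theorem koszul_mul_self (i j : ι) : koszul odd i j * koszul odd i j = 1 := by
  unfold koszul; split <;> norm_num

/-- `f ↦ [[f, f ∂/∂z], [0, σ_z f]]` as an algebra homomorphism, where `f ∂/∂z` is the right partial
derivative by the jet variable `z` and `σ_z` multiplies a jet variable `x` by `(-1)^{|z||x|}`. -/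
def pdHom [DecidableEq ι] (odd : ι → Bool) (z : ι × ℕ) :
    JetAlg odd →ₐ[ℂ] Matrix (Fin 2) (Fin 2) (JetAlg odd) :=
  lift (fun x => !![gen odd x, if x = z then 1 else 0; 0, koszul odd z.1 x.1 • gen odd x]) (by
    intro x y
    have h1 := gen_mul_gen (odd := odd) x y
    have h2 := koszul_comm (odd := odd) x.1 y.1
    have h3 := koszul_mul_self (odd := odd) x.1 y.1
    ext i j
    fin_cases i <;> fin_cases j
    · by_cases hy : y = z
      · subst hy
        simpa [Matrix.mul_apply] using h1
      · simpa [Matrix.mul_apply, hy] using h1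
    · by_cases hx : x = z <;> by_cases hy : y = z
      · subst hx; subst hy
        simp [Matrix.mul_apply, smul_smul, h3, add_comm]
      · subst hx
        simp [Matrix.mul_apply, hy]
      · subst hy
        simp [Matrix.mul_apply, hx, smul_smul, ← h2, h3]
      · simp [Matrix.mul_apply, hx, hy]
    · simp [Matrix.mul_apply]
    · simp [Matrix.mul_apply, h1, smul_smul]
      congr 1
      ring)

/-- The right partial derivative by the jet variable `z = u_i^{(k)}`: it is linear, takes `z` to `1`
and the other jet variables to `0`, and
`(f g) ∂/∂z = f (g ∂/∂z) + (-1)^{|z||g|} (f ∂/∂z) g`. -/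
def pd [DecidableEq ι] (odd : ι → Bool) (z : ι × ℕ) : JetAlg odd →ₗ[ℂ] JetAlg odd :=
  Matrix.entryLinearMap ℂ (JetAlg odd) 0 1 ∘ₗ (pdHom odd z).toLinearMap

/-- The variational derivative `δ/δu_i ∫ h dx = ∑_k (-∂)^k (h ∂/∂u_i^{(k)})` (a finite sum), so that
the first variation of `∫ h dx` is `∫ ∑_i (δ/δu_i ∫ h dx) δu_i dx`. -/
def euler [DecidableEq ι] (odd : ι → Bool) (i : ι) (h : JetAlg odd) : JetAlg odd :=
  ∑ᶠ k : ℕ, ((-D odd) ^ k : Module.End ℂ (JetAlg odd)) (pd odd (i, k) h)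

end JetAlg

open JetAlg

/-! ### The fields `u = (v, w, α, β)` -/

/-- The fields are numbered `v = 0`, `w = 1` (even), `α = 2`, `β = 3` (odd). -/
def oddField : Fin 4 → Bool := ![false, false, true, true]

/-- Differential superpolynomials in `v, w, α, β`. -/
abbrev Alg : Type := JetAlg oddField

/-- The field `u_i` itself. -/
def field (i : Fin 4) : Alg := gen oddField (i, 0)

abbrev fv : Alg := field 0
abbrev fw : Alg := field 1
abbrev fα : Alg := field 2
abbrev fβ : Alg := field 3

/-- `∂ = d/dx`. -/
abbrev dx : Module.End ℂ Alg := D oddField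

/-- The variational gradient `δ/δu ∫ h dx`. -/
def grad (h : Alg) : Fin 4 → Alg := fun i => euler oddField i h

/-! ### Matrix differential operators

`mul` interprets functions as multiplication operators, `d` is `∂` and `dinv` is `∂⁻¹`; products
are compositions. -/

section Operators

variable {E : Type} [Ring E] [Algebra ℂ E] (mul : Alg →ₐ[ℂ] E) (d dinv : E)

/-- The operator `J`. -/
def opJ : Matrix (Fin 4) (Fin 4) E :=
  let α := mul fα
  let β := mul fβ
  let h : ℂ := 1 / 2
  !![0, -d, 0, 0;
     -d, 0, -(h • α), h • β;
     0, -(h • α), 0, -(h • 1);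
     0, h • β, -(h • 1), 0]

/-- The row `ℓ = ½ (v∂, w∂, -α∂, -β∂)`, on which `∂⁻¹` acts in the recursion operator. -/
def recRow : Fin 4 → E :=
  let h : ℂ := 1 / 2
  ![h • (mul fv * d), h • (mul fw * d), -(h • (mul fα * d)), -(h • (mul fβ * d))]

/-- The part of the recursion operator without `∂⁻¹`. -/
def recLocal : Matrix (Fin 4) (Fin 4) E :=
  let v := mul fv
  let w := mul fw
  let α := mul fα
  let β := mul fβ
  let h : ℂ := 1 / 2
  let q : ℂ := 1 / 4
  !![h • d, h • w + 1, q • α, -(q • β);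
     2, -(h • d) + h • v, 0, α;
     2 * β - 2 * α * d, -(2 * α * (w + 1)), d + h • v, α * β - (2 * w + 2);
     -(2 * α), β, -1, -d + h • v]

/-- The recursion operator `𝓛`: its first row is `∂⁻¹ ℓ` plus the first row of `recLocal`, the other
rows contain no `∂⁻¹`. -/
def opL : Matrix (Fin 4) (Fin 4) E :=
  recLocal mul d +
    !![dinv * recRow mul d 0, dinv * recRow mul d 1, dinv * recRow mul d 2, dinv * recRow mul d 3;
       0, 0, 0, 0;
       0, 0, 0, 0;
       0, 0, 0, 0]

/-- The operator `R`. -/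
def opR : Matrix (Fin 4) (Fin 4) E :=
  let v := mul fv
  let w := mul fw
  let α := mul fα
  let β := mul fβ
  let h : ℂ := 1 / 2
  let q : ℂ := 1 / 4
  !![-(2 * d), h • (d * d) - h • (d * v), 0, -(d * α);
     -(h • (v * d)) - h • (d * d), -(h • (w * d)) - h • (d * w) - d,
       -(q • (d * α)) - q • (v * α) - h • β, q • (d * β) + (w + 1) * α + q • (v * β);
     0, q • (α * d) - q • (v * α) - h • β, h • 1, h • d - q • v;
     α * d, -(q • (β * d)) + (w + 1) * α + q • (v * β), -(h • d) - q • v, (w + 1) - α * β]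

end Operators

/-- `J` acting on differential superpolynomials. -/
def J : Matrix (Fin 4) (Fin 4) (Module.End ℂ Alg) := opJ (Algebra.lmul ℂ Alg) dx

/-- `R` acting on differential superpolynomials. -/
def R : Matrix (Fin 4) (Fin 4) (Module.End ℂ Alg) := opR (Algebra.lmul ℂ Alg) dx

/-- The action of a matrix of operators on a column. -/
def act (P : Matrix (Fin 4) (Fin 4) (Module.End ℂ Alg)) (G : Fin 4 → Alg) : Fin 4 → Alg :=
  fun i => ∑ j, P i j (G j)

/-- `G' = 𝓛 G`, where `∂⁻¹` stands for some antiderivative `s` (determined up to a constant) of the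
differential superpolynomial it is applied to. -/
def RecursionRel (G G' : Fin 4 → Alg) : Prop :=
  ∃ s : Alg, dx s = ∑ j, recRow (Algebra.lmul ℂ Alg) dx j (G j) ∧
    G' = act (recLocal (Algebra.lmul ℂ Alg) dx) G + ![s, 0, 0, 0]

/-- A density of the super Poisson bracket `{∫f, ∫g} = ∫ (δf/δu)ᵀ P (δg/δu) dx`. -/
def bracket (P : Matrix (Fin 4) (Fin 4) (Module.End ℂ Alg)) (f g : Alg) : Alg :=
  ∑ i, grad f i * act P (grad g) i

/-- `P` is a super-Hamiltonian operator: its bracket of even functionals (densities modulo total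
derivatives) is skew-symmetric and satisfies the Jacobi identity. -/
structure IsSuperHamiltonian (P : Matrix (Fin 4) (Fin 4) (Module.End ℂ Alg)) : Prop where
  even : ∀ f g : Alg, IsEven f → IsEven g → IsEven (bracket P f g)
  skew : ∀ f g : Alg, IsEven f → IsEven g →
    bracket P f g + bracket P g f ∈ LinearMap.range dx
  jacobi : ∀ f g h : Alg, IsEven f → IsEven g → IsEven h →
    bracket P (bracket P f g) h + bracket P (bracket P g h) f + bracket P (bracket P h f) g ∈
      LinearMap.range dx

/-! ### The spectral problem -/

/-- Formal Laurent series in `z = λ⁻¹` (finitely many positive powers of `λ`). -/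
abbrev Ser : Type := LaurentSeries Alg

/-- The spectral parameter `λ = z⁻¹`. -/
def lam : Ser := HahnSeries.single (-1 : ℤ) 1

/-- A series that is constant in `λ`. -/
abbrev con : Alg →+* Ser := HahnSeries.C

/-- `∂/∂λ = -z² ∂/∂z`. -/
def dlam (f : Ser) : Ser := -(HahnSeries.single (2 : ℤ) 1 * LaurentSeries.derivative ℂ f)

/-- A linear map of `Alg` applied to all coefficients of the entries of a matrix. -/
def mapCoeff (T : Alg →ₗ[ℂ] Alg) (X : Matrix (Fin 3) (Fin 3) Ser) : Matrix (Fin 3) (Fin 3) Ser :=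
  X.map fun f => f.map T

/-- The supertrace. -/
def str (X : Matrix (Fin 3) (Fin 3) Ser) : Ser := X 0 0 + X 1 1 - X 2 2

/-- The spectral matrix `M`. -/
def specM : Matrix (Fin 3) (Fin 3) Ser :=
  let h : ℂ := 1 / 2
  !![-lam + con (h • fv), 1, con fα;
     con (-(2 * fw) - 2), lam - con (h • fv), con fβ;
     con fβ, -con fα, 0]

/-- The coefficients `a_m, b_m, c_m, ρ_m, δ_m` of `N`. -/
@[ext] structure Coeffs where
  a : ℕ → Alg
  b : ℕ → Alg
  c : ℕ → Alg
  ρ : ℕ → Alg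
  δ : ℕ → Alg

namespace Coeffs

variable (N : Coeffs)

/-- The coefficient of `λ^{-m}` in `N`. -/
def mat (m : ℕ) : Matrix (Fin 3) (Fin 3) Alg :=
  !![N.a m, N.b m, N.ρ m;
     -(2 * N.b m) + 2 * N.c m, -N.a m, N.δ m;
     N.δ m, -N.ρ m, 0]

/-- `N = ∑_{m ≥ 0} N_m λ^{-m}`. -/
def ser : Matrix (Fin 3) (Fin 3) Ser :=
  Matrix.of fun i j => HahnSeries.ofPowerSeries ℤ Alg (PowerSeries.mk fun m => N.mat m i j)

/-- `N` is an even element with `N_x = [M, N]` and the initial values `a_0 = k₀`,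
`b_0 = c_0 = ρ_0 = δ_0 = 0`. The integration constants in `a_1, a_2, …` are free. -/
structure IsSolution (k₀ : ℂ) : Prop where
  even : ∀ m, IsEven (N.a m) ∧ IsEven (N.b m) ∧ IsEven (N.c m)
  odd : ∀ m, IsOdd (N.ρ m) ∧ IsOdd (N.δ m)
  init : N.a 0 = algebraMap ℂ Alg k₀ ∧ N.b 0 = 0 ∧ N.c 0 = 0 ∧ N.ρ 0 = 0 ∧ N.δ 0 = 0
  stationary : mapCoeff dx N.ser = specM * N.ser - N.ser * specM

/-- The integration constants are chosen such that `Str N²` does not depend on `λ`. -/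
def IsNormalized (k₀ : ℂ) : Prop := str (N.ser * N.ser) = con (algebraMap ℂ Alg (2 * k₀ ^ 2))

/-- `G_n = (a_n, -2 b_n, -2 δ_n, 2 ρ_n)`. -/
def vec (n : ℕ) : Fin 4 → Alg := ![N.a n, -(2 * N.b n), -(2 * N.δ n), 2 * N.ρ n]

/-- `N^{(n)} = ∑_{m ≤ n} N_m λ^{n-m} + b_{n+1} diag(1, -1, 0)`. -/
def aux (n : ℕ) : Matrix (Fin 3) (Fin 3) Ser :=
  (Matrix.of fun i j =>
    ∑ m ∈ Finset.range (n + 1), HahnSeries.single ((m : ℤ) - (n : ℤ)) (N.mat m i j)) +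
  !![con (N.b (n + 1)), 0, 0; 0, -con (N.b (n + 1)), 0; 0, 0, 0]

/-- `T = ∂/∂t_n` is the `n`-th flow: a derivation commuting with `∂/∂x`, for which the zero curvature
equation `M_t - N^{(n)}_x + [M, N^{(n)}] = 0` holds. -/
structure IsFlow (n : ℕ) (T : Alg →ₗ[ℂ] Alg) : Prop where
  leibniz : ∀ f g, T (f * g) = T f * g + f * T g
  comm : ∀ f, T (dx f) = dx (T f)
  zeroCurvature :
    mapCoeff T specM - mapCoeff dx (N.aux n) + (specM * N.aux n - N.aux n * specM) = 0

/-- The density of `H̃_n`: `2 a_{n+1} / n` for `n ≥ 1`, and `k₀ v` for `n = 0`. -/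
def ham (k₀ : ℂ) (n : ℕ) : Alg :=
  if n = 0 then k₀ • fv else (2 / (n : ℂ)) • N.a (n + 1)

end Coeffs

/-- `u_t = J δ(∫h₁)/δu = J𝓛 δ(∫h₀)/δu` for the flow `T = ∂/∂t`. The second form is stated both with
`R` and with `J` applied to any value of `𝓛 δ(∫h₀)/δu`, one of which is `δ(∫h₁)/δu`. -/
structure BiHamiltonianForm (T : Alg →ₗ[ℂ] Alg) (h₀ h₁ : Alg) : Prop where
  first : (fun i => T (field i)) = act J (grad h₁)
  recursion : RecursionRel (grad h₀) (grad h₁)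
  second : ∀ G, RecursionRel (grad h₀) G → (fun i => T (field i)) = act J G
  secondR : (fun i => T (field i)) = act R (grad h₀)

end

end SuperGBK

/-! Four arguments carry the theorem.

Calculus on jets. An even derivation, or a right partial derivative, is the off-diagonal entry of an
algebra homomorphism into upper triangular 2×2 matrices, so it is defined on all of the algebra by
its values on the jets. This gives the first variation formula (`ev_sub_sum_euler_mem`), ker ∂ = ℂ
(`eq_algebraMap_of_D_eq_zero`) and the fundamental lemma: g = 0 as soon as ∑ gᵢXᵢ is a total
derivative for every X of the right parity (`eq_zero_of_sum_mul_mem`). The long polynomial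
identities are left to a normal form procedure that is proved sound (`eq_of_check`,
`mem_range_of_check`).

Hamiltonian operators. Second variations are self-adjoint, so they cancel in the cyclic sum of the
Jacobi identity for a skew-adjoint P. What remains is the trilinear form built from the derivative
of the coefficients of P. For c₁J + c₂R it is a total derivative for arbitrary covectors, with c₁,
c₂ indeterminate (`pencil_jacobi`); this contains the compatibility.

Solutions. In z = 1/λ the stationary equation determines b, g = N₂₁, ρ, δ algebraically and a only
through ∂a. Prescribing Str N² = 2k₀² determines a algebraically as well, and the equation for ∂a
then follows by differentiating this invariant, because a is a unit (`eq_a_of_invariant`). So no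
element has to be shown to be a total derivative in order to construct the normalized N. Since ker ∂
= ℂ, a solution is determined by the values of the aₘ at zero fields; hence any solution is a scalar
power series f(z) with f(0) = 1 times the normalized one.

Gradients. A normalized N has the eigenvalue k₀, with eigenvector (1, s, σ), and (s, σ) satisfies
the Riccati equations of φₓ = Mφ, in which φ₁ has the logarithmic derivative χ = -λ + v/2 + s + ασ.
As in first-order perturbation theory, k₀ times the variation of χ equals half the supertrace of N
times the variation of M, up to total derivatives (`RiccatiForm.variation`). Varying λ shows that
2aₙ₊₁ is 2k₀n(s + ασ)ₙ modulo ∂; varying the fields shows that the gradient of 2k₀(v/2 + s + ασ)ₙ is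
Gₙ. Together, δ∫2aₙ₊₁/δu = nGₙ, which is the super-trace identity with γ = 0. For N' = fN the same
formula would force ∑ⱼ j fⱼ Gₙ₋ⱼ = 0 for all n ≥ 1, hence f = 1.

The flows come from truncating λⁿN: the zero curvature expression is constant in λ and its entries
prescribe the derivatives of the fields. The forms with J, 𝓛 and R are consequences of the recursion
for the coefficients. -/

namespace SuperGBK
noncomputable section
-- Differential calculus in the free supercommutative jet algebra
namespace JetAlg

variable {ι : Type} {odd : ι → Bool}

/-- Induction over the algebra generated by the jet variables. -/
theorem induction {P : JetAlg odd → Prop} (hc : ∀ c : ℂ, P (algebraMap ℂ _ c))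
    (hg : ∀ x, P (gen odd x)) (ha : ∀ f g, P f → P g → P (f + g))
    (hm : ∀ f g, P f → P g → P (f * g)) (f : JetAlg odd) : P f := by
  obtain ⟨f, rfl⟩ := RingQuot.mkAlgHom_surjective ℂ (JetRel odd) f
  refine FreeAlgebra.induction (R := ℂ) (X := ι × ℕ)
    (motive := fun f => P (RingQuot.mkAlgHom ℂ (JetRel odd) f)) ?_ ?_ ?_ ?_ f
  · intro r
    rw [AlgHom.commutes]
    exact hc r
  · exact hg
  · intro a b h1 h2
    rw [map_mul]
    exact hm _ _ h1 h2
  · intro a b h1 h2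
    rw [map_add]
    exact ha _ _ h1 h2

/-! #### The total derivative -/

theorem totalHom_apply (f : JetAlg odd) : totalHom odd f = !![f, D odd f; 0, f] := by
  have h : ∀ f : JetAlg odd, totalHom odd f 0 0 = f ∧ totalHom odd f 1 0 = 0 ∧
      totalHom odd f 1 1 = f := by
    intro f
    induction f using induction with
    | hc c =>
      rw [AlgHom.commutes]
      simp [Matrix.algebraMap_matrix_apply]
    | hg x => simp [totalHom]
    | ha f g hf hg => simp [hf, hg]
    | hm f g hf hg => simp [hf, hg, Matrix.mul_apply]
  ext i j
  fin_cases i <;> fin_cases j <;> simp [h, D]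

theorem D_mul (f g : JetAlg odd) : D odd (f * g) = D odd f * g + f * D odd g := by
  have h := congrArg (fun M => M 0 1) (map_mul (totalHom odd) f g)
  simpa [totalHom_apply, Matrix.mul_apply, add_comm] using h

@[simp] theorem D_gen (x : ι × ℕ) : D odd (gen odd x) = gen odd (x.1, x.2 + 1) := by
  simp [D, totalHom]

@[simp] theorem D_algebraMap (c : ℂ) : D odd (algebraMap ℂ _ c) = 0 := by
  have h := congrArg (fun M => M 0 1) ((totalHom odd).commutes c)
  rw [totalHom_apply] at h
  simpa [Matrix.algebraMap_matrix_apply] using h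

@[simp] theorem D_one : D odd 1 = 0 := by
  simpa using D_algebraMap (odd := odd) 1

/-! #### Parity -/

@[simp] theorem parity_gen (x : ι × ℕ) :
    parity odd (gen odd x) = (if odd x.1 then (-1 : ℂ) else 1) • gen odd x := by
  simp [parity]

theorem parity_D (f : JetAlg odd) : parity odd (D odd f) = D odd (parity odd f) := by
  induction f using induction with
  | hc c => simp
  | hg x => rw [parity_gen, map_smul, D_gen, parity_gen]
  | ha f g hf hg => simp [hf, hg]
  | hm f g hf hg => simp [D_mul, hf, hg]

/-- The twist `σ_z`, multiplying a jet variable `x` by the Koszul sign of `z` and `x`. -/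
def twist (odd : ι → Bool) (b : Bool) : JetAlg odd →ₐ[ℂ] JetAlg odd :=
  if b then parity odd else AlgHom.id ℂ _

theorem twist_gen (i : ι) (x : ι × ℕ) :
    twist odd (odd i) (gen odd x) = koszul odd i x.1 • gen odd x := by
  by_cases hi : odd i <;> by_cases hx : odd x.1 <;> simp [twist, koszul, hi, hx]

/-- The Koszul rule for generators extends multiplicatively: moving f past x applies the sign
automorphism of x to f. -/
theorem gen_mul (x : ι × ℕ) (f : JetAlg odd) :
    gen odd x * f = twist odd (odd x.1) f * gen odd x := by
  induction f using induction with
  | hc c => rw [AlgHom.commutes, Algebra.commutes]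
  | hg y => rw [gen_mul_gen, twist_gen, smul_mul_assoc]
  | ha f g hf hg => rw [mul_add, hf, hg, map_add, add_mul]
  | hm f g hf hg => rw [← mul_assoc, hf, mul_assoc, hg, map_mul, mul_assoc]

theorem IsEven.mul_comm {f : JetAlg odd} (hf : IsEven f) (g : JetAlg odd) : f * g = g * f := by
  induction g using induction with
  | hc c => rw [Algebra.commutes]
  | hg y =>
    rw [gen_mul]
    by_cases hy : odd y.1
    · simp [twist, hy, show parity odd f = f from hf]
    · simp [twist, hy]
  | ha g h hg hh => rw [mul_add, hg, hh, add_mul]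
  | hm g h hg hh => rw [← mul_assoc, hg, mul_assoc, hh, mul_assoc]

theorem IsOdd.mul_eq {f : JetAlg odd} (hf : IsOdd f) (g : JetAlg odd) :
    f * g = parity odd g * f := by
  induction g using induction with
  | hc c => rw [AlgHom.commutes, Algebra.commutes]
  | hg y =>
    have h := gen_mul y f
    by_cases hy : odd y.1
    · simp only [twist, hy, if_true, show parity odd f = -f from hf] at h
      simp [hy, h]
    · simp only [twist, hy, Bool.false_eq_true, if_false, AlgHom.id_apply] at h
      simp [hy, h]
  | ha g h hg hh => rw [mul_add, hg, hh, map_add, add_mul]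
  | hm g h hg hh => rw [← mul_assoc, hg, mul_assoc, hh, map_mul, mul_assoc]

theorem IsOdd.anticomm {f g : JetAlg odd} (hf : IsOdd f) (hg : IsOdd g) : f * g = -(g * f) := by
  rw [hf.mul_eq, show parity odd g = -g from hg, neg_mul]

/-- `f` has the parity `b`. -/
def HasParity (b : Bool) (f : JetAlg odd) : Prop := parity odd f = (if b then (-1 : ℂ) else 1) • f

theorem hasParity_false {f : JetAlg odd} : HasParity false f ↔ IsEven f := by
  simp [HasParity, IsEven]

theorem hasParity_true {f : JetAlg odd} : HasParity true f ↔ IsOdd f := by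
  simp [HasParity, IsOdd]

theorem hasParity_gen (x : ι × ℕ) : HasParity (odd x.1) (gen odd x) := by
  simp [HasParity]

theorem HasParity.zero (b : Bool) : HasParity b (0 : JetAlg odd) := by simp [HasParity]

theorem HasParity.add {b : Bool} {f g : JetAlg odd} (hf : HasParity b f) (hg : HasParity b g) :
    HasParity b (f + g) := by
  unfold HasParity at *
  rw [map_add, hf, hg, smul_add]

theorem HasParity.neg {b : Bool} {f : JetAlg odd} (hf : HasParity b f) : HasParity b (-f) := by
  unfold HasParity at *
  rw [map_neg, hf, smul_neg]

theorem HasParity.sub {b : Bool} {f g : JetAlg odd} (hf : HasParity b f) (hg : HasParity b g) :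
    HasParity b (f - g) := by
  rw [sub_eq_add_neg]
  exact hf.add hg.neg

theorem HasParity.mul {b c : Bool} {f g : JetAlg odd} (hf : HasParity b f) (hg : HasParity c g) :
    HasParity (xor b c) (f * g) := by
  unfold HasParity at *
  rw [map_mul, hf, hg, smul_mul_smul_comm]
  congr 1
  cases b <;> cases c <;> simp

theorem HasParity.D {b : Bool} {f : JetAlg odd} (hf : HasParity b f) :
    HasParity b (JetAlg.D odd f) := by
  unfold HasParity at *
  rw [parity_D, hf, map_smul]

theorem HasParity.D_pow {b : Bool} {f : JetAlg odd} (hf : HasParity b f) (k : ℕ) :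
    HasParity b ((JetAlg.D odd ^ k) f) := by
  induction k with
  | zero => simpa using hf
  | succ k ih =>
    rw [pow_succ', Module.End.mul_apply]
    exact ih.D

theorem HasParity.sum {b : Bool} {κ : Type*} (s : Finset κ) {f : κ → JetAlg odd}
    (hf : ∀ i ∈ s, HasParity b (f i)) : HasParity b (∑ i ∈ s, f i) :=
  Finset.sum_induction f _ (fun _ _ => HasParity.add) (HasParity.zero b) hf

/-- A homogeneous element moves past any element at the cost of a twist. -/
theorem HasParity.mul_twist {b : Bool} {f : JetAlg odd} (hf : HasParity b f) (g : JetAlg odd) :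
    f * g = twist odd b g * f := by
  cases b
  · simpa [twist] using (hasParity_false.1 hf).mul_comm g
  · simpa [twist] using (hasParity_true.1 hf).mul_eq g

theorem twist_D (b : Bool) (f : JetAlg odd) : twist odd b (D odd f) = D odd (twist odd b f) := by
  cases b <;> simp [twist, parity_D]

theorem HasParity.twist_mul {b : Bool} {f : JetAlg odd} (hf : HasParity b f) (g : JetAlg odd) :
    twist odd b g * f = f * g := (hf.mul_twist g).symm

/-! #### Even derivations -/

section Der

variable {X : ι × ℕ → JetAlg odd}

theorem HasParity.twist_eq {b : Bool} {f : JetAlg odd} (hf : HasParity b f) (i j : ι)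
    (hb : odd j = b) : twist odd (odd i) f = koszul odd i j • f := by
  subst hb
  unfold HasParity at hf
  by_cases hi : odd i <;> by_cases hj : odd j <;> simp_all [twist, koszul]

/-- `f ↦ [[f, T f], [0, f]]`, where `T` is the even derivation with prescribed values on the jet
variables. -/
def derHom (X : ι × ℕ → JetAlg odd) (hX : ∀ x, HasParity (odd x.1) (X x)) :
    JetAlg odd →ₐ[ℂ] Matrix (Fin 2) (Fin 2) (JetAlg odd) :=
  lift (fun x => !![gen odd x, X x; 0, gen odd x]) (by
    intro x y
    have h1 := gen_mul_gen (odd := odd) x y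
    have h2 : gen odd x * X y = koszul odd x.1 y.1 • (X y * gen odd x) := by
      rw [gen_mul, (hX y).twist_eq x.1 y.1 rfl, smul_mul_assoc]
    have h3 : X x * gen odd y = koszul odd x.1 y.1 • (gen odd y * X x) := by
      rw [gen_mul, (hX x).twist_eq y.1 x.1 rfl, smul_mul_assoc, smul_smul, koszul_comm y.1 x.1,
        koszul_mul_self, one_smul]
    ext i j
    fin_cases i <;> fin_cases j <;> simp [h1, h2, h3, Matrix.mul_apply, add_comm])

/-- The even derivation with prescribed values on the jet variables. -/
def der (X : ι × ℕ → JetAlg odd) (hX : ∀ x, HasParity (odd x.1) (X x)) :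
    JetAlg odd →ₗ[ℂ] JetAlg odd :=
  Matrix.entryLinearMap ℂ (JetAlg odd) 0 1 ∘ₗ (derHom X hX).toLinearMap

variable (hX : ∀ x, HasParity (odd x.1) (X x))

theorem derHom_apply (f : JetAlg odd) : derHom X hX f = !![f, der X hX f; 0, f] := by
  have h : ∀ f : JetAlg odd, derHom X hX f 0 0 = f ∧ derHom X hX f 1 0 = 0 ∧
      derHom X hX f 1 1 = f := by
    intro f
    induction f using induction with
    | hc c =>
      rw [AlgHom.commutes]
      simp [Matrix.algebraMap_matrix_apply]
    | hg x => simp [derHom]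
    | ha f g hf hg => simp [hf, hg]
    | hm f g hf hg => simp [hf, hg, Matrix.mul_apply]
  ext i j
  fin_cases i <;> fin_cases j <;> simp [h, der]

theorem der_mul (f g : JetAlg odd) : der X hX (f * g) = der X hX f * g + f * der X hX g := by
  have h := congrArg (fun M => M 0 1) (map_mul (derHom X hX) f g)
  simpa [derHom_apply, Matrix.mul_apply, add_comm] using h

@[simp] theorem der_gen (x : ι × ℕ) : der X hX (gen odd x) = X x := by
  simp [der, derHom]

@[simp] theorem der_algebraMap (c : ℂ) : der X hX (algebraMap ℂ _ c) = 0 := by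
  have h := congrArg (fun M => M 0 1) ((derHom X hX).commutes c)
  rw [derHom_apply] at h
  simpa [Matrix.algebraMap_matrix_apply] using h

end Der

/-! #### Scaling and augmentation -/

/-- The homomorphism `u_i^{(k)} ↦ t u_i^{(k)}` into the polynomials in `t`. -/
def scaleHom (odd : ι → Bool) : JetAlg odd →ₐ[ℂ] Polynomial (JetAlg odd) :=
  lift (fun x => Polynomial.C (gen odd x) * Polynomial.X) (by
    intro x y
    have h : ∀ a b : JetAlg odd, Polynomial.C a * Polynomial.X * (Polynomial.C b * Polynomial.X) =
        Polynomial.C (a * b) * Polynomial.X ^ 2 := by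
      intro a b
      rw [mul_assoc, ← mul_assoc Polynomial.X, Polynomial.X_mul_C, mul_assoc, ← mul_assoc, pow_two,
        Polynomial.C_mul]
    rw [h, h, gen_mul_gen, ← Polynomial.smul_C, smul_mul_assoc])

/-- Here t d/dt corresponds to the Euler field ∑ u ∂/∂u: both obey the Leibniz rule and they agree
on the jets. It lets an element be recovered from its partial derivatives. -/
theorem scaleHom_derivative (f : JetAlg odd) :
    Polynomial.derivative (scaleHom odd f) * Polynomial.X =
      scaleHom odd (der (gen odd) hasParity_gen f) := by
  induction f using induction with
  | hc c =>
    rw [AlgHom.commutes, der_algebraMap, map_zero, Polynomial.algebraMap_apply]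
    simp
  | hg x => simp [scaleHom]
  | ha f g hf hg => simp only [map_add, add_mul, hf, hg]
  | hm f g hf hg =>
    rw [map_mul, Polynomial.derivative_mul, add_mul, der_mul, map_add, map_mul, map_mul, ← hf, ← hg,
      mul_assoc, mul_assoc, mul_assoc, Polynomial.X_mul]

theorem eval_scaleHom (f : JetAlg odd) : (scaleHom odd f).eval 1 = f := by
  -- The coefficients do not commute, so evaluation is multiplicative only at central points such as
  -- 1.
  let e : Polynomial (JetAlg odd) →+* JetAlg odd :=
    Polynomial.eval₂RingHom' (RingHom.id _) 1 fun a => Commute.one_right _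
  have he : ∀ p, e p = p.eval 1 := fun p => rfl
  induction f using induction with
  | hc c => rw [AlgHom.commutes, Polynomial.algebraMap_apply]; simp
  | hg x => simp [scaleHom]
  | ha f g hf hg => simp [hf, hg]
  | hm f g hf hg => rw [← he, map_mul, map_mul, he, he, hf, hg]

/-- The augmentation: the value at zero fields. -/
def aug (odd : ι → Bool) : JetAlg odd →ₐ[ℂ] ℂ := lift (fun _ => 0) (by simp)

@[simp] theorem aug_gen (x : ι × ℕ) : aug odd (gen odd x) = 0 := by simp [aug]

theorem algebraMap_injective : Function.Injective (algebraMap ℂ (JetAlg odd)) := by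
  intro a b h
  simpa using congrArg (aug odd) h

theorem scaleHom_coeff_zero (f : JetAlg odd) :
    (scaleHom odd f).coeff 0 = algebraMap ℂ _ (aug odd f) := by
  induction f using induction with
  | hc c => rw [AlgHom.commutes, Polynomial.algebraMap_apply]; simp
  | hg x => simp [scaleHom]
  | ha f g hf hg => simp [hf, hg]
  | hm f g hf hg => simp [hf, hg, Polynomial.mul_coeff_zero]

/-! #### Partial derivatives -/

variable [DecidableEq ι]

theorem pdHom_apply (z : ι × ℕ) (f : JetAlg odd) :
    pdHom odd z f = !![f, pd odd z f; 0, twist odd (odd z.1) f] := by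
  have h : ∀ f : JetAlg odd, pdHom odd z f 0 0 = f ∧ pdHom odd z f 1 0 = 0 ∧
      pdHom odd z f 1 1 = twist odd (odd z.1) f := by
    intro f
    induction f using induction with
    | hc c =>
      rw [AlgHom.commutes, AlgHom.commutes]
      simp [Matrix.algebraMap_matrix_apply]
    | hg x => simp [pdHom, twist_gen]
    | ha f g hf hg => simp [hf, hg]
    | hm f g hf hg => simp [hf, hg, Matrix.mul_apply]
  ext i j
  fin_cases i <;> fin_cases j <;> simp [h, pd]

theorem pd_mul (z : ι × ℕ) (f g : JetAlg odd) :
    pd odd z (f * g) = f * pd odd z g + pd odd z f * twist odd (odd z.1) g := by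
  have h := congrArg (fun M => M 0 1) (map_mul (pdHom odd z) f g)
  simpa [pdHom_apply, Matrix.mul_apply] using h

theorem pd_gen (z x : ι × ℕ) : pd odd z (gen odd x) = if x = z then 1 else 0 := by
  simp [pd, pdHom]

@[simp] theorem pd_algebraMap (z : ι × ℕ) (c : ℂ) : pd odd z (algebraMap ℂ _ c) = 0 := by
  have h := congrArg (fun M => M 0 1) ((pdHom odd z).commutes c)
  rw [pdHom_apply] at h
  simpa [Matrix.algebraMap_matrix_apply] using h

theorem pd_parity (z : ι × ℕ) (f : JetAlg odd) :
    parity odd (pd odd z f) = (if odd z.1 then (-1 : ℂ) else 1) • pd odd z (parity odd f) := by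
  induction f using induction with
  | hc c => simp
  | hg x =>
    rw [pd_gen, parity_gen, map_smul, pd_gen]
    split_ifs with h1 h2 <;> simp_all
  | ha f g hf hg => simp [hf, hg]
  | hm f g hf hg =>
    have ht : parity odd (twist odd (odd z.1) g) = twist odd (odd z.1) (parity odd g) := by
      cases odd z.1 <;> simp [twist]
    simp only [map_mul, pd_mul, map_add, hf, hg, ht, smul_add, mul_smul_comm, smul_mul_assoc]

theorem HasParity.pd {b : Bool} {f : JetAlg odd} (hf : HasParity b f) (z : ι × ℕ) :
    HasParity (xor b (odd z.1)) (JetAlg.pd odd z f) := by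
  unfold HasParity at *
  rw [pd_parity, hf, map_smul, smul_smul]
  congr 1
  cases b <;> cases odd z.1 <;> simp

/-- The commutator of ∂/∂u⁽ᵏ⁺¹⁾ with the total derivative is ∂/∂u⁽ᵏ⁾. This relation drives all
arguments by jet order below. -/
theorem pd_succ_D (i : ι) (k : ℕ) (f : JetAlg odd) :
    pd odd (i, k + 1) (D odd f) = D odd (pd odd (i, k + 1) f) + pd odd (i, k) f := by
  induction f using induction with
  | hc c => simp
  | hg x =>
    obtain ⟨j, l⟩ := x
    simp only [D_gen, pd_gen, Prod.mk.injEq, Nat.add_right_cancel_iff]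
    by_cases h : j = i ∧ l = k + 1 <;> by_cases h' : j = i ∧ l = k <;> simp [h, h']
  | ha f g hf hg =>
    simp only [map_add, hf, hg]
    abel
  | hm f g hf hg =>
    simp only [map_add, D_mul, pd_mul, hf, hg, twist_D, mul_add, add_mul]
    abel

theorem pd_zero_D (i : ι) (f : JetAlg odd) :
    pd odd (i, 0) (D odd f) = D odd (pd odd (i, 0) f) := by
  induction f using induction with
  | hc c => simp
  | hg x =>
    obtain ⟨j, l⟩ := x
    simp only [D_gen, pd_gen, Prod.mk.injEq]
    by_cases h : j = i ∧ l = 0 <;> simp [h]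
  | ha f g hf hg => simp only [map_add, hf, hg]
  | hm f g hf hg =>
    simp only [map_add, D_mul, pd_mul, hf, hg, twist_D]
    abel

/-- `f` does not depend on jets of order `K` or higher. -/
def OrderLT (K : ℕ) (f : JetAlg odd) : Prop := ∀ z : ι × ℕ, K ≤ z.2 → pd odd z f = 0

theorem OrderLT.mono {K L : ℕ} {f : JetAlg odd} (h : OrderLT K f) (hKL : K ≤ L) : OrderLT L f :=
  fun z hz => h z (hKL.trans hz)

theorem OrderLT.mul {K : ℕ} {f g : JetAlg odd} (hf : OrderLT K f) (hg : OrderLT K g) :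
    OrderLT K (f * g) := fun z hz => by simp [pd_mul, hf z hz, hg z hz]

theorem orderLT_gen {K : ℕ} {x : ι × ℕ} (hx : x.2 < K) : OrderLT K (gen odd x) := by
  intro z hz
  rw [pd_gen, if_neg]
  rintro rfl
  omega

theorem exists_orderLT (f : JetAlg odd) : ∃ K, OrderLT K f := by
  induction f using induction with
  | hc c => exact ⟨0, fun z _ => by simp⟩
  | hg x => exact ⟨x.2 + 1, orderLT_gen (Nat.lt_succ_self _)⟩
  | ha f g hf hg =>
    obtain ⟨K, hK⟩ := hf
    obtain ⟨L, hL⟩ := hg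
    exact ⟨max K L, fun z hz => by
      simp [hK z (le_of_max_le_left hz), hL z (le_of_max_le_right hz)]⟩
  | hm f g hf hg =>
    obtain ⟨K, hK⟩ := hf
    obtain ⟨L, hL⟩ := hg
    exact ⟨max K L, (hK.mono (le_max_left _ _)).mul (hL.mono (le_max_right _ _))⟩

/-- The chain rule. The values X stand to the right of the right derivatives: in the product rule,
the twist of the second factor is undone by moving it past X. "For all large K" makes the statement
stable under sums and products. -/
theorem der_eq_sum_pd [Fintype ι] {X : ι × ℕ → JetAlg odd}
    (hX : ∀ x, HasParity (odd x.1) (X x)) (f : JetAlg odd) :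
    ∀ᶠ K in Filter.atTop,
      der X hX f = ∑ i, ∑ k ∈ Finset.range K, pd odd (i, k) f * X (i, k) := by
  induction f using induction with
  | hc c => simp
  | hg x =>
    filter_upwards [Filter.eventually_gt_atTop x.2] with K hK
    simp only [der_gen, pd_gen]
    rw [Finset.sum_eq_single x.1, Finset.sum_eq_single x.2]
    · simp
    · intro k _ hk
      rw [if_neg, zero_mul]
      exact fun h => hk (congrArg Prod.snd h).symm
    · intro h
      exact absurd (Finset.mem_range.2 hK) h
    · intro i _ hi
      refine Finset.sum_eq_zero fun k _ => ?_
      rw [if_neg, zero_mul]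
      exact fun h => hi (congrArg Prod.fst h).symm
    · simp
  | ha f g hf hg =>
    filter_upwards [hf, hg] with K h1 h2
    simp only [map_add, h1, h2, add_mul, Finset.sum_add_distrib]
  | hm f g hf hg =>
    filter_upwards [hf, hg] with K h1 h2
    simp only [der_mul, h1, h2, pd_mul, add_mul, Finset.sum_add_distrib, Finset.sum_mul,
      Finset.mul_sum]
    rw [add_comm]
    congr 1
    · simp only [mul_assoc]
    · refine Finset.sum_congr rfl fun i _ => Finset.sum_congr rfl fun k _ => ?_
      rw [mul_assoc, mul_assoc, (hX (i, k)).twist_mul]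

/-! #### The kernel of the total derivative -/

/-- If all partial derivatives of `f` vanish, then `f` is constant. -/
theorem eq_algebraMap_of_pd_eq_zero [Fintype ι] {f : JetAlg odd} (hf : ∀ z, pd odd z f = 0) :
    f = algebraMap ℂ _ (aug odd f) := by
  -- The Euler field kills f, so the polynomial f(tu) has zero derivative in t and takes the same
  -- value at t = 1 as at t = 0.
  have h0 : der (gen odd) hasParity_gen f = 0 := by
    obtain ⟨K, hK⟩ := (der_eq_sum_pd (X := gen odd) hasParity_gen f).exists
    simpa [hf] using hK
  have h1 := scaleHom_derivative f
  rw [h0, map_zero] at h1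
  have h2 : scaleHom odd f = Polynomial.C (algebraMap ℂ _ (aug odd f)) := by
    ext n
    cases n with
    | zero => rw [scaleHom_coeff_zero, Polynomial.coeff_C_zero]
    | succ n =>
      have h3 := congrArg (fun p => p.coeff (n + 1)) h1
      simp only [Polynomial.coeff_mul_X, Polynomial.coeff_derivative, Polynomial.coeff_zero] at h3
      rw [Polynomial.coeff_C_succ]
      have h4 : ((n : ℂ) + 1) • (scaleHom odd f).coeff (n + 1) = 0 := by
        rw [Algebra.smul_def, Algebra.commutes]
        simpa using h3
      exact (smul_eq_zero.1 h4).resolve_left (by exact_mod_cast Nat.succ_ne_zero n)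
  conv_lhs => rw [← eval_scaleHom f, h2, Polynomial.eval_C]

/-- If f has order below K and ∂f = 0, the commutator relation gives ∂f/∂u⁽ᴷ⁻¹⁾ = 0. Descending in
the order removes every jet. -/
theorem eq_algebraMap_of_D_eq_zero [Fintype ι] {f : JetAlg odd} (hf : D odd f = 0) :
    f = algebraMap ℂ _ (aug odd f) := by
  apply eq_algebraMap_of_pd_eq_zero
  obtain ⟨K, hK⟩ := exists_orderLT f
  have key : ∀ n, n ≤ K → OrderLT (K - n) f := by
    intro n
    induction n with
    | zero => intro _; simpa using hK
    | succ n ih =>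
      intro hn z hz
      by_cases h : K - n ≤ z.2
      · exact ih (by omega) z h
      · have h1 := pd_succ_D z.1 z.2 f
        rw [hf, map_zero, ih (by omega) (z.1, z.2 + 1) (by simp only; omega), map_zero,
          zero_add] at h1
        exact h1.symm
  intro z
  exact key K le_rfl z (by simp)

end JetAlg
end
end SuperGBK

namespace SuperGBK
noncomputable section
namespace JetAlg

variable {ι : Type} {odd : ι → Bool}

/-! #### Evolutionary derivations -/

theorem der_parity {X : ι × ℕ → JetAlg odd} (hX : ∀ x, HasParity (odd x.1) (X x))
    (f : JetAlg odd) : parity odd (der X hX f) = der X hX (parity odd f) := by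
  induction f using induction with
  | hc c => simp
  | hg x => rw [parity_gen, map_smul, der_gen, hX x]
  | ha f g hf hg => simp [hf, hg]
  | hm f g hf hg => simp [der_mul, hf, hg]

/-- The even derivation commuting with `∂` that takes the field `u_i` to `X i`. -/
def ev (X : ι → JetAlg odd) (hX : ∀ i, HasParity (odd i) (X i)) : JetAlg odd →ₗ[ℂ] JetAlg odd :=
  der (fun x => (D odd ^ x.2) (X x.1)) fun x => (hX x.1).D_pow x.2

section Ev

variable {X : ι → JetAlg odd} (hX : ∀ i, HasParity (odd i) (X i))

theorem ev_mul (f g : JetAlg odd) : ev X hX (f * g) = ev X hX f * g + f * ev X hX g :=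
  der_mul _ f g

@[simp] theorem ev_algebraMap (c : ℂ) : ev X hX (algebraMap ℂ _ c) = 0 := der_algebraMap _ c

theorem ev_gen (x : ι × ℕ) : ev X hX (gen odd x) = (D odd ^ x.2) (X x.1) := der_gen _ x

theorem ev_D (f : JetAlg odd) : ev X hX (D odd f) = D odd (ev X hX f) := by
  induction f using induction with
  | hc c => simp
  | hg x => simp [ev_gen, pow_succ']
  | ha f g hf hg => simp [hf, hg]
  | hm f g hf hg =>
    simp only [D_mul, ev_mul, map_add, hf, hg]
    abel

theorem ev_parity (f : JetAlg odd) : parity odd (ev X hX f) = ev X hX (parity odd f) :=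
  der_parity _ f

theorem HasParity.ev {b : Bool} {f : JetAlg odd} (hf : HasParity b f) :
    HasParity b (JetAlg.ev X hX f) := by
  unfold HasParity at hf ⊢
  rw [ev_parity, hf, map_smul]

/-- A derivation commuting with `∂` is determined by its values on the fields. -/
theorem eq_of_apply_field {S T : JetAlg odd →ₗ[ℂ] JetAlg odd}
    (hS : ∀ f g, S (f * g) = S f * g + f * S g) (hT : ∀ f g, T (f * g) = T f * g + f * T g)
    (hSD : ∀ f, S (D odd f) = D odd (S f)) (hTD : ∀ f, T (D odd f) = D odd (T f))
    (h : ∀ i, S (gen odd (i, 0)) = T (gen odd (i, 0))) : S = T := by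
  have h1 : ∀ U : JetAlg odd →ₗ[ℂ] JetAlg odd, (∀ f g, U (f * g) = U f * g + f * U g) →
      ∀ c, U (algebraMap ℂ _ c) = 0 := by
    intro U hU c
    have := hU 1 1
    rw [mul_one, mul_one, one_mul, left_eq_add] at this
    rw [Algebra.algebraMap_eq_smul_one, map_smul, this, smul_zero]
  ext f
  induction f using induction with
  | hc c => rw [h1 S hS, h1 T hT]
  | hg x =>
    obtain ⟨i, k⟩ := x
    induction k with
    | zero => exact h i
    | succ k ih => rw [← D_gen (i, k), hSD, hTD, ih]
  | ha f g hf hg => rw [map_add, map_add, hf, hg]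
  | hm f g hf hg => rw [hS, hT, hf, hg]

end Ev

/-- Integration by parts. -/
theorem mul_D_pow_sub_mem (g x : JetAlg odd) (k : ℕ) :
    g * (D odd ^ k) x - ((-D odd) ^ k : Module.End ℂ (JetAlg odd)) g * x ∈
      LinearMap.range (D odd) := by
  induction k generalizing g with
  | zero => simp
  | succ k ih =>
    have h := ih (-D odd g)
    have h2 : D odd (g * (D odd ^ k) x) ∈ LinearMap.range (D odd) := ⟨_, rfl⟩
    have h3 := add_mem h h2
    rw [D_mul] at h3
    rw [pow_succ', pow_succ, Module.End.mul_apply, Module.End.mul_apply, LinearMap.neg_apply]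
    convert h3 using 1
    noncomm_ring

theorem neg_pow_apply (L : ℕ) (y : JetAlg odd) :
    ((-D odd) ^ L : Module.End ℂ (JetAlg odd)) y = (-1 : ℂ) ^ L • (D odd ^ L) y := by
  rw [neg_pow (D odd), Module.End.mul_apply]
  rcases Nat.even_or_odd L with h | h <;> simp [h.neg_one_pow]

/-! #### Variational derivatives -/

variable [DecidableEq ι]

theorem euler_eq_sum {K : ℕ} {h : JetAlg odd} (hK : OrderLT K h) (i : ι) :
    euler odd i h = ∑ k ∈ Finset.range K,
      ((-D odd) ^ k : Module.End ℂ (JetAlg odd)) (pd odd (i, k) h) := by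
  unfold euler
  apply finsum_eq_sum_of_support_subset
  intro k hk
  by_contra h'
  rw [Finset.mem_coe, Finset.mem_range, not_lt] at h'
  exact hk (by simp only [hK (i, k) h', map_zero])

theorem OrderLT.add {K : ℕ} {f g : JetAlg odd} (hf : OrderLT K f) (hg : OrderLT K g) :
    OrderLT K (f + g) := fun z hz => by simp [hf z hz, hg z hz]

theorem OrderLT.smul {K : ℕ} {f : JetAlg odd} (c : ℂ) (hf : OrderLT K f) :
    OrderLT K (c • f) := fun z hz => by simp [hf z hz]

theorem OrderLT.D {K : ℕ} {f : JetAlg odd} (hf : OrderLT K f) :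
    OrderLT (K + 1) (JetAlg.D odd f) := by
  rintro ⟨i, k⟩ hk
  obtain ⟨k, rfl⟩ : ∃ l, k = l + 1 := ⟨k - 1, by simp only at hk; omega⟩
  simp only [add_le_add_iff_right] at hk
  rw [pd_succ_D, hf (i, k) hk, hf (i, k + 1) (by simp only; omega), map_zero, add_zero]

theorem exists_orderLT₂ (f g : JetAlg odd) : ∃ K, OrderLT K f ∧ OrderLT K g := by
  obtain ⟨K, hK⟩ := exists_orderLT f
  obtain ⟨L, hL⟩ := exists_orderLT g
  exact ⟨max K L, hK.mono (le_max_left _ _), hL.mono (le_max_right _ _)⟩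

theorem euler_add (i : ι) (f g : JetAlg odd) :
    euler odd i (f + g) = euler odd i f + euler odd i g := by
  obtain ⟨K, hf, hg⟩ := exists_orderLT₂ f g
  rw [euler_eq_sum hf, euler_eq_sum hg, euler_eq_sum (hf.add hg), ← Finset.sum_add_distrib]
  simp only [map_add]

theorem euler_smul (i : ι) (c : ℂ) (f : JetAlg odd) :
    euler odd i (c • f) = c • euler odd i f := by
  obtain ⟨K, hf⟩ := exists_orderLT f
  rw [euler_eq_sum hf, euler_eq_sum (hf.smul c), Finset.smul_sum]
  simp only [map_smul]

theorem euler_algebraMap (i : ι) (c : ℂ) : euler odd i (algebraMap ℂ _ c) = 0 := by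
  simp [euler]

/-- The commutator relation makes the alternating sum telescope; the remaining term has an order
that does not occur in f. -/
theorem euler_D (i : ι) (f : JetAlg odd) : euler odd i (D odd f) = 0 := by
  obtain ⟨K, hK⟩ := exists_orderLT f
  rw [euler_eq_sum hK.D, Finset.sum_range_succ', pow_zero, Module.End.one_apply, pd_zero_D]
  have h : ∀ L, ∑ k ∈ Finset.range L, ((-D odd) ^ (k + 1) : Module.End ℂ (JetAlg odd))
      (pd odd (i, k + 1) (D odd f)) =
      -D odd (pd odd (i, 0) f) + ((-D odd) ^ L : Module.End ℂ (JetAlg odd))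
        (D odd (pd odd (i, L) f)) := by
    intro L
    induction L with
    | zero => simp
    | succ L ih =>
      rw [Finset.sum_range_succ, ih, pd_succ_D, map_add]
      have h2 : ((-D odd) ^ (L + 1) : Module.End ℂ (JetAlg odd)) (pd odd (i, L) f) =
          -((-D odd) ^ L : Module.End ℂ (JetAlg odd)) (D odd (pd odd (i, L) f)) := by
        rw [pow_succ, Module.End.mul_apply, LinearMap.neg_apply, map_neg]
      rw [h2]
      abel
  rw [h, hK (i, K) le_rfl]
  simp

theorem HasParity.euler {b : Bool} {f : JetAlg odd} (hf : HasParity b f) (i : ι) :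
    HasParity (xor b (odd i)) (euler odd i f) := by
  obtain ⟨K, hK⟩ := exists_orderLT f
  rw [euler_eq_sum hK]
  refine HasParity.sum _ fun k _ => ?_
  have h : ∀ (c : Bool) (g : JetAlg odd) (l : ℕ), HasParity c g →
      HasParity c (((-JetAlg.D odd) ^ l : Module.End ℂ (JetAlg odd)) g) := by
    intro c g l hg
    induction l with
    | zero => simpa using hg
    | succ l ih =>
      rw [pow_succ', Module.End.mul_apply, LinearMap.neg_apply]
      exact ih.D.neg
  exact h _ _ k (hf.pd (i, k))

/-- The first variation formula. -/
theorem ev_sub_sum_euler_mem [Fintype ι] {X : ι → JetAlg odd} (hX : ∀ i, HasParity (odd i) (X i))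
    (f : JetAlg odd) :
    ev X hX f - ∑ i, euler odd i f * X i ∈ LinearMap.range (D odd) := by
  obtain ⟨K₀, hK₀⟩ := exists_orderLT f
  obtain ⟨K, hK, hKK⟩ := ((der_eq_sum_pd (fun x => (hX x.1).D_pow x.2) f).and
    (Filter.eventually_ge_atTop K₀)).exists
  have hf := hK₀.mono hKK
  rw [ev, hK, ← Finset.sum_sub_distrib]
  refine Submodule.sum_mem _ fun i _ => ?_
  rw [euler_eq_sum hf, Finset.sum_mul, ← Finset.sum_sub_distrib]
  exact Submodule.sum_mem _ fun k _ => mul_D_pow_sub_mem _ _ k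

/-! #### The fundamental lemma of the calculus of variations -/

/-- Each ∂ raises the highest order by one and keeps the leading partial derivative. -/
theorem pd_D_pow_of_order {i : ι} {n : ℕ} {y : JetAlg odd} (h : ∀ m, n < m → pd odd (i, m) y = 0)
    (L : ℕ) : (∀ m, n + L < m → pd odd (i, m) ((D odd ^ L) y) = 0) ∧
      pd odd (i, n + L) ((D odd ^ L) y) = pd odd (i, n) y := by
  induction L with
  | zero => exact ⟨by simpa using h, by simp⟩
  | succ L ih =>
    constructor
    · intro m hm
      obtain ⟨m, rfl⟩ : ∃ l, m = l + 1 := ⟨m - 1, by omega⟩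
      rw [pow_succ', Module.End.mul_apply, pd_succ_D, ih.1 _ (by omega), ih.1 _ (by omega),
        map_zero, add_zero]
    · rw [pow_succ', Module.End.mul_apply, ← add_assoc, pd_succ_D, ih.1 _ (by omega), ih.2,
        map_zero, zero_add]

/-- Apply the variational derivative by the even field uⱼ to y uⱼ⁽ᴸ⁾ and take the leading part for
large L. It shows that y does not contain uⱼ at all, and then L = 0 gives y = 0. -/
theorem eq_zero_of_mul_gen_mem {j : ι} (hj : odd j = false) {y : JetAlg odd}
    (h : ∀ L, y * gen odd (j, L) ∈ LinearMap.range (D odd)) : y = 0 := by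
  have hE : ∀ L K, L < K → OrderLT K y →
      ((-D odd) ^ L : Module.End ℂ (JetAlg odd)) y + ∑ k ∈ Finset.range K,
        ((-D odd) ^ k : Module.End ℂ (JetAlg odd)) (pd odd (j, k) y * gen odd (j, L)) = 0 := by
    intro L K hL hK
    obtain ⟨s, hs⟩ := h L
    have h1 : euler odd j (y * gen odd (j, L)) = 0 := by rw [← hs, euler_D]
    rw [euler_eq_sum (hK.mul (orderLT_gen hL))] at h1
    simp only [pd_mul, hj, twist, Bool.false_eq_true, if_false, AlgHom.id_apply, pd_gen,
      Prod.mk.injEq, true_and, map_add, Finset.sum_add_distrib] at h1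
    rw [Finset.sum_eq_single L] at h1
    · simpa using h1
    · intro k _ hk
      rw [if_neg (Ne.symm hk), mul_zero, map_zero]
    · intro h2
      exact absurd (Finset.mem_range.2 hL) h2
  obtain ⟨K, hK⟩ := exists_orderLT y
  have key : ∀ n, n ≤ K → ∀ m, K - n ≤ m → pd odd (j, m) y = 0 := by
    intro n
    induction n with
    | zero => intro _ m hm; exact hK (j, m) (by simpa using hm)
    | succ n ih =>
      intro hn m hm
      by_cases h1 : K - n ≤ m
      · exact ih (by omega) m h1
      -- B bounds the orders of all first partial derivatives, so that for L ≥ B the factor uⱼ⁽ᴸ⁾ is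
      -- the leading jet of each product.
      obtain ⟨B, hB⟩ : ∃ B, ∀ k < K, OrderLT B (pd odd (j, k) y) := by
        choose B hB using fun k => exists_orderLT (pd odd (j, k) y)
        exact ⟨∑ k ∈ Finset.range K, B k, fun k hk => (hB k).mono
          (Finset.single_le_sum (f := B) (fun _ _ => Nat.zero_le _) (Finset.mem_range.2 hk))⟩
      have hy : ∀ l, m < l → pd odd (j, l) y = 0 := fun l hl => ih (by omega) l (by omega)
      -- Only (-∂)ᴸy and the summand k = m contain uⱼ⁽ᵐ⁺ᴸ⁾, with coefficients (-1)ᴸ and (-1)ᵐ times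
      -- ∂y/∂uⱼ⁽ᵐ⁾. As L has the parity of m, they add up instead of cancelling.
      set L := m + 2 * B with hL
      have h2 := congrArg (pd odd (j, m + L)) (hE L (K + L + 1) (by omega) (hK.mono (by omega)))
      rw [map_add, neg_pow_apply, map_smul, (pd_D_pow_of_order hy L).2, map_sum,
        Finset.sum_eq_single m, map_zero] at h2
      · have h3 : ∀ l, L < l → pd odd (j, l) (pd odd (j, m) y * gen odd (j, L)) = 0 := by
          intro l hl
          rw [pd_mul, pd_gen, if_neg (by simp; omega), hB m (by omega) (j, l) (by simp only; omega)]
          simp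
        rw [neg_pow_apply, map_smul, add_comm m L, (pd_D_pow_of_order h3 m).2, pd_mul, pd_gen,
          if_pos rfl, mul_one] at h2
        by_cases hB0 : B ≤ L
        · rw [hB m (by omega) (j, L) hB0, zero_mul, add_zero, ← add_smul, hL, pow_add,
            pow_mul] at h2
          simp only [neg_sq, one_pow, mul_one] at h2
          refine (smul_eq_zero.1 h2).resolve_left ?_
          rw [← two_mul]
          exact mul_ne_zero two_ne_zero (pow_ne_zero _ (by norm_num))
        · omega
      · intro k hk hkm
        rcases lt_or_gt_of_ne hkm with h4 | h4
        · have h3 : ∀ l, L < l → pd odd (j, l) (pd odd (j, k) y * gen odd (j, L)) = 0 := by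
            intro l hl
            rw [pd_mul, pd_gen, if_neg (by simp; omega), hB k (by omega) (j, l) (by simp only; omega)]
            simp
          rw [neg_pow_apply, map_smul, (pd_D_pow_of_order h3 k).1 _ (by omega), smul_zero]
        · rw [hy k h4, zero_mul, map_zero, map_zero]
      · intro h4
        exact absurd (Finset.mem_range.2 (by omega)) h4
  have h0 := hE 0 (K + 1) (by omega) (hK.mono (by omega))
  rw [Finset.sum_eq_zero] at h0
  · simpa using h0
  · intro k _
    rw [key K le_rfl k (by omega), zero_mul, map_zero]

/-- The fundamental lemma of the calculus of variations. -/
theorem eq_zero_of_sum_mul_mem [Fintype ι] {j : ι} (hj : odd j = false) {g : ι → JetAlg odd}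
    (h : ∀ X : ι → JetAlg odd, (∀ i, HasParity (odd i) (X i)) →
      ∑ i, g i * X i ∈ LinearMap.range (D odd)) : g = 0 := by
  funext i
  obtain ⟨K, hK⟩ := exists_orderLT (g i)
  -- The test field uᵢ⁽ᴷ⁾uⱼ⁽ᴸ⁾ has the parity of uᵢ because uⱼ is even. Since K exceeds the order of
  -- gᵢ, differentiating gᵢuᵢ⁽ᴷ⁾ = 0 by uᵢ⁽ᴷ⁾ returns gᵢ.
  have h1 : g i * gen odd (i, K) = 0 := by
    refine eq_zero_of_mul_gen_mem hj fun L => ?_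
    have h2 := h (Pi.single i (gen odd (i, K) * gen odd (j, L))) fun l => by
      by_cases hl : l = i
      · subst hl
        rw [Pi.single_eq_same]
        have := (hasParity_gen (odd := odd) (l, K)).mul (hasParity_gen (j, L))
        simpa [hj] using this
      · rw [Pi.single_eq_of_ne hl]
        exact HasParity.zero _
    rw [Finset.sum_eq_single i (fun l _ hl => by rw [Pi.single_eq_of_ne hl, mul_zero])
      (by simp), Pi.single_eq_same, ← mul_assoc] at h2
    exact h2
  have h3 := congrArg (pd odd (i, K)) h1
  rwa [pd_mul, hK (i, K) le_rfl, pd_gen, if_pos rfl, mul_one, zero_mul, add_zero, map_zero] at h3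

end JetAlg
end
end SuperGBK

namespace SuperGBK

/-! ### A decision procedure for supercommutative differential algebra -/

/-- A supercommutative algebra, with its parity automorphism. -/
class SuperAlg (S : Type) [Ring S] [Algebra ℂ S] where
  par : S →+* S
  comm_of_even : ∀ x y : S, par x = x → x * y = y * x
  anticomm_of_odd : ∀ x y : S, par x = -x → par y = -y → x * y = -(y * x)

namespace SuperAlg

/-- The kinds of atoms of a differential superpolynomial. -/
inductive Kind
  | even | odd | const

/-- A dyadic number `n / 2 ^ k`. -/
abbrev Coef := ℤ × ℕ

namespace Coef

def mul (a b : Coef) : Coef := (a.1 * b.1, a.2 + b.2)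

def neg (a : Coef) : Coef := (-a.1, a.2)

/-- Fractions are brought to the larger exponent and never reduced; a zero test needs only the
numerator. -/
def add (a b : Coef) : Coef :=
  bif Nat.ble a.2 b.2 then (a.1 * 2 ^ (b.2 - a.2) + b.1, b.2)
  else (a.1 + b.1 * 2 ^ (a.2 - b.2), a.2)

def isZero (a : Coef) : Bool := Nat.beq a.1.natAbs 0

/-- The value of a dyadic number. -/
noncomputable def val (a : Coef) : ℂ := a.1 / 2 ^ a.2

theorem val_mul (a b : Coef) : (mul a b).val = a.val * b.val := by
  simp only [mul, val, pow_add, Int.cast_mul]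
  ring

theorem val_neg (a : Coef) : (neg a).val = -a.val := by
  simp only [neg, val, Int.cast_neg]
  ring

theorem val_add (a b : Coef) : (add a b).val = a.val + b.val := by
  have key : ∀ (n : ℤ) (k l : ℕ), k ≤ l →
      ((n * 2 ^ (l - k) : ℤ) : ℂ) / 2 ^ l = (n : ℂ) / 2 ^ k := by
    intro n k l h
    rw [div_eq_div_iff (pow_ne_zero _ two_ne_zero) (pow_ne_zero _ two_ne_zero)]
    push_cast
    rw [mul_assoc, ← pow_add, Nat.sub_add_cancel h]
  unfold add
  cases h : Nat.ble a.2 b.2 with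
  | true =>
    simp only [cond_true, val]
    rw [Int.cast_add, add_div, key _ _ _ (Nat.le_of_ble_eq_true h)]
  | false =>
    have h' : b.2 ≤ a.2 := by
      by_contra h2
      rw [Nat.ble_eq_true_of_le (by omega)] at h
      exact Bool.noConfusion h
    simp only [cond_false, val]
    rw [Int.cast_add, add_div, key _ _ _ h']

theorem val_of_isZero {a : Coef} (h : a.isZero = true) : a.val = 0 := by
  have h1 : a.1 = 0 := Int.natAbs_eq_zero.1 (Nat.eq_of_beq_eq_true h)
  simp [val, h1]

end Coef

/-- Differential superpolynomial expressions with atoms numbered by `ℕ`. -/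
inductive SExpr
  | var (i : ℕ)
  | const (q : Coef)
  | add (e f : SExpr)
  | sub (e f : SExpr)
  | mul (e f : SExpr)
  | neg (e : SExpr)
  | der (e : SExpr)

/-- A jet variable: the number of an atom and the order of the derivative. -/
abbrev Jet := ℕ × ℕ

/-- A monomial with coefficient. -/
abbrev Term := Coef × List Jet

def Kind.isOdd : Kind → Bool
  | odd => true
  | _ => false

def Kind.isConst : Kind → Bool
  | const => true
  | _ => false

def jetOdd (ks : List Kind) (v : Jet) : Bool := (ks.getD v.1 .even).isOdd

/-- Only a sorting key. It separates jets of order below 64, but soundness does not depend on that: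
equality of jets is tested componentwise. -/
def code (v : Jet) : ℕ := 64 * v.1 + v.2

/-- The product of a variable and a sorted monomial. -/
def ins (ks : List Kind) (v : Jet) (c : Coef) : List Jet → Term
  | [] => (c, [v])
  | w :: m =>
    bif Nat.ble (code v) (code w) then
      -- An odd jet squares to zero; the zero term is encoded by the coefficient 0.
      bif jetOdd ks v && (Nat.beq v.1 w.1 && Nat.beq v.2 w.2) then ((0, 0), []) else (c, v :: w :: m)
    else
      ((bif jetOdd ks v && jetOdd ks w then (ins ks v c m).1.neg else (ins ks v c m).1),
        w :: (ins ks v c m).2)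

/-- The product of a monomial and a sorted monomial. -/
def mulMono (ks : List Kind) (m : List Jet) (t : Term) : Term :=
  m.foldr (fun v t => ins ks v t.1 t.2) t

def mulTerms (ks : List Kind) (p q : List Term) : List Term :=
  p.flatMap fun s => q.map fun t => mulMono ks s.2 (s.1.mul t.1, t.2)

def negTerms (p : List Term) : List Term := p.map fun t => (t.1.neg, t.2)

/-- The derivative of a monomial. -/
def derMono (ks : List Kind) (c : Coef) : List Jet → List Term
  | [] => []
  | v :: m =>
    (bif (ks.getD v.1 .even).isConst then [] else [ins ks (v.1, v.2 + 1) c m]) ++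
      (derMono ks c m).map fun t => ins ks v t.1 t.2

def derTerms (ks : List Kind) (p : List Term) : List Term :=
  p.flatMap fun t => derMono ks t.1 t.2

/-- The expansion of an expression into monomials. -/
def SExpr.terms (ks : List Kind) : SExpr → List Term
  | var i => [((1, 0), [(i, 0)])]
  | const q => [(q, [])]
  | add e f => e.terms ks ++ f.terms ks
  | sub e f => e.terms ks ++ negTerms (f.terms ks)
  | mul e f => mulTerms ks (e.terms ks) (f.terms ks)
  | neg e => negTerms (e.terms ks)
  | der e => derTerms ks (e.terms ks)

/-! ### Collecting like terms -/

/-- A search tree of monomials with coefficients. -/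
inductive Tree
  | nil
  | node (l : Tree) (c : Coef) (m : List Jet) (r : Tree)

/-- Lexicographic comparison. -/
def cmp : List Jet → List Jet → Ordering
  | [], [] => .eq
  | [], _ :: _ => .lt
  | _ :: _, [] => .gt
  | v :: m, w :: n =>
    bif Nat.beq v.1 w.1 then
      bif Nat.beq v.2 w.2 then cmp m n else bif Nat.ble v.2 w.2 then .lt else .gt
    else bif Nat.ble v.1 w.1 then .lt else .gt

def Tree.insert (c : Coef) (m : List Jet) : Tree → Tree
  | nil => node nil c m nil
  | node l d n r =>
    match cmp m n with
    | .eq => node l (c.add d) n r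
    | .lt => node (l.insert c m) d n r
    | .gt => node l d n (r.insert c m)

def Tree.isZero : Tree → Bool
  | nil => true
  | node l c _ r => l.isZero && (c.isZero && r.isZero)

def Tree.toTerms : Tree → List Term → List Term
  | nil, p => p
  | node l c m r, p =>
    bif c.isZero then l.toTerms (r.toTerms p) else (c, m) :: l.toTerms (r.toTerms p)

/-! Continuation passing forces the kernel to evaluate arguments. -/

def forceNat {β : Type} (n : ℕ) (k : ℕ → β) : β :=
  match n with
  | 0 => k 0
  | n + 1 => k n.succ

def forceMono {β : Type} : List Jet → (List Jet → β) → β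
  | [], k => k []
  | v :: m, k => forceNat v.1 fun i => forceNat v.2 fun j => forceMono m fun m => k ((i, j) :: m)

def forceTerm {β : Type} (t : Term) (k : Term → β) : β :=
  forceNat t.1.2 fun e => forceMono t.2 fun m =>
    match t.1.1 with
    | .ofNat n => forceNat n fun n => k ((.ofNat n, e), m)
    | .negSucc n => forceNat n fun n => k ((.negSucc n, e), m)

def collectInto : List Term → Tree → Tree
  | [], T => T
  | t :: p, T => forceTerm t fun t => collectInto p (T.insert t.1 t.2)

def collect (p : List Term) : Tree := collectInto p .nil

def isZero (p : List Term) : Bool := (collect p).isZero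

/-! ### Integration by parts on expansions -/

/-- Lowering the order of an atom with number at least `h`. -/
def lower (ks : List Kind) (h : ℕ) (t : Term) : List Jet → Option Term
  | [] => none
  | v :: m =>
    bif Nat.ble h v.1 && Nat.ble 1 v.2 then some (ins ks (v.1, v.2 - 1) t.1 m)
    else (lower ks h t m).map fun t => ins ks v t.1 t.2

def forceTerms {β : Type} : List Term → (List Term → β) → β
  | [], k => k []
  | t :: p, k => forceTerm t fun t => forceTerms p fun p => k (t :: p)

/-- An antiderivative of an expression that is linear in the atoms with number at least `h`, found
by repeated integration by parts. -/
def antiTerms (ks : List Kind) (h : ℕ) : ℕ → List Term → List Term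
  | 0, _ => []
  | n + 1, p =>
    forceTerms ((collect p).toTerms []) fun p =>
      forceTerms (p.filterMap fun t => lower ks h t t.2) fun q =>
        -- If y is the distinguished atom, a term m y⁽ᵏ⁺¹⁾ puts m y⁽ᵏ⁾ into q, and subtracting ∂q
        -- leaves -m′y⁽ᵏ⁾, of lower order in y. The result is only a candidate; `mem_range_of_check`
        -- differentiates it again.
        q ++ antiTerms ks h n (p ++ negTerms (derTerms ks q))

/-! #### Soundness -/

section Soundness

variable {S : Type} [Ring S] [Algebra ℂ S]

/-- An even derivation. -/
structure IsEvenDer [SuperAlg S] (D : S →ₗ[ℂ] S) : Prop where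
  leibniz : ∀ x y, D (x * y) = D x * y + x * D y
  par : ∀ x, par (D x) = D (par x)

def HasKind [SuperAlg S] (D : S →ₗ[ℂ] S) : Kind → S → Prop
  | .even, x => par x = x
  | .odd, x => par x = -x
  | .const, x => par x = x ∧ D x = 0

variable (D : S →ₗ[ℂ] S) (env : List S)

def jetVal (v : Jet) : S := (D ^ v.2 : Module.End ℂ S) (env.getD v.1 0)

def monoVal (m : List Jet) : S := (m.map (jetVal D env)).prod

noncomputable def termVal (t : Term) : S := t.1.val • monoVal D env t.2

noncomputable def termsVal (p : List Term) : S := (p.map (termVal D env)).sum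

noncomputable def SExpr.val : SExpr → S
  | var i => env.getD i 0
  | const q => algebraMap ℂ S q.val
  | add e f => e.val + f.val
  | sub e f => e.val - f.val
  | mul e f => e.val * f.val
  | neg e => -e.val
  | der e => D e.val

noncomputable def Tree.val : Tree → S
  | nil => 0
  | node l c m r => l.val + c.val • monoVal D env m + r.val

variable {D env}

theorem cmp_eq : ∀ {m n : List Jet}, cmp m n = .eq → m = n
  | [], [], _ => rfl
  | v :: m, w :: n, h => by
    unfold cmp at h
    by_cases h1 : v.1 = w.1
    · by_cases h2 : v.2 = w.2
      · simp only [h1, h2, Nat.beq_refl, cond_true] at h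
        rw [cmp_eq h, Prod.ext h1 h2]
      · have h3 : Nat.beq v.2 w.2 = false := Bool.eq_false_iff.2 fun h => h2 (Nat.eq_of_beq_eq_true h)
        rw [h1, Nat.beq_refl, cond_true, h3, cond_false] at h
        cases h4 : Nat.ble v.2 w.2 <;> simp [h4] at h
    · have h3 : Nat.beq v.1 w.1 = false := Bool.eq_false_iff.2 fun h => h1 (Nat.eq_of_beq_eq_true h)
      rw [h3, cond_false] at h
      cases h4 : Nat.ble v.1 w.1 <;> simp [h4] at h

theorem Tree.val_insert (c : Coef) (m : List Jet) (T : Tree) :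
    (T.insert c m).val D env = T.val D env + c.val • monoVal D env m := by
  induction T with
  | nil => simp [Tree.insert, Tree.val]
  | node l d n r hl hr =>
    unfold Tree.insert
    cases h : cmp m n with
    | eq =>
      rw [cmp_eq h]
      simp only [Tree.val, Coef.val_add, add_smul]
      abel
    | lt =>
      simp only [Tree.val, hl]
      abel
    | gt =>
      simp only [Tree.val, hr]
      abel

theorem Tree.val_of_isZero {T : Tree} (h : T.isZero = true) : T.val D env = 0 := by
  induction T with
  | nil => rfl
  | node l d n r hl hr =>
    simp only [Tree.isZero, Bool.and_eq_true] at h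
    simp [Tree.val, hl h.1, hr h.2.2, Coef.val_of_isZero h.2.1]

theorem termsVal_append (p q : List Term) :
    termsVal D env (p ++ q) = termsVal D env p + termsVal D env q := by
  simp [termsVal]

theorem termsVal_cons (t : Term) (q : List Term) :
    termsVal D env (t :: q) = termVal D env t + termsVal D env q := by
  simp [termsVal]

theorem forceNat_eq {β : Type} (n : ℕ) (k : ℕ → β) : forceNat n k = k n := by
  cases n <;> rfl

theorem forceMono_eq {β : Type} (m : List Jet) (k : List Jet → β) : forceMono m k = k m := by
  induction m generalizing k with
  | nil => rfl
  | cons v m ih => rw [forceMono, forceNat_eq, forceNat_eq, ih]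

theorem forceTerm_eq {β : Type} (t : Term) (k : Term → β) : forceTerm t k = k t := by
  obtain ⟨⟨n, e⟩, m⟩ := t
  rw [forceTerm, forceNat_eq, forceMono_eq]
  cases n <;> simp only [forceNat_eq]

theorem termsVal_eq_zero {p : List Term} (h : isZero p = true) : termsVal D env p = 0 := by
  have key : ∀ (p : List Term) (T : Tree),
      (collectInto p T).val D env = T.val D env + termsVal D env p := by
    intro p
    induction p with
    | nil => simp [termsVal, collectInto]
    | cons t p ih =>
      intro T
      rw [collectInto, forceTerm_eq, ih, Tree.val_insert, termsVal_cons, termVal, add_assoc]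
  have := key p .nil
  change (collect p).val D env = _ at this
  rw [Tree.val_of_isZero (T := collect p) h, Tree.val, zero_add] at this
  exact this.symm

theorem termsVal_neg (p : List Term) : termsVal D env (negTerms p) = -termsVal D env p := by
  induction p with
  | nil => simp [negTerms, termsVal]
  | cons t p ih =>
    rw [negTerms, List.map_cons, termsVal_cons, termsVal_cons, neg_add, ← ih, termVal, termVal,
      Coef.val_neg, neg_smul]
    rfl

variable [SuperAlg S] {ks : List Kind}

theorem hasKind_getD (hk : List.Forall₂ (HasKind D) ks env) (i : ℕ) : HasKind D (ks.getD i .even) (env.getD i 0) := by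
  induction hk generalizing i with
  | nil => simp [HasKind]
  | cons h _ ih =>
    cases i with
    | zero => simpa using h
    | succ i => simpa using ih i

theorem par_jetVal (hD : IsEvenDer D) (hk : List.Forall₂ (HasKind D) ks env)
    (v : Jet) :
    par (jetVal D env v) = if jetOdd ks v then -jetVal D env v else jetVal D env v := by
  obtain ⟨i, k⟩ := v
  have h := hasKind_getD hk i
  induction k with
  | zero =>
    simp only [jetVal, pow_zero, Module.End.one_apply, jetOdd]
    revert h
    cases ks.getD i .even <;> simp +contextual [HasKind, Kind.isOdd]
  | succ k ih =>
    have h2 : jetVal D env (i, k + 1) = D (jetVal D env (i, k)) := by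
      simp [jetVal, pow_succ']
    rw [h2, hD.par, ih]
    have h3 : jetOdd ks (i, k + 1) = jetOdd ks (i, k) := rfl
    rw [h3]
    split_ifs
    · rw [map_neg]
    · rfl

theorem jetVal_mul (hD : IsEvenDer D) (hk : List.Forall₂ (HasKind D) ks env)
    (v w : Jet) : jetVal D env v * jetVal D env w =
    if jetOdd ks v && jetOdd ks w then -(jetVal D env w * jetVal D env v)
    else jetVal D env w * jetVal D env v := by
  have hv := par_jetVal hD hk v
  have hw := par_jetVal hD hk w
  cases h1 : jetOdd ks v <;> cases h2 : jetOdd ks w <;>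
    simp only [h1, h2, Bool.false_eq_true, if_false, if_true, Bool.and_true,
      Bool.and_false] at hv hw ⊢
  · exact comm_of_even _ _ hv
  · exact comm_of_even _ _ hv
  · exact (comm_of_even _ _ hw).symm
  · exact anticomm_of_odd _ _ hv hw

theorem mul_self_of_odd {x : S} (hx : par x = -x) : x * x = 0 := by
  have h := anticomm_of_odd x x hx hx
  have h2 : (2 : ℂ) • (x * x) = 0 := by
    rw [two_smul]
    nth_rewrite 1 [h]
    exact neg_add_cancel _
  exact (smul_eq_zero.1 h2).resolve_left two_ne_zero

/-- Insertion moves v to the right past smaller jets, one Koszul sign at a time. The list need not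
be sorted for this to be sound. -/
theorem termVal_ins (hD : IsEvenDer D) (hk : List.Forall₂ (HasKind D) ks env)
    (v : Jet) (c : Coef) (m : List Jet) :
    termVal D env (ins ks v c m) = c.val • (jetVal D env v * monoVal D env m) := by
  induction m with
  | nil => simp [ins, termVal, monoVal]
  | cons w m ih =>
    unfold ins
    cases h1 : Nat.ble (code v) (code w) with
    | true =>
      simp only [cond_true]
      cases h2 : jetOdd ks v && (Nat.beq v.1 w.1 && Nat.beq v.2 w.2) with
      | true =>
        simp only [Bool.and_eq_true] at h2
        obtain ⟨h3, h4, h5⟩ := h2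
        obtain rfl : v = w := Prod.ext (Nat.eq_of_beq_eq_true h4) (Nat.eq_of_beq_eq_true h5)
        have h6 := par_jetVal hD hk v
        rw [h3, if_pos rfl] at h6
        simp [termVal, monoVal, ← mul_assoc, mul_self_of_odd h6, Coef.val]
      | false => simp [termVal, monoVal]
    | false =>
      simp only [cond_false]
      have h2 : monoVal D env (w :: m) = jetVal D env w * monoVal D env m := by simp [monoVal]
      have h3 : monoVal D env (w :: (ins ks v c m).2) =
          jetVal D env w * monoVal D env (ins ks v c m).2 := by simp [monoVal]
      rw [h2, ← mul_assoc, jetVal_mul hD hk]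
      unfold termVal at ih ⊢
      cases h4 : jetOdd ks v && jetOdd ks w with
      | true =>
        simp only [cond_true, if_true, Coef.val_neg]
        rw [h3, neg_smul, ← mul_smul_comm, ih, mul_smul_comm, neg_mul, smul_neg, mul_assoc]
      | false =>
        simp only [cond_false, Bool.false_eq_true, if_false]
        rw [h3, ← mul_smul_comm, ih, mul_smul_comm, mul_assoc]

theorem termVal_mulMono (hD : IsEvenDer D) (hk : List.Forall₂ (HasKind D) ks env)
    (m : List Jet) (t : Term) :
    termVal D env (mulMono ks m t) = monoVal D env m * termVal D env t := by
  induction m with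
  | nil => simp [mulMono, monoVal]
  | cons v m ih =>
    unfold mulMono at ih ⊢
    rw [List.foldr_cons, termVal_ins hD hk, ← mul_smul_comm]
    unfold termVal at ih ⊢
    rw [ih]
    simp [monoVal, mul_assoc]

theorem termsVal_mul (hD : IsEvenDer D) (hk : List.Forall₂ (HasKind D) ks env)
    (p q : List Term) :
    termsVal D env (mulTerms ks p q) = termsVal D env p * termsVal D env q := by
  induction p with
  | nil => simp [mulTerms, termsVal]
  | cons s p ih =>
    unfold mulTerms at ih ⊢
    rw [List.flatMap_cons, termsVal_append, ih, termsVal_cons, add_mul]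
    congr 1
    clear ih
    induction q with
    | nil => simp [termsVal]
    | cons t q ih =>
      rw [List.map_cons, termsVal_cons, ih, termsVal_cons, mul_add, termVal_mulMono hD hk]
      congr 1
      simp [termVal, smul_smul, mul_comm, Coef.val_mul]

theorem termsVal_map_ins (hD : IsEvenDer D) (hk : List.Forall₂ (HasKind D) ks env)
    (v : Jet) (p : List Term) :
    termsVal D env (p.map fun t => ins ks v t.1 t.2) = jetVal D env v * termsVal D env p := by
  induction p with
  | nil => simp [termsVal]
  | cons t p ih =>
    rw [List.map_cons, termsVal_cons, ih, termsVal_cons, mul_add, termVal_ins hD hk, termVal,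
      mul_smul_comm]

theorem IsEvenDer.map_one (hD : IsEvenDer D) : D 1 = 0 := by
  have h := hD.leibniz 1 1
  simpa using h

theorem termsVal_derMono (hD : IsEvenDer D) (hk : List.Forall₂ (HasKind D) ks env)
    (c : Coef) (m : List Jet) :
    termsVal D env (derMono ks c m) = D (termVal D env (c, m)) := by
  induction m with
  | nil => simp [derMono, termsVal, termVal, monoVal, hD.map_one]
  | cons v m ih =>
    rw [derMono, termsVal_append, termsVal_map_ins hD hk, ih]
    have h2 : monoVal D env (v :: m) = jetVal D env v * monoVal D env m := by simp [monoVal]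
    simp only [termVal, h2, map_smul, hD.leibniz, smul_add, mul_smul_comm]
    congr 1
    have h3 : jetVal D env (v.1, v.2 + 1) = D (jetVal D env v) := by
      simp [jetVal, pow_succ']
    have h := hasKind_getD hk v.1
    cases h4 : (ks.getD v.1 .even).isConst with
    | false =>
      rw [cond_false, termsVal_cons, termVal_ins hD hk, h3]
      simp [termsVal]
    | true =>
      have h5 : HasKind D .const (env.getD v.1 0) := by
        revert h h4
        cases ks.getD v.1 .even <;> simp [Kind.isConst]
      have h6 : D (jetVal D env v) = 0 := by
        rw [← h3, jetVal, pow_succ, Module.End.mul_apply]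
        simp only
        rw [h5.2, map_zero]
      simp [termsVal, h6]

theorem termsVal_der (hD : IsEvenDer D) (hk : List.Forall₂ (HasKind D) ks env)
    (p : List Term) : termsVal D env (derTerms ks p) = D (termsVal D env p) := by
  induction p with
  | nil => simp [derTerms, termsVal]
  | cons t p ih =>
    unfold derTerms at ih ⊢
    rw [List.flatMap_cons, termsVal_append, ih, termsVal_derMono hD hk, termsVal_cons, map_add]

theorem SExpr.termsVal_terms (hD : IsEvenDer D) (hk : List.Forall₂ (HasKind D) ks env)
    (e : SExpr) : termsVal D env (e.terms ks) = e.val D env := by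
  induction e with
  | var i => simp [SExpr.terms, SExpr.val, termsVal, termVal, monoVal, jetVal, Coef.val]
  | const q => simp [SExpr.terms, SExpr.val, termsVal, termVal, monoVal, Algebra.smul_def]
  | add e f he hf => rw [SExpr.terms, termsVal_append, he, hf, SExpr.val]
  | sub e f he hf => rw [SExpr.terms, termsVal_append, termsVal_neg, he, hf, SExpr.val, sub_eq_add_neg]
  | mul e f he hf => rw [SExpr.terms, termsVal_mul hD hk, he, hf, SExpr.val]
  | neg e he => rw [SExpr.terms, termsVal_neg, he, SExpr.val]
  | der e he => rw [SExpr.terms, termsVal_der hD hk, he, SExpr.val]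

end Soundness

/-! #### Reification -/

section Reify

variable {S : Type} [Ring S] [Algebra ℂ S]

/-- `x` is the atom with number `i` in `env`. -/
class IsAtom (env : List S) (x : S) (i : outParam ℕ) : Prop where
  eq : x = env.getD i 0

instance (priority := high) (x : S) (env : List S) : IsAtom (x :: env) x 0 := ⟨rfl⟩

instance (x y : S) (env : List S) (i : ℕ) [h : IsAtom env x i] : IsAtom (y :: env) x (i + 1) :=
  ⟨by rw [h.eq]; rfl⟩

/-- `c` is the dyadic number `q`. -/
class IsDyadic (c : ℂ) (q : outParam Coef) : Prop where
  eq : c = q.val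

instance : IsDyadic (1 / 2) (1, 1) := ⟨by norm_num [Coef.val]⟩
instance : IsDyadic (1 / 4) (1, 2) := ⟨by norm_num [Coef.val]⟩

/-- `x` is the value of the expression `e`. -/
class Reify (D : S →ₗ[ℂ] S) (env : List S) (x : S) (e : outParam SExpr) : Prop where
  eq : x = e.val D env

variable (D : S →ₗ[ℂ] S) (env : List S)

instance (priority := low) (x : S) (i : ℕ) [h : IsAtom env x i] : Reify D env x (.var i) := ⟨h.eq⟩

instance : Reify D env 0 (.const (0, 0)) := ⟨by simp [SExpr.val, Coef.val]⟩

instance : Reify D env 1 (.const (1, 0)) := ⟨by simp [SExpr.val, Coef.val]⟩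

instance : Reify D env 2 (.const (2, 0)) := ⟨by simp [SExpr.val, Coef.val, map_ofNat]⟩

instance : Reify D env 4 (.const (4, 0)) := ⟨by simp [SExpr.val, Coef.val, map_ofNat]⟩

instance (x y : S) (e f : SExpr) [hx : Reify D env x e] [hy : Reify D env y f] :
    Reify D env (x + y) (.add e f) := ⟨by rw [SExpr.val, ← hx.eq, ← hy.eq]⟩

instance (x y : S) (e f : SExpr) [hx : Reify D env x e] [hy : Reify D env y f] :
    Reify D env (x - y) (.sub e f) := ⟨by rw [SExpr.val, ← hx.eq, ← hy.eq]⟩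

instance (x y : S) (e f : SExpr) [hx : Reify D env x e] [hy : Reify D env y f] :
    Reify D env (x * y) (.mul e f) := ⟨by rw [SExpr.val, ← hx.eq, ← hy.eq]⟩

instance (x : S) (e : SExpr) [hx : Reify D env x e] : Reify D env (-x) (.neg e) :=
  ⟨by rw [SExpr.val, ← hx.eq]⟩

instance (x : S) (e : SExpr) [hx : Reify D env x e] : Reify D env (D x) (.der e) :=
  ⟨by rw [SExpr.val, ← hx.eq]⟩

instance (c : ℂ) (q : Coef) (x : S) (e : SExpr) [hc : IsDyadic c q] [hx : Reify D env x e] :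
    Reify D env (c • x) (.mul (.const q) e) :=
  ⟨by rw [SExpr.val, ← hx.eq, SExpr.val, ← hc.eq, Algebra.smul_def]⟩

/-- A symbolic scalar, such as a parameter of the pencil, enters as a constant atom. -/
instance (priority := low) (c : ℂ) (i : ℕ) (x : S) (e : SExpr)
    [hc : IsAtom env (algebraMap ℂ S c) i] [hx : Reify D env x e] :
    Reify D env (c • x) (.mul (.var i) e) :=
  ⟨by rw [SExpr.val, ← hx.eq, SExpr.val, ← hc.eq, Algebra.smul_def]⟩

variable {D} [SuperAlg S]

/-- Two differential superpolynomials with the same expansion are equal. -/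
theorem eq_of_check (hD : IsEvenDer D) (ks : List Kind) (env : List S)
    (hk : List.Forall₂ (HasKind D) ks env) {x y : S} {e f : SExpr}
    [hx : Reify D env x e] [hy : Reify D env y f]
    (h : isZero ((SExpr.sub e f).terms ks) = true) : x = y := by
  have h1 := termsVal_eq_zero (D := D) (env := env) h
  rw [SExpr.termsVal_terms hD hk, SExpr.val, ← hx.eq, ← hy.eq] at h1
  exact sub_eq_zero.1 h1

/-- A differential superpolynomial whose integration by parts succeeds is a total derivative. -/
theorem mem_range_of_check (hD : IsEvenDer D) (ks : List Kind) (env : List S)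
    (hk : List.Forall₂ (HasKind D) ks env) (i n : ℕ) {x : S} {e : SExpr} [hx : Reify D env x e]
    (h : isZero (e.terms ks ++ negTerms (derTerms ks (antiTerms ks i n (e.terms ks)))) = true) :
    x ∈ LinearMap.range D := by
  have h1 := termsVal_eq_zero (D := D) (env := env) h
  rw [termsVal_append, termsVal_neg, SExpr.termsVal_terms hD hk, termsVal_der hD hk,
    ← hx.eq] at h1
  exact ⟨_, (sub_eq_zero.1 ((sub_eq_add_neg _ _).trans h1)).symm⟩

end Reify

end SuperAlg
end SuperGBK

namespace SuperGBK
noncomputable section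
open JetAlg SuperAlg

/-! ### The Hamiltonian operators -/

instance {ι : Type} (odd : ι → Bool) : SuperAlg (JetAlg odd) where
  par := (parity odd).toRingHom
  comm_of_even _ y hx := IsEven.mul_comm hx y
  anticomm_of_odd _ _ hx hy := IsOdd.anticomm hx hy

theorem isEvenDer_D {ι : Type} (odd : ι → Bool) : IsEvenDer (D odd) :=
  ⟨D_mul, parity_D⟩

/-- A column whose entries have the parities of the fields. -/
abbrev Typed (G : Fin 4 → Alg) : Prop := ∀ i, HasParity (oddField i) (G i)

theorem Typed.kinds {G : Fin 4 → Alg} (hG : Typed G) :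
    HasKind dx .even (G 0) ∧ HasKind dx .even (G 1) ∧ HasKind dx .odd (G 2) ∧
      HasKind dx .odd (G 3) :=
  ⟨hasParity_false.1 (hG 0), hasParity_false.1 (hG 1), hasParity_true.1 (hG 2),
    hasParity_true.1 (hG 3)⟩

theorem Typed.parity {G : Fin 4 → Alg} (hG : Typed G) :
    JetAlg.parity oddField (G 0) = G 0 ∧ JetAlg.parity oddField (G 1) = G 1 ∧
      JetAlg.parity oddField (G 2) = -G 2 ∧ JetAlg.parity oddField (G 3) = -G 3 :=
  hG.kinds

theorem hasKind_algebraMap (c : ℂ) : HasKind dx .const (algebraMap ℂ Alg c) :=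
  ⟨(parity oddField).commutes c, D_algebraMap c⟩

theorem typed_field : Typed field := fun i => hasParity_gen (i, 0)

/-! ### The pencil, its skew-adjointness and its trilinear form -/

/-- The pencil `c₁ J + c₂ R` applied to a column. -/
def pencilAct (c₁ c₂ : ℂ) (G : Fin 4 → Alg) : Fin 4 → Alg :=
  let h : ℂ := 1 / 2
  let q : ℂ := 1 / 4
  ![c₁ • -dx (G 1) + c₂ • (-(2 * dx (G 0)) + h • dx (dx (G 1)) - h • dx (fv * G 1) - dx (fα * G 3)),
    c₁ • (-dx (G 0) - h • (fα * G 2) + h • (fβ * G 3)) +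
      c₂ • (-(h • (fv * dx (G 0))) - h • dx (dx (G 0)) - h • (fw * dx (G 1)) - h • dx (fw * G 1)
        - dx (G 1) - q • dx (fα * G 2) - q • (fv * (fα * G 2)) - h • (fβ * G 2)
        + q • dx (fβ * G 3) + (fw + 1) * (fα * G 3) + q • (fv * (fβ * G 3))),
    c₁ • (-(h • (fα * G 1)) - h • G 3) +
      c₂ • (q • (fα * dx (G 1)) - q • (fv * (fα * G 1)) - h • (fβ * G 1) + h • G 2 + h • dx (G 3)
        - q • (fv * G 3)),
    c₁ • (h • (fβ * G 1) - h • G 2) +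
      c₂ • (fα * dx (G 0) - q • (fβ * dx (G 1)) + (fw + 1) * (fα * G 1) + q • (fv * (fβ * G 1))
        - h • dx (G 2) - q • (fv * G 2) + (fw + 1) * G 3 - fα * (fβ * G 3))]

theorem act_pencil (c₁ c₂ : ℂ) (G : Fin 4 → Alg) : act (c₁ • J + c₂ • R) G = pencilAct c₁ c₂ G := by
  funext i
  fin_cases i <;>
    simp [act, J, R, opJ, opR, pencilAct, Fin.sum_univ_four, add_mul, two_mul] <;> module

/-- The derivative of the coefficients of the pencil `c₁ J + c₂ R` in the direction `X`. -/
def pencilVar (c₁ c₂ : ℂ) (X G : Fin 4 → Alg) : Fin 4 → Alg :=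
  let h : ℂ := 1 / 2
  let q : ℂ := 1 / 4
  ![c₂ • (-(h • dx (X 0 * G 1)) - dx (X 2 * G 3)),
    c₁ • (-(h • (X 2 * G 2)) + h • (X 3 * G 3)) +
      c₂ • (-(h • (X 0 * dx (G 0))) - h • (X 1 * dx (G 1)) - h • dx (X 1 * G 1)
        - q • dx (X 2 * G 2) - q • (X 0 * (fα * G 2)) - q • (fv * (X 2 * G 2)) - h • (X 3 * G 2)
        + q • dx (X 3 * G 3) + X 1 * (fα * G 3) + (fw + 1) * (X 2 * G 3) + q • (X 0 * (fβ * G 3))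
        + q • (fv * (X 3 * G 3))),
    c₁ • -(h • (X 2 * G 1)) +
      c₂ • (q • (X 2 * dx (G 1)) - q • (X 0 * (fα * G 1)) - q • (fv * (X 2 * G 1)) - h • (X 3 * G 1)
        - q • (X 0 * G 3)),
    c₁ • (h • (X 3 * G 1)) +
      c₂ • (X 2 * dx (G 0) - q • (X 3 * dx (G 1)) + X 1 * (fα * G 1) + (fw + 1) * (X 2 * G 1)
        + q • (X 0 * (fβ * G 1)) + q • (fv * (X 3 * G 1)) - q • (X 0 * G 2) + X 1 * G 3
        - X 2 * (fβ * G 3) - fα * (X 3 * G 3))]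

theorem ev_field {X : Fin 4 → Alg} (hX : Typed X) (i : Fin 4) : ev X hX (field i) = X i := by
  simp [field, ev_gen]

theorem ev_pencilAct (c₁ c₂ : ℂ) {X : Fin 4 → Alg} (hX : Typed X) (G : Fin 4 → Alg) (i : Fin 4) :
    ev X hX (pencilAct c₁ c₂ G i) =
      pencilAct c₁ c₂ (fun j => ev X hX (G j)) i + pencilVar c₁ c₂ X G i := by
  fin_cases i <;>
    simp [pencilAct, pencilVar, ev_mul, ev_D, ev_field, two_mul, add_mul, mul_add] <;> module

set_option synthInstance.maxHeartbeats 2000000 in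
set_option synthInstance.maxSize 100000 in
set_option maxRecDepth 100000 in
-- Skew-adjointness holds for arbitrary covectors, not just gradients, so the entries of F and G are
-- independent atoms and removing the derivatives from G leaves zero.
theorem pencil_skew (c₁ c₂ : ℂ) {F G : Fin 4 → Alg} (hF : Typed F) (hG : Typed G) :
    ∑ i, F i * pencilAct c₁ c₂ G i + ∑ i, G i * pencilAct c₁ c₂ F i ∈ LinearMap.range dx := by
  obtain ⟨F0, F1, F2, F3⟩ := hF.kinds
  obtain ⟨G0, G1, G2, G3⟩ := hG.kinds
  obtain ⟨u0, u1, u2, u3⟩ := typed_field.kinds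
  simp only [pencilAct, Fin.sum_univ_four, Matrix.cons_val]
  exact mem_range_of_check (isEvenDer_D _)
    [.const, .const, .even, .even, .odd, .odd, .even, .even, .odd, .odd, .even, .even, .odd, .odd]
    [algebraMap ℂ Alg c₁, algebraMap ℂ Alg c₂, field 0, field 1, field 2, field 3,
      F 0, F 1, F 2, F 3, G 0, G 1, G 2, G 3]
    (by simp only [List.forall₂_cons, List.forall₂_nil_left_iff, hasKind_algebraMap]; tauto)
    -- Atom 10 is `G 0`: derivatives are moved off G, in at most three rounds.
    10 3 (by decide +kernel)

theorem typed_pencilAct (c₁ c₂ : ℂ) {G : Fin 4 → Alg} (hG : Typed G) :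
    Typed (pencilAct c₁ c₂ G) := by
  have hu := typed_field.parity
  have hG' := hG.parity
  intro i
  fin_cases i
  · exact hasParity_false.2 (by simp [IsEven, pencilAct, parity_D, hu, hG', two_mul])
  · exact hasParity_false.2 (by simp [IsEven, pencilAct, parity_D, hu, hG', two_mul])
  · exact hasParity_true.2 (by simp [IsOdd, pencilAct, parity_D, hu, hG']; module)
  · exact hasParity_true.2 (by simp [IsOdd, pencilAct, parity_D, hu, hG']; module)

set_option synthInstance.maxHeartbeats 2000000 in
set_option synthInstance.maxSize 100000 in
set_option maxRecDepth 100000 in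
-- This is the vanishing of the Schouten bracket of the pencil with itself, for free covectors. With
-- c₁ and c₂ as constant atoms, the parts in c₁², c₁c₂ and c₂² are settled at once: J,
-- compatibility, R.
theorem pencil_jacobi (c₁ c₂ : ℂ) {F G H : Fin 4 → Alg} (hF : Typed F) (hG : Typed G)
    (hH : Typed H) :
    ∑ i, F i * pencilVar c₁ c₂ (pencilAct c₁ c₂ H) G i +
      ∑ i, G i * pencilVar c₁ c₂ (pencilAct c₁ c₂ F) H i +
      ∑ i, H i * pencilVar c₁ c₂ (pencilAct c₁ c₂ G) F i ∈ LinearMap.range dx := by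
  obtain ⟨F0, F1, F2, F3⟩ := hF.kinds
  obtain ⟨G0, G1, G2, G3⟩ := hG.kinds
  obtain ⟨H0, H1, H2, H3⟩ := hH.kinds
  obtain ⟨u0, u1, u2, u3⟩ := typed_field.kinds
  simp only [pencilAct, pencilVar, Fin.sum_univ_four, Matrix.cons_val]
  exact mem_range_of_check (isEvenDer_D _)
    [.const, .const, .even, .even, .odd, .odd, .even, .even, .odd, .odd, .even, .even, .odd, .odd,
      .even, .even, .odd, .odd]
    [algebraMap ℂ Alg c₁, algebraMap ℂ Alg c₂, field 0, field 1, field 2, field 3,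
      F 0, F 1, F 2, F 3, G 0, G 1, G 2, G 3, H 0, H 1, H 2, H 3]
    (by simp only [List.forall₂_cons, List.forall₂_nil_left_iff, hasKind_algebraMap]; tauto)
    -- Atom 14 is `H 0`; each of the three sums is linear in H and its derivatives.
    14 4 (by decide +kernel)

/-! ### From the trilinear form to the Jacobi identity -/

theorem typed_grad {f : Alg} (hf : IsEven f) : Typed (grad f) := fun i => by
  have h := (hasParity_false.2 hf).euler i
  rwa [Bool.false_xor] at h

theorem ev_sub_sum_grad_mem {X : Fin 4 → Alg} (hX : Typed X) (f : Alg) :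
    ev X hX f - ∑ i, grad f i * X i ∈ LinearMap.range dx := ev_sub_sum_euler_mem hX f

/-- A commutator of derivations commuting with ∂ is again one, so it is enough to compare both sides
on the fields. -/
theorem ev_ev_sub (X Y : Fin 4 → Alg) (hX : Typed X) (hY : Typed Y) (f : Alg) :
    ev X hX (ev Y hY f) - ev Y hY (ev X hX f) =
      ev (fun i => ev X hX (Y i) - ev Y hY (X i)) (fun i => ((hY i).ev hX).sub ((hX i).ev hY)) f := by
  refine DFunLike.congr_fun (f := ev X hX ∘ₗ ev Y hY - ev Y hY ∘ₗ ev X hX)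
    (eq_of_apply_field ?_ (fun f g => ev_mul _ f g) ?_ (fun f => ev_D _ f) ?_) f
  · intro f g
    simp only [LinearMap.sub_apply, LinearMap.comp_apply, ev_mul, map_add]
    noncomm_ring
  · intro f
    simp only [LinearMap.sub_apply, LinearMap.comp_apply, ev_D, map_sub]
  · intro i
    simp [ev_gen]

/-- The Fréchet derivative of a gradient is self-adjoint. -/
theorem sum_ev_grad_mul_sub_mem {X Y : Fin 4 → Alg} (hX : Typed X) (hY : Typed Y) (f : Alg) :
    ∑ i, ev X hX (grad f i) * Y i - ∑ i, ev Y hY (grad f i) * X i ∈ LinearMap.range dx := by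
  have key : ∀ {X Y : Fin 4 → Alg} (hX : Typed X) (hY : Typed Y),
      ev X hX (ev Y hY f) - (∑ i, ev X hX (grad f i) * Y i + ∑ i, grad f i * ev X hX (Y i)) ∈
        LinearMap.range dx := by
    intro X Y hX hY
    obtain ⟨s, hs⟩ := ev_sub_sum_grad_mem hY f
    refine ⟨ev X hX s, ?_⟩
    rw [← ev_D, hs, map_sub, map_sum, ← Finset.sum_add_distrib]
    simp only [ev_mul]
  -- Antisymmetrize the second variation in X and Y: the terms containing the gradient
  -- undifferentiated form the first variation along [X, Y] and cancel against it.
  have h := sub_mem (sub_mem (ev_sub_sum_grad_mem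
    (X := fun i => ev X hX (Y i) - ev Y hY (X i)) (fun i => ((hY i).ev hX).sub ((hX i).ev hY)) f)
    (key hX hY)) (neg_mem (key hY hX))
  rw [← ev_ev_sub] at h
  convert h using 1
  simp only [mul_sub, Finset.sum_sub_distrib]
  abel

/-- A skew-adjoint operator whose trilinear form vanishes modulo total derivatives is
super-Hamiltonian. -/
theorem isSuperHamiltonian_of_trilinear {P : Matrix (Fin 4) (Fin 4) (Module.End ℂ Alg)}
    (Q : (Fin 4 → Alg) → (Fin 4 → Alg) → Fin 4 → Alg)
    (typed : ∀ {G}, Typed G → Typed (act P G))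
    (skew : ∀ {F G}, Typed F → Typed G →
      ∑ i, F i * act P G i + ∑ i, G i * act P F i ∈ LinearMap.range dx)
    (var : ∀ {X} (hX : Typed X) (G) (i),
      ev X hX (act P G i) = act P (fun j => ev X hX (G j)) i + Q X G i)
    (trilinear : ∀ {F G H}, Typed F → Typed G → Typed H →
      ∑ i, F i * Q (act P H) G i + ∑ i, G i * Q (act P F) H i + ∑ i, H i * Q (act P G) F i ∈
        LinearMap.range dx) :
    IsSuperHamiltonian P := by
  have even : ∀ f g : Alg, IsEven f → IsEven g → IsEven (bracket P f g) := by
    intro f g hf hg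
    rw [← hasParity_false]
    refine HasParity.sum _ fun i _ => ?_
    have h := (typed_grad hf i).mul (typed (typed_grad hg) i)
    rwa [Bool.xor_self] at h
  refine ⟨even, fun f g hf hg => skew (typed_grad hf) (typed_grad hg), ?_⟩
  -- Modulo ∂, {{f,g},h} is the derivative of {f,g} along P∇h. Skew-adjointness moves P off the
  -- derivative of ∇g, which leaves two second variations and the trilinear term.
  have key : ∀ f g h : Alg, IsEven f → IsEven g → (hh : IsEven h) →
      bracket P (bracket P f g) h -
        (∑ i, ev _ (typed (typed_grad hh)) (grad f i) * act P (grad g) i -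
          ∑ i, ev _ (typed (typed_grad hh)) (grad g i) * act P (grad f) i +
          ∑ i, grad f i * Q (act P (grad h)) (grad g) i) ∈ LinearMap.range dx := by
    intro f g h hf hg hh
    have h1 := ev_sub_sum_grad_mem (typed (typed_grad hh)) (bracket P f g)
    have h2 := skew (typed_grad hf) (G := fun j => ev _ (typed (typed_grad hh)) (grad g j))
      fun j => (typed_grad hg j).ev _
    refine (Submodule.neg_mem_iff _).1 ?_
    convert sub_mem h1 h2 using 1
    rw [bracket, bracket, map_sum]
    simp only [ev_mul, var, mul_add, Finset.sum_add_distrib]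
    abel
  intro f g h hf hg hh
  -- In the cyclic sum the six second variations pair off, two for each functional, and cancel by
  -- self-adjointness.
  have s1 := sum_ev_grad_mul_sub_mem (typed (typed_grad hh)) (typed (typed_grad hg)) f
  have s2 := sum_ev_grad_mul_sub_mem (typed (typed_grad hf)) (typed (typed_grad hh)) g
  have s3 := sum_ev_grad_mul_sub_mem (typed (typed_grad hg)) (typed (typed_grad hf)) h
  have t := trilinear (typed_grad hf) (typed_grad hg) (typed_grad hh)
  have k := add_mem (add_mem (key f g h hf hg hh) (key g h f hg hh hf)) (key h f g hh hf hg)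
  convert add_mem (add_mem k t) (add_mem (add_mem s1 s2) s3) using 1
  abel

theorem isSuperHamiltonian_pencil (c₁ c₂ : ℂ) : IsSuperHamiltonian (c₁ • J + c₂ • R) := by
  refine isSuperHamiltonian_of_trilinear (pencilVar c₁ c₂) ?_ ?_ ?_ ?_
  · intro G hG
    rw [act_pencil]
    exact typed_pencilAct c₁ c₂ hG
  · intro F G hF hG
    rw [act_pencil, act_pencil]
    exact pencil_skew c₁ c₂ hF hG
  · intro X hX G i
    rw [act_pencil, act_pencil]
    exact ev_pencilAct c₁ c₂ hX G i
  · intro F G H hF hG hH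
    rw [act_pencil, act_pencil, act_pencil]
    exact pencil_jacobi c₁ c₂ hF hG hH

/-! ### The factorization of `R` -/

/-- The symbol ∂⁻¹ occurs only in the first row of 𝓛, and the only nonzero entry of J that meets
this row is -∂, so ∂∂⁻¹ = 1 removes it. The rest is normal ordering: every ∂ to the right, the odd
fields anticommuting. -/
theorem opJ_mul_opL {E : Type} [Ring E] [Algebra ℂ E] (mul : Alg →ₐ[ℂ] E) (d dinv : E)
    (hd : ∀ f, d * mul f = mul f * d + mul (dx f)) (hdinv : d * dinv = 1) :
    opJ mul d * opL mul d dinv = opR mul d := by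
  obtain ⟨u0, u1, u2, u3⟩ := typed_field.kinds
  have hv := hd fv
  have hw := hd fw
  have hα := hd fα
  have hβ := hd fβ
  have hαv : mul fα * mul fv = mul fv * mul fα := by
    rw [← map_mul, ← map_mul, IsEven.mul_comm u0]
  have hαw : mul fα * mul fw = mul fw * mul fα := by
    rw [← map_mul, ← map_mul, IsEven.mul_comm u1]
  have hβv : mul fβ * mul fv = mul fv * mul fβ := by
    rw [← map_mul, ← map_mul, IsEven.mul_comm u0]
  have hβα : mul fβ * mul fα = -(mul fα * mul fβ) := by
    rw [← map_mul, ← map_mul, IsOdd.anticomm u3 u2, map_neg]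
  have hαα : mul fα * mul fα = 0 := by
    rw [← map_mul, mul_self_of_odd u2, map_zero]
  have hββ : mul fβ * mul fβ = 0 := by
    rw [← map_mul, mul_self_of_odd u3, map_zero]
  have assoc : ∀ {a b c : E}, a * b = c → ∀ x, a * (b * x) = c * x := fun h x => by
    rw [← mul_assoc, h]
  have hαw' := assoc hαw
  have hαα' := assoc hαα
  have hdinv' := assoc hdinv
  ext i j
  fin_cases i <;> fin_cases j <;>
    simp only [opJ, opL, opR, recLocal, recRow, Matrix.mul_apply, Fin.sum_univ_four, Matrix.add_apply,
      Matrix.cons_val, Matrix.of_apply, Fin.zero_eta, Fin.mk_one, Fin.reduceFinMk, Fin.isValue,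
      mul_add, add_mul, mul_sub, neg_mul, mul_neg,
      zero_mul, mul_zero, add_zero, zero_add, smul_mul_assoc, mul_smul_comm, mul_assoc, two_mul,
      mul_two, mul_one, one_mul, hv, hw, hα, hβ, hαv, hαw, hβv, hβα, hαα, hββ, hαw', hαα', hdinv'] <;> module

/-! ### Power series in `z = λ⁻¹` -/

abbrev PS : Type := PowerSeries Alg

/-- A linear map of `Alg` applied to all coefficients. -/
def cmap (T : Alg →ₗ[ℂ] Alg) : PS →ₗ[ℂ] PS where
  toFun f := PowerSeries.mk fun n => T (PowerSeries.coeff n f)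
  map_add' f g := by ext n; simp
  map_smul' c f := by ext n; simp

@[simp] theorem coeff_cmap (T : Alg →ₗ[ℂ] Alg) (n : ℕ) (f : PS) :
    PowerSeries.coeff n (cmap T f) = T (PowerSeries.coeff n f) := by simp [cmap]

instance : SuperAlg PS where
  par := PowerSeries.map (parity oddField).toRingHom
  comm_of_even x y hx := by
    have h : ∀ n, IsEven (PowerSeries.coeff n x) := fun n => by
      have := congrArg (PowerSeries.coeff n) hx
      rwa [PowerSeries.coeff_map] at this
    ext n
    rw [PowerSeries.coeff_mul, PowerSeries.coeff_mul, ← Finset.Nat.sum_antidiagonal_swap]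
    exact Finset.sum_congr rfl fun p _ => (h _).mul_comm _
  anticomm_of_odd x y hx hy := by
    have h : ∀ z : PS, PowerSeries.map (parity oddField).toRingHom z = -z →
        ∀ n, IsOdd (PowerSeries.coeff n z) := fun z hz n => by
      have := congrArg (PowerSeries.coeff n) hz
      rwa [PowerSeries.coeff_map, map_neg] at this
    ext n
    rw [map_neg, PowerSeries.coeff_mul, PowerSeries.coeff_mul, ← Finset.Nat.sum_antidiagonal_swap,
      ← Finset.sum_neg_distrib]
    exact Finset.sum_congr rfl fun p _ => (h x hx _).anticomm (h y hy _)

theorem coeff_par (n : ℕ) (f : PS) :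
    PowerSeries.coeff n (par f) = parity oddField (PowerSeries.coeff n f) :=
  PowerSeries.coeff_map _ _ _

theorem par_eq_self_iff {f : PS} : par f = f ↔ ∀ n, IsEven (PowerSeries.coeff n f) := by
  rw [PowerSeries.ext_iff]
  simp only [coeff_par, IsEven]

theorem par_eq_neg_iff {f : PS} : par f = -f ↔ ∀ n, IsOdd (PowerSeries.coeff n f) := by
  rw [PowerSeries.ext_iff]
  simp only [coeff_par, IsOdd, map_neg]

theorem isEvenDer_cmap {T : Alg →ₗ[ℂ] Alg} (hT : IsEvenDer T) : IsEvenDer (cmap T) where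
  leibniz f g := by
    ext n
    simp only [coeff_cmap, PowerSeries.coeff_mul, map_add, map_sum, hT.leibniz,
      Finset.sum_add_distrib]
  par f := by
    ext n
    rw [coeff_par, coeff_cmap, coeff_cmap, coeff_par]
    exact hT.par _

/-- The derivation `z d/dz`. -/
def zder : PS →ₗ[ℂ] PS where
  toFun f := PowerSeries.mk fun n => (n : ℂ) • PowerSeries.coeff n f
  map_add' f g := by ext n; simp
  map_smul' c f := by ext n; simp [smul_comm c]

@[simp] theorem coeff_zder (n : ℕ) (f : PS) :
    PowerSeries.coeff n (zder f) = (n : ℂ) • PowerSeries.coeff n f := by simp [zder]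

theorem isEvenDer_zder : IsEvenDer zder where
  leibniz f g := by
    ext n
    simp only [coeff_zder, PowerSeries.coeff_mul, map_add, Finset.smul_sum,
      ← Finset.sum_add_distrib]
    refine Finset.sum_congr rfl fun p hp => ?_
    rw [← Finset.HasAntidiagonal.mem_antidiagonal.1 hp, smul_mul_assoc, mul_smul_comm, ← add_smul]
    push_cast
    rfl
  par f := by
    ext n
    rw [coeff_par, coeff_zder, coeff_zder, coeff_par, map_smul]

/-- `∂` on power series. -/
abbrev Dx : PS →ₗ[ℂ] PS := cmap dx

theorem isEvenDer_Dx : IsEvenDer Dx := isEvenDer_cmap (isEvenDer_D _)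

theorem cmap_comm {S T : Alg →ₗ[ℂ] Alg} (h : ∀ f, S (T f) = T (S f)) (f : PS) :
    cmap S (cmap T f) = cmap T (cmap S f) := by
  ext n
  simp [h]

theorem zder_cmap (T : Alg →ₗ[ℂ] Alg) (f : PS) : zder (cmap T f) = cmap T (zder f) := by
  ext n
  simp

theorem hasKind_X : HasKind Dx .const (PowerSeries.X : PS) := by
  constructor
  · exact PowerSeries.map_X _
  · ext n
    rw [coeff_cmap, PowerSeries.coeff_X]
    split_ifs <;> simp

theorem cmap_C (T : Alg →ₗ[ℂ] Alg) (f : Alg) :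
    cmap T (PowerSeries.C f) = PowerSeries.C (T f) := by
  ext n
  rw [coeff_cmap, PowerSeries.coeff_C, PowerSeries.coeff_C]
  split_ifs <;> simp

theorem par_C (f : Alg) : par (PowerSeries.C f : PS) = PowerSeries.C (parity oddField f) :=
  PowerSeries.map_C _ _

abbrev sv : PS := PowerSeries.C fv
abbrev sw : PS := PowerSeries.C fw
abbrev sα : PS := PowerSeries.C fα
abbrev sβ : PS := PowerSeries.C fβ

theorem hasKind_fields : HasKind Dx .even sv ∧ HasKind Dx .even sw ∧ HasKind Dx .odd sα ∧
    HasKind Dx .odd sβ := by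
  obtain ⟨u0, u1, u2, u3⟩ := typed_field.parity
  refine ⟨?_, ?_, ?_, ?_⟩ <;> simp only [HasKind, par_C, u0, u1, u2, u3, map_neg]

theorem algebraMap_PS (c : ℂ) : algebraMap ℂ PS c = PowerSeries.C (algebraMap ℂ Alg c) :=
  PowerSeries.algebraMap_apply ..

theorem hasKind_algebraMap_PS (c : ℂ) : HasKind Dx .const (algebraMap ℂ PS c) := by
  constructor
  · rw [algebraMap_PS, par_C, AlgHom.commutes]
  · rw [algebraMap_PS, cmap_C, D_algebraMap, map_zero]

/-- A power series with constant, nonzero constant term can be cancelled. -/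
theorem isUnit_of_constantCoeff {f : PS} {c : ℂ} (hc : c ≠ 0)
    (hf : PowerSeries.constantCoeff f = algebraMap ℂ Alg c) : IsUnit f := by
  rw [PowerSeries.isUnit_iff_constantCoeff, hf]
  exact (isUnit_iff_ne_zero.2 hc).map _

/-! ### The stationary equation -/

/-- The equation `N_x = [M, N]` for the power series
`N = [[a, b, ρ], [g, -a, δ], [δ, -ρ, 0]]`, multiplied by `z`. -/
structure SeriesSol (a b g ρ δ : PS) : Prop where
  par_a : par a = a
  par_b : par b = b
  par_g : par g = g
  par_ρ : par ρ = -ρ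
  par_δ : par δ = -δ
  eq_a : PowerSeries.X * Dx a = PowerSeries.X * (g + 2 * ((sw + 1) * b) + sα * δ + sβ * ρ)
  eq_b : PowerSeries.X * Dx b = -(2 * b) + PowerSeries.X * (sv * b - 2 * a - 2 * (sα * ρ))
  eq_g : PowerSeries.X * Dx g =
    2 * g + PowerSeries.X * (-(4 * ((sw + 1) * a)) - sv * g + 2 * (sβ * δ))
  eq_ρ : PowerSeries.X * Dx ρ =
    -ρ + PowerSeries.X * ((1 / 2 : ℂ) • (sv * ρ) + δ - a * sα - b * sβ)
  eq_δ : PowerSeries.X * Dx δ =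
    δ + PowerSeries.X * (-(2 * ((sw + 1) * ρ)) - (1 / 2 : ℂ) • (sv * δ) - g * sα + a * sβ)

theorem mk_par_eq {f : ℕ → Alg} : par (PowerSeries.mk f : PS) = PowerSeries.mk f ↔
    ∀ n, IsEven (f n) := by
  simp [par_eq_self_iff]

theorem mk_par_neg {f : ℕ → Alg} : par (PowerSeries.mk f : PS) = -PowerSeries.mk f ↔
    ∀ n, IsOdd (f n) := by
  simp [par_eq_neg_iff]

/-- The matrix `z M`. -/
def zM : Matrix (Fin 3) (Fin 3) PS :=
  !![-1 + PowerSeries.X * ((1 / 2 : ℂ) • sv), PowerSeries.X, PowerSeries.X * sα;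
     PowerSeries.X * (-(2 * sw) - 2), 1 - PowerSeries.X * ((1 / 2 : ℂ) • sv), PowerSeries.X * sβ;
     PowerSeries.X * sβ, -(PowerSeries.X * sα), 0]

/-- The matrix of power series. -/
def matN (a b g ρ δ : PS) : Matrix (Fin 3) (Fin 3) PS :=
  !![a, b, ρ; g, -a, δ; δ, -ρ, 0]

/-- The embedding of power series into Laurent series. -/
abbrev toSer : PS →+* Ser := HahnSeries.ofPowerSeries ℤ Alg

/-- The entry `N₂₁`. -/
def Coeffs.g (N : Coeffs) (m : ℕ) : Alg := -(2 * N.b m) + 2 * N.c m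

theorem Coeffs.ser_eq (N : Coeffs) : N.ser = (matN (PowerSeries.mk N.a) (PowerSeries.mk N.b)
    (PowerSeries.mk N.g) (PowerSeries.mk N.ρ) (PowerSeries.mk N.δ)).map toSer := by
  have h0 : (PowerSeries.mk fun _ => 0 : PS) = 0 := by ext; simp
  have hn : ∀ f : ℕ → Alg, (PowerSeries.mk fun m => -f m : PS) = -PowerSeries.mk f := fun f => by
    ext; simp
  ext1 i j
  fin_cases i <;> fin_cases j <;>
    simp [Coeffs.ser, Coeffs.mat, matN, h0, hn]; rfl

theorem toSer_C (f : Alg) : toSer (PowerSeries.C f) = con f := HahnSeries.ofPowerSeries_C _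

theorem toSer_X_mul_lam : toSer PowerSeries.X * lam = 1 := by
  rw [HahnSeries.ofPowerSeries_X, lam, HahnSeries.single_mul_single]
  simp

theorem lam_mul_toSer_X : lam * toSer PowerSeries.X = 1 := by
  rw [HahnSeries.ofPowerSeries_X, lam, HahnSeries.single_mul_single]
  simp

theorem toSer_X_mul (f : Ser) : toSer PowerSeries.X * f = f * toSer PowerSeries.X := by
  ext n
  rw [HahnSeries.ofPowerSeries_X, HahnSeries.coeff_single_mul, HahnSeries.coeff_mul_single, one_mul,
    mul_one]

theorem toSer_X_mul_specM (i j : Fin 3) :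
    toSer PowerSeries.X * specM i j = toSer (zM i j) := by
  have hC : ∀ f : Alg, toSer PowerSeries.X * con f =
      toSer (PowerSeries.X * PowerSeries.C f) := fun f => by
    rw [map_mul, toSer_C]
  have hh : (1 / 2 : ℂ) • sv = PowerSeries.C ((1 / 2 : ℂ) • fv) := by
    ext n
    rw [PowerSeries.coeff_smul, PowerSeries.coeff_C, PowerSeries.coeff_C]
    split_ifs <;> simp
  have h2 : (-(2 * sw) - 2 : PS) = PowerSeries.C (-(2 * fw) - 2) := by
    simp [← one_add_one_eq_two]
  rw [zM, specM, hh, h2]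
  fin_cases i <;> fin_cases j <;>
    simp only [Matrix.of_apply, Matrix.cons_val, Fin.zero_eta, Fin.mk_one, Fin.reduceFinMk,
      Fin.isValue, mul_add, mul_sub, mul_neg, toSer_X_mul_lam, hC, map_add, map_sub, map_neg,
      map_one, mul_one, mul_zero, map_zero]

theorem toSer_map (T : Alg →ₗ[ℂ] Alg) (f : PS) : (toSer f).map T = toSer (cmap T f) := by
  ext n
  rw [HahnSeries.map_coeff]
  simp only [PowerSeries.coeff_coe]
  split_ifs <;> simp

/-- Multiplication by the central unit z turns M into a matrix of power series, so the equation can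
be stated without Laurent series. -/
theorem stationary_iff (n : Matrix (Fin 3) (Fin 3) PS) :
    mapCoeff dx (n.map toSer) = specM * n.map toSer - n.map toSer * specM ↔
      ∀ i j, PowerSeries.X * Dx (n i j) = (zM * n - n * zM) i j := by
  have hz₁ : ∀ i j, toSer PowerSeries.X * (specM * n.map toSer) i j = toSer ((zM * n) i j) := by
    intro i j
    rw [Matrix.mul_apply, Matrix.mul_apply, Finset.mul_sum, map_sum]
    refine Finset.sum_congr rfl fun k _ => ?_
    rw [← mul_assoc, toSer_X_mul_specM, map_mul, Matrix.map_apply]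
  have hz₂ : ∀ i j, toSer PowerSeries.X * (n.map toSer * specM) i j = toSer ((n * zM) i j) := by
    intro i j
    rw [Matrix.mul_apply, Matrix.mul_apply, Finset.mul_sum, map_sum]
    refine Finset.sum_congr rfl fun k _ => ?_
    rw [← mul_assoc, toSer_X_mul, mul_assoc, toSer_X_mul_specM, map_mul, Matrix.map_apply]
  have hz : ∀ i j, toSer PowerSeries.X * (specM * n.map toSer - n.map toSer * specM) i j =
      toSer ((zM * n - n * zM) i j) := by
    intro i j
    rw [Matrix.sub_apply, Matrix.sub_apply, mul_sub, hz₁, hz₂, map_sub]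
  have hx : ∀ i j, toSer PowerSeries.X * mapCoeff dx (n.map toSer) i j =
      toSer (PowerSeries.X * Dx (n i j)) := by
    intro i j
    rw [mapCoeff, Matrix.map_apply, Matrix.map_apply, toSer_map, map_mul]
  constructor
  · intro h i j
    apply HahnSeries.ofPowerSeries_injective (Γ := ℤ)
    rw [← hx, ← hz, h]
  · intro h
    ext1 i j
    have h1 : toSer PowerSeries.X * mapCoeff dx (n.map toSer) i j =
        toSer PowerSeries.X * (specM * n.map toSer - n.map toSer * specM) i j := by
      rw [hx, hz, h]
    have h2 : ∀ f : Ser, f = lam * (toSer PowerSeries.X * f) := fun f => by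
      rw [← mul_assoc, lam_mul_toSer_X, one_mul]
    rw [h2 (mapCoeff dx (n.map toSer) i j), h1, ← h2]

/-- The kinds of the entries of `N`. -/
theorem SeriesSol.kinds {a b g ρ δ : PS} (h : SeriesSol a b g ρ δ) :
    HasKind Dx .even a ∧ HasKind Dx .even b ∧ HasKind Dx .even g ∧ HasKind Dx .odd ρ ∧
      HasKind Dx .odd δ :=
  ⟨h.par_a, h.par_b, h.par_g, h.par_ρ, h.par_δ⟩

set_option synthInstance.maxHeartbeats 400000 in
set_option synthInstance.maxSize 100000 in
set_option maxHeartbeats 1000000 in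
-- The commutator keeps the shape of N: the entries 11 and 22, 13 and 32, 23 and 31 give the same
-- equation up to sign, and 33 is trivial. The parities are needed to reorder the products.
theorem seriesSol_iff {a b g ρ δ : PS} (ha : par a = a) (hb : par b = b) (hg : par g = g)
    (hρ : par ρ = -ρ) (hδ : par δ = -δ) :
    SeriesSol a b g ρ δ ↔
      ∀ i j, PowerSeries.X * Dx (matN a b g ρ δ i j) =
        (zM * matN a b g ρ δ - matN a b g ρ δ * zM) i j := by
  obtain ⟨u0, u1, u2, u3⟩ := hasKind_fields
  have hk : List.Forall₂ (HasKind Dx) [.const, .even, .even, .odd, .odd, .even, .even, .even, .odd, .odd]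
      [PowerSeries.X, sv, sw, sα, sβ, a, b, g, ρ, δ] := by
    simp only [List.forall₂_cons, List.forall₂_nil_left_iff, hasKind_X]
    exact ⟨trivial, u0, u1, u2, u3, ha, hb, hg, hρ, hδ, trivial⟩
  have entries : (∀ i j, PowerSeries.X * Dx (matN a b g ρ δ i j) =
        (zM * matN a b g ρ δ - matN a b g ρ δ * zM) i j) ↔
      (PowerSeries.X * Dx a = PowerSeries.X * (g + 2 * ((sw + 1) * b) + sα * δ + sβ * ρ) ∧
        PowerSeries.X * Dx b = -(2 * b) + PowerSeries.X * (sv * b - 2 * a - 2 * (sα * ρ)) ∧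
        PowerSeries.X * Dx ρ =
          -ρ + PowerSeries.X * ((1 / 2 : ℂ) • (sv * ρ) + δ - a * sα - b * sβ)) ∧
      (PowerSeries.X * Dx g =
          2 * g + PowerSeries.X * (-(4 * ((sw + 1) * a)) - sv * g + 2 * (sβ * δ)) ∧
        PowerSeries.X * Dx (-a) = -(PowerSeries.X * (g + 2 * ((sw + 1) * b) + sα * δ + sβ * ρ)) ∧
        PowerSeries.X * Dx δ =
          δ + PowerSeries.X * (-(2 * ((sw + 1) * ρ)) - (1 / 2 : ℂ) • (sv * δ) - g * sα + a * sβ)) ∧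
      (PowerSeries.X * Dx δ =
          δ + PowerSeries.X * (-(2 * ((sw + 1) * ρ)) - (1 / 2 : ℂ) • (sv * δ) - g * sα + a * sβ) ∧
        PowerSeries.X * Dx (-ρ) =
          -(-ρ + PowerSeries.X * ((1 / 2 : ℂ) • (sv * ρ) + δ - a * sα - b * sβ)) ∧
        PowerSeries.X * Dx 0 = 0) := by
    simp only [Fin.forall_fin_succ, IsEmpty.forall_iff, and_true, matN, zM,
      Matrix.sub_apply, Matrix.mul_apply, Fin.sum_univ_three, Matrix.of_apply, Matrix.cons_val,
      Fin.succ_zero_eq_one, Fin.succ_one_eq_two, Fin.isValue]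
    refine and_congr (and_congr ?_ (and_congr ?_ ?_)) (and_congr (and_congr ?_ (and_congr ?_ ?_))
      (and_congr ?_ (and_congr ?_ ?_))) <;> refine iff_of_eq (congrArg _ ?_) <;>
    exact eq_of_check isEvenDer_Dx [.const, .even, .even, .odd, .odd, .even, .even, .even, .odd, .odd]
      [PowerSeries.X, sv, sw, sα, sβ, a, b, g, ρ, δ] hk (by decide +kernel)
  rw [entries]
  constructor
  · intro h
    refine ⟨⟨h.eq_a, h.eq_b, h.eq_ρ⟩, ⟨h.eq_g, ?_, h.eq_δ⟩, h.eq_δ, ?_, by simp⟩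
    · rw [map_neg, mul_neg, h.eq_a]
    · rw [map_neg, mul_neg, h.eq_ρ]
  · intro h
    exact ⟨ha, hb, hg, hρ, hδ, h.1.1, h.1.2.1, h.2.1.1, h.1.2.2, h.2.1.2.2⟩

/-- The power series `a`, `b`, `g`, `ρ`, `δ` of `N` satisfy the stationary equation. -/
abbrev Coeffs.Sol (N : Coeffs) : Prop := SeriesSol (PowerSeries.mk N.a) (PowerSeries.mk N.b)
  (PowerSeries.mk N.g) (PowerSeries.mk N.ρ) (PowerSeries.mk N.δ)

theorem Coeffs.even_g {N : Coeffs} {m : ℕ} (hb : IsEven (N.b m)) (hc : IsEven (N.c m)) :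
    IsEven (N.g m) := by
  unfold IsEven at *
  simp [Coeffs.g, hb, hc, two_mul]

theorem Coeffs.IsSolution.sol {N : Coeffs} {k₀ : ℂ} (h : N.IsSolution k₀) : N.Sol := by
  have hs := h.stationary
  rw [N.ser_eq, stationary_iff] at hs
  exact (seriesSol_iff (mk_par_eq.2 fun n => (h.even n).1) (mk_par_eq.2 fun n => (h.even n).2.1)
    (mk_par_eq.2 fun n => Coeffs.even_g (h.even n).2.1 (h.even n).2.2)
    (mk_par_neg.2 fun n => (h.odd n).1) (mk_par_neg.2 fun n => (h.odd n).2)).2 hs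

theorem Coeffs.Sol.isSolution {N : Coeffs} {k₀ : ℂ} (h : N.Sol)
    (ha : N.a 0 = algebraMap ℂ Alg k₀) : N.IsSolution k₀ where
  even m := by
    have hb := mk_par_eq.1 h.par_b m
    have hg := mk_par_eq.1 h.par_g m
    refine ⟨mk_par_eq.1 h.par_a m, hb, ?_⟩
    have h1 : N.c m = (1 / 2 : ℂ) • N.g m + N.b m := by
      simp only [Coeffs.g, two_mul]
      module
    unfold IsEven at *
    rw [h1, map_add, map_smul, hb, hg]
  odd m := ⟨mk_par_neg.1 h.par_ρ m, mk_par_neg.1 h.par_δ m⟩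
  init := by
    have h2 : ∀ x : Alg, x + x = 0 → x = 0 := fun x hx => by
      rw [← two_smul ℂ] at hx
      exact (smul_eq_zero.1 hx).resolve_left two_ne_zero
    -- At z = 0 the equations, having been multiplied by z, retain only the terms from [E, N₀],
    -- where E is the λ-coefficient of M; they force the prescribed zero initial values.
    have hb : N.b 0 = 0 := by
      have := congrArg (PowerSeries.coeff 0) h.eq_b
      simp [two_mul] at this
      exact h2 _ (by rw [← neg_eq_zero, neg_add]; exact this.symm)
    have hg : N.g 0 = 0 := by
      have := congrArg (PowerSeries.coeff 0) h.eq_g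
      simp [two_mul] at this
      exact h2 _ this.symm
    have hρ : N.ρ 0 = 0 := by simpa using congrArg (PowerSeries.coeff 0) h.eq_ρ
    have hδ : N.δ 0 = 0 := by simpa using (congrArg (PowerSeries.coeff 0) h.eq_δ).symm
    refine ⟨ha, hb, ?_, hρ, hδ⟩
    have h1 : N.c 0 = (1 / 2 : ℂ) • N.g 0 + N.b 0 := by
      simp only [Coeffs.g, two_mul]
      module
    rw [h1, hb, hg, smul_zero, add_zero]
  stationary := by
    rw [N.ser_eq, stationary_iff]
    exact (seriesSol_iff h.par_a h.par_b h.par_g h.par_ρ h.par_δ).1 h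

/-! ### The recursion for the coefficients -/

/-- Comparing coefficients turns an equation with a term free of z into an initial condition and a
recursion solved for index m + 1. -/
theorem X_mul_eq_add_iff (Y c Z : PS) : PowerSeries.X * Y = c + PowerSeries.X * Z ↔
    PowerSeries.coeff 0 c = 0 ∧ ∀ m, PowerSeries.coeff m Y =
      PowerSeries.coeff (m + 1) c + PowerSeries.coeff m Z := by
  rw [PowerSeries.ext_iff]
  constructor
  · intro h
    refine ⟨by simpa using (h 0).symm, fun m => ?_⟩
    simpa [PowerSeries.coeff_succ_X_mul] using h (m + 1)
  · rintro ⟨h0, h⟩ (_ | m)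
    · simpa using h0.symm
    · simpa [PowerSeries.coeff_succ_X_mul] using h m

theorem eq_zero_of_two_mul {S : Type} [Ring S] [Algebra ℂ S] {x : S} (h : 2 * x = 0) : x = 0 := by
  rw [two_mul, ← two_smul ℂ] at h
  exact (smul_eq_zero.1 h).resolve_left two_ne_zero

theorem coeff_two_mul (m : ℕ) (f : PS) :
    PowerSeries.coeff m (2 * f) = 2 * PowerSeries.coeff m f := by
  rw [two_mul, map_add, two_mul]

theorem coeff_four_mul (m : ℕ) (f : PS) :
    PowerSeries.coeff m (4 * f) = 4 * PowerSeries.coeff m f := by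
  have h : ∀ {S : Type} [Ring S] (x : S), 4 * x = 2 * (2 * x) := fun x => by
    rw [← mul_assoc]; norm_num
  rw [h, coeff_two_mul, coeff_two_mul, ← h]

theorem coeff_one_mul (m : ℕ) (f : PS) :
    PowerSeries.coeff m ((sw + 1) * f) = (fw + 1) * PowerSeries.coeff m f := by
  rw [add_mul, one_mul, map_add, PowerSeries.coeff_C_mul, add_mul, one_mul]

theorem eq_b_iff (a b ρ : PS) :
    PowerSeries.X * Dx b = -(2 * b) + PowerSeries.X * (sv * b - 2 * a - 2 * (sα * ρ)) ↔
      PowerSeries.coeff 0 b = 0 ∧ ∀ m, dx (PowerSeries.coeff m b) =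
        -(2 * PowerSeries.coeff (m + 1) b) + (fv * PowerSeries.coeff m b -
          2 * PowerSeries.coeff m a - 2 * (fα * PowerSeries.coeff m ρ)) := by
  rw [X_mul_eq_add_iff]
  refine and_congr ?_ (forall_congr' fun m => ?_)
  · rw [map_neg, coeff_two_mul, neg_eq_zero]
    exact ⟨eq_zero_of_two_mul, fun h => by rw [h, mul_zero]⟩
  · simp only [coeff_cmap, map_neg, map_sub, coeff_two_mul, PowerSeries.coeff_C_mul]

theorem eq_g_iff (a g δ : PS) :
    PowerSeries.X * Dx g =
      2 * g + PowerSeries.X * (-(4 * ((sw + 1) * a)) - sv * g + 2 * (sβ * δ)) ↔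
      PowerSeries.coeff 0 g = 0 ∧ ∀ m, dx (PowerSeries.coeff m g) =
        2 * PowerSeries.coeff (m + 1) g + (-(4 * ((fw + 1) * PowerSeries.coeff m a)) -
          fv * PowerSeries.coeff m g + 2 * (fβ * PowerSeries.coeff m δ)) := by
  rw [X_mul_eq_add_iff]
  refine and_congr ?_ (forall_congr' fun m => ?_)
  · rw [coeff_two_mul]
    exact ⟨eq_zero_of_two_mul, fun h => by rw [h, mul_zero]⟩
  · simp only [coeff_cmap, map_neg, map_add, map_sub, coeff_two_mul, coeff_four_mul, coeff_one_mul,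
      PowerSeries.coeff_C_mul]

theorem eq_ρ_iff {a b : PS} (ha : par a = a) (hb : par b = b) (ρ δ : PS) :
    PowerSeries.X * Dx ρ =
      -ρ + PowerSeries.X * ((1 / 2 : ℂ) • (sv * ρ) + δ - a * sα - b * sβ) ↔
      PowerSeries.coeff 0 ρ = 0 ∧ ∀ m, dx (PowerSeries.coeff m ρ) =
        -PowerSeries.coeff (m + 1) ρ + ((1 / 2 : ℂ) • (fv * PowerSeries.coeff m ρ) +
          PowerSeries.coeff m δ - fα * PowerSeries.coeff m a - fβ * PowerSeries.coeff m b) := by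
  rw [X_mul_eq_add_iff, comm_of_even _ _ ha, comm_of_even _ _ hb]
  refine and_congr ?_ (forall_congr' fun m => ?_)
  · rw [map_neg, neg_eq_zero]
  · simp only [coeff_cmap, map_neg, map_add, map_sub, PowerSeries.coeff_smul,
      PowerSeries.coeff_C_mul]

theorem eq_δ_iff {a g : PS} (ha : par a = a) (hg : par g = g) (ρ δ : PS) :
    PowerSeries.X * Dx δ =
      δ + PowerSeries.X * (-(2 * ((sw + 1) * ρ)) - (1 / 2 : ℂ) • (sv * δ) - g * sα + a * sβ) ↔
      PowerSeries.coeff 0 δ = 0 ∧ ∀ m, dx (PowerSeries.coeff m δ) =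
        PowerSeries.coeff (m + 1) δ + (-(2 * ((fw + 1) * PowerSeries.coeff m ρ)) -
          (1 / 2 : ℂ) • (fv * PowerSeries.coeff m δ) - fα * PowerSeries.coeff m g +
          fβ * PowerSeries.coeff m a) := by
  rw [X_mul_eq_add_iff, comm_of_even _ _ ha, comm_of_even _ _ hg]
  refine and_congr Iff.rfl (forall_congr' fun m => ?_)
  simp only [coeff_cmap, map_neg, map_add, map_sub, PowerSeries.coeff_smul, coeff_two_mul,
    coeff_one_mul, PowerSeries.coeff_C_mul]

/-- Unlike the other four equations this one has no term free of z: it fixes only ∂aₘ, which is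
where the integration constants enter. -/
theorem SeriesSol.coeff_a {a b g ρ δ : PS} (h : SeriesSol a b g ρ δ) (m : ℕ) :
    dx (PowerSeries.coeff m a) = PowerSeries.coeff m g + 2 * ((fw + 1) * PowerSeries.coeff m b) +
      fα * PowerSeries.coeff m δ + fβ * PowerSeries.coeff m ρ := by
  have h1 := congrArg (PowerSeries.coeff (m + 1)) h.eq_a
  simpa only [PowerSeries.coeff_succ_X_mul, coeff_cmap, map_add, coeff_two_mul, coeff_one_mul,
    PowerSeries.coeff_C_mul] using h1

/-! ### Linear structure of the solutions -/

set_option synthInstance.maxHeartbeats 400000 in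
set_option synthInstance.maxSize 100000 in
/-- Solutions may be multiplied by constant power series. -/
theorem SeriesSol.const_mul {a b g ρ δ F : PS} (h : SeriesSol a b g ρ δ)
    (hF : HasKind Dx .const F) : SeriesSol (F * a) (F * b) (F * g) (F * ρ) (F * δ) := by
  obtain ⟨u0, u1, u2, u3⟩ := hasKind_fields
  obtain ⟨ka, kb, kg, kρ, kδ⟩ := h.kinds
  have hk : List.Forall₂ (HasKind Dx)
      [.const, .even, .even, .odd, .odd, .even, .even, .even, .odd, .odd, .const]
      [PowerSeries.X, sv, sw, sα, sβ, a, b, g, ρ, δ, F] := by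
    simp only [List.forall₂_cons, List.forall₂_nil_left_iff, hasKind_X]
    exact ⟨trivial, u0, u1, u2, u3, ka, kb, kg, kρ, kδ, hF, trivial⟩
  have key : ∀ x y : PS, PowerSeries.X * Dx x = y → PowerSeries.X * Dx (F * x) = F * y := by
    rintro x _ rfl
    rw [isEvenDer_Dx.leibniz, hF.2, zero_mul, zero_add, ← mul_assoc, ← mul_assoc,
      comm_of_even _ _ hF.1]
  constructor
  · rw [map_mul, hF.1, h.par_a]
  · rw [map_mul, hF.1, h.par_b]
  · rw [map_mul, hF.1, h.par_g]
  · rw [map_mul, hF.1, h.par_ρ, mul_neg]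
  · rw [map_mul, hF.1, h.par_δ, mul_neg]
  · rw [key _ _ h.eq_a]
    exact eq_of_check isEvenDer_Dx _ _ hk (by decide +kernel)
  · rw [key _ _ h.eq_b]
    exact eq_of_check isEvenDer_Dx _ _ hk (by decide +kernel)
  · rw [key _ _ h.eq_g]
    exact eq_of_check isEvenDer_Dx _ _ hk (by decide +kernel)
  · rw [key _ _ h.eq_ρ]
    exact eq_of_check isEvenDer_Dx _ _ hk (by decide +kernel)
  · rw [key _ _ h.eq_δ]
    exact eq_of_check isEvenDer_Dx _ _ hk (by decide +kernel)

theorem SeriesSol.sub {a b g ρ δ a' b' g' ρ' δ' : PS} (h : SeriesSol a b g ρ δ)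
    (h' : SeriesSol a' b' g' ρ' δ') : SeriesSol (a - a') (b - b') (g - g') (ρ - ρ') (δ - δ') := by
  constructor
  · rw [map_sub, h.par_a, h'.par_a]
  · rw [map_sub, h.par_b, h'.par_b]
  · rw [map_sub, h.par_g, h'.par_g]
  · rw [map_sub, h.par_ρ, h'.par_ρ]; abel
  · rw [map_sub, h.par_δ, h'.par_δ]; abel
  · rw [map_sub, mul_sub, h.eq_a, h'.eq_a]; noncomm_ring
  · rw [map_sub, mul_sub, h.eq_b, h'.eq_b]; noncomm_ring
  · rw [map_sub, mul_sub, h.eq_g, h'.eq_g]; noncomm_ring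
  · rw [map_sub, mul_sub, h.eq_ρ, h'.eq_ρ, mul_sub sv, smul_sub]; noncomm_ring
  · rw [map_sub, mul_sub, h.eq_δ, h'.eq_δ, mul_sub sv, smul_sub]; noncomm_ring

/-- A solution is determined by the constant terms of `a_0, a_1, …`. -/
theorem SeriesSol.eq_zero {a b g ρ δ : PS} (h : SeriesSol a b g ρ δ)
    (ha : ∀ m, aug oddField (PowerSeries.coeff m a) = 0) :
    a = 0 ∧ b = 0 ∧ g = 0 ∧ ρ = 0 ∧ δ = 0 := by
  obtain ⟨hb0, hb⟩ := (eq_b_iff a b ρ).1 h.eq_b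
  obtain ⟨hg0, hg⟩ := (eq_g_iff a g δ).1 h.eq_g
  obtain ⟨hρ0, hρ⟩ := (eq_ρ_iff h.par_a h.par_b ρ δ).1 h.eq_ρ
  obtain ⟨hδ0, hδ⟩ := (eq_δ_iff h.par_a h.par_g ρ δ).1 h.eq_δ
  -- Here ∂aₘ = 0, so aₘ is a complex number by ker ∂ = ℂ, and its value at zero fields vanishes by
  -- assumption.
  have step : ∀ m, PowerSeries.coeff m b = 0 → PowerSeries.coeff m g = 0 →
      PowerSeries.coeff m ρ = 0 → PowerSeries.coeff m δ = 0 → PowerSeries.coeff m a = 0 := by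
    intro m h1 h2 h3 h4
    have h5 := h.coeff_a m
    rw [h1, h2, h3, h4] at h5
    have h6 := eq_algebraMap_of_D_eq_zero (by simpa using h5)
    rw [h6, ha, map_zero]
  have all : ∀ m, PowerSeries.coeff m b = 0 ∧ PowerSeries.coeff m g = 0 ∧
      PowerSeries.coeff m ρ = 0 ∧ PowerSeries.coeff m δ = 0 := by
    intro m
    induction m with
    | zero => exact ⟨hb0, hg0, hρ0, hδ0⟩
    | succ m ih =>
      obtain ⟨h1, h2, h3, h4⟩ := ih
      have h5 := step m h1 h2 h3 h4
      have e1 := hb m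
      have e2 := hg m
      have e3 := hρ m
      have e4 := hδ m
      simp only [h1, h2, h3, h4, h5, map_zero, mul_zero, sub_zero, add_zero, neg_zero,
        smul_zero] at e1 e2 e3 e4
      refine ⟨eq_zero_of_two_mul (neg_eq_zero.1 e1.symm), eq_zero_of_two_mul e2.symm,
        neg_eq_zero.1 e3.symm, e4.symm⟩
  refine ⟨?_, ?_, ?_, ?_, ?_⟩ <;> ext m <;> rw [map_zero]
  · exact step m (all m).1 (all m).2.1 (all m).2.2.1 (all m).2.2.2
  · exact (all m).1
  · exact (all m).2.1
  · exact (all m).2.2.1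
  · exact (all m).2.2.2

/-- A power series with constant coefficients. -/
abbrev scal : PowerSeries ℂ →+* PS := PowerSeries.map (algebraMap ℂ Alg)

theorem hasKind_scal (f : PowerSeries ℂ) : HasKind Dx .const (scal f) := by
  constructor
  · ext n
    rw [coeff_par, PowerSeries.coeff_map, AlgHom.commutes]
  · ext n
    rw [coeff_cmap, PowerSeries.coeff_map, D_algebraMap, map_zero]

/-- Two solutions with the same leading term differ by a constant factor. -/
theorem SeriesSol.exists_factor {a b g ρ δ a' b' g' ρ' δ' : PS} {k₀ : ℂ} (hk₀ : k₀ ≠ 0)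
    (h : SeriesSol a b g ρ δ) (h' : SeriesSol a' b' g' ρ' δ')
    (ha : PowerSeries.coeff 0 a = algebraMap ℂ Alg k₀)
    (ha' : PowerSeries.coeff 0 a' = algebraMap ℂ Alg k₀) :
    ∃ f : PowerSeries ℂ, PowerSeries.coeff 0 f = 1 ∧ a' = scal f * a ∧ b' = scal f * b ∧
      g' = scal f * g ∧ ρ' = scal f * ρ ∧ δ' = scal f * δ := by
  let e : PS →+* PowerSeries ℂ := PowerSeries.map (aug oddField).toRingHom
  have he : ∀ x : PS, PowerSeries.coeff 0 x = algebraMap ℂ Alg k₀ →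
      PowerSeries.constantCoeff (e x) = k₀ := fun x hx => by
    rw [← PowerSeries.coeff_zero_eq_constantCoeff_apply, PowerSeries.coeff_map, hx]
    exact AlgHom.commutes _ _
  have hes : ∀ f, e (scal f) = f := fun f => by
    ext n
    rw [PowerSeries.coeff_map, PowerSeries.coeff_map]
    exact AlgHom.commutes _ _
  -- The factor is the quotient of a' and a at zero fields, a unit problem in ℂ[[z]] since the
  -- leading term is k₀ ≠ 0. With it, N' - fN is a solution whose a vanishes at zero fields.
  refine ⟨e a' * (e a)⁻¹, ?_, ?_⟩
  · rw [PowerSeries.coeff_zero_eq_constantCoeff_apply, map_mul, PowerSeries.constantCoeff_inv,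
      he _ ha, he _ ha', mul_inv_cancel₀ hk₀]
  · have h1 := (h'.sub (h.const_mul (hasKind_scal (e a' * (e a)⁻¹)))).eq_zero fun m => by
      have h2 : e (a' - scal (e a' * (e a)⁻¹) * a) = 0 := by
        rw [map_sub, map_mul, hes, mul_assoc, PowerSeries.inv_mul_cancel _ (by rwa [he _ ha]),
          mul_one, sub_self]
      have h3 := congrArg (PowerSeries.coeff m) h2
      rwa [PowerSeries.coeff_map, map_zero] at h3
    simpa only [sub_eq_zero] using h1

/-! ### Normalized solutions -/

set_option synthInstance.maxHeartbeats 400000 in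
set_option synthInstance.maxSize 100000 in
-- The supertrace of N² is 2(a² + bg + 2ρδ); the two odd contributions come from the upper diagonal
-- entries and from entry 33.
theorem Coeffs.Sol.isNormalized_iff {N : Coeffs} (h : N.Sol) (k₀ : ℂ) : N.IsNormalized k₀ ↔
    PowerSeries.mk N.a * PowerSeries.mk N.a + PowerSeries.mk N.b * PowerSeries.mk N.g +
      2 * (PowerSeries.mk N.ρ * PowerSeries.mk N.δ) =
        algebraMap ℂ PS k₀ * algebraMap ℂ PS k₀ := by
  rw [Coeffs.IsNormalized, N.ser_eq]
  unfold Coeffs.Sol at h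
  generalize PowerSeries.mk N.a = a at *
  generalize PowerSeries.mk N.b = b at *
  generalize PowerSeries.mk N.g = g at *
  generalize PowerSeries.mk N.ρ = ρ at *
  generalize PowerSeries.mk N.δ = δ at *
  obtain ⟨ka, kb, kg, kρ, kδ⟩ := h.kinds
  have hk : List.Forall₂ (HasKind Dx) [.even, .even, .even, .odd, .odd] [a, b, g, ρ, δ] := by
    simp only [List.forall₂_cons, List.forall₂_nil_left_iff]
    exact ⟨ka, kb, kg, kρ, kδ, trivial⟩
  have h1 : str ((matN a b g ρ δ).map toSer * (matN a b g ρ δ).map toSer) =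
      toSer (2 * (a * a + b * g + 2 * (ρ * δ))) := by
    rw [← Matrix.map_mul, str, Matrix.map_apply, Matrix.map_apply, Matrix.map_apply, ← map_add,
      ← map_sub]
    refine congrArg _ ?_
    simp only [matN, Matrix.mul_apply, Fin.sum_univ_three, Matrix.of_apply, Matrix.cons_val,
      Fin.isValue]
    exact eq_of_check isEvenDer_Dx _ _ hk (by decide +kernel)
  have h2 : con (algebraMap ℂ Alg (2 * k₀ ^ 2)) =
      toSer (2 * (algebraMap ℂ PS k₀ * algebraMap ℂ PS k₀)) := by
    rw [← toSer_C, ← algebraMap_PS, pow_two, map_mul (algebraMap ℂ PS), map_mul (algebraMap ℂ PS),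
      map_ofNat]
  rw [h1, h2, (HahnSeries.ofPowerSeries_injective (Γ := ℤ) (R := Alg)).eq_iff]
  refine ⟨fun h => ?_, fun h => by rw [h]⟩
  rw [← sub_eq_zero, ← mul_sub] at h
  exact sub_eq_zero.1 (eq_zero_of_two_mul h)

/-- The values of `a`, `b`, `g`, `ρ`, `δ` in one step of the recursion. -/
structure Jet5 where
  a : Alg
  b : Alg
  g : Alg
  ρ : Alg
  δ : Alg

/-- The normalized solution of the recursion. -/
def normal (k₀ : ℂ) : ℕ → Jet5
  | 0 => ⟨algebraMap ℂ Alg k₀, 0, 0, 0, 0⟩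
  | n + 1 =>
    let p := normal k₀ n
    -- The coefficient of zⁿ⁺¹ in a² + bg + 2ρδ = k₀², solved for the two end terms 2k₀aₙ₊₁. Both
    -- indices i + 1 and n - i run through 1, …, n; the other products have no end terms because b₀
    -- = g₀ = ρ₀ = δ₀ = 0.
    { a := -((1 / (2 * k₀)) • ∑ i : Fin n,
        ((normal k₀ (i + 1)).a * (normal k₀ (n - i)).a +
          (normal k₀ (i + 1)).b * (normal k₀ (n - i)).g +
          2 * ((normal k₀ (i + 1)).ρ * (normal k₀ (n - i)).δ)))
      b := (1 / 2 : ℂ) • (fv * p.b - 2 * p.a - 2 * (fα * p.ρ) - dx p.b)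
      g := (1 / 2 : ℂ) • (dx p.g - (-(4 * ((fw + 1) * p.a)) - fv * p.g + 2 * (fβ * p.δ)))
      ρ := (1 / 2 : ℂ) • (fv * p.ρ) + p.δ - fα * p.a - fβ * p.b - dx p.ρ
      δ := dx p.δ - (-(2 * ((fw + 1) * p.ρ)) - (1 / 2 : ℂ) • (fv * p.δ) - fα * p.g + fβ * p.a) }

theorem parity_normal (k₀ : ℂ) (n : ℕ) : IsEven (normal k₀ n).a ∧
    IsEven (normal k₀ n).b ∧ IsEven (normal k₀ n).g ∧
    IsOdd (normal k₀ n).ρ ∧ IsOdd (normal k₀ n).δ := by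
  obtain ⟨u0, u1, u2, u3⟩ := typed_field.parity
  induction n using Nat.strongRec with
  | ind n ih =>
  cases n with
  | zero => simp [normal, IsEven, IsOdd]
  | succ n =>
    obtain ⟨pa, pb, pg, pρ, pδ⟩ := ih n n.lt_succ_self
    unfold IsEven IsOdd at *
    rw [normal]
    refine ⟨?_, ?_, ?_, ?_, ?_⟩
    · dsimp only
      rw [map_neg, map_smul, map_sum]
      refine congrArg (fun x => -((1 / (2 * k₀)) • x)) (Finset.sum_congr rfl fun i _ => ?_)
      obtain ⟨qa, qb, -, qρ, -⟩ := ih (i + 1) (by omega)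
      obtain ⟨ra, -, rg, -, rδ⟩ := ih (n - i) (by omega)
      simp only [map_add, map_mul, map_ofNat, qa, qb, qρ, ra, rg, rδ, neg_mul_neg]
    · simp only [map_smul, map_sub, map_mul, map_ofNat, parity_D, u0, u2, pa, pb, pρ, neg_mul_neg]
    · simp only [map_smul, map_sub, map_add, map_neg, map_one, map_mul, map_ofNat, parity_D, u0, u1,
        u3, pa, pg, pδ, neg_mul_neg]
    · simp only [map_smul, map_sub, map_add, map_neg, map_mul, parity_D, u0, u2, u3, pa, pb, pρ, pδ,
        mul_neg, neg_mul, smul_neg]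
      abel
    · simp only [map_smul, map_sub, map_add, map_one, map_neg, map_mul, map_ofNat, parity_D, u0, u1,
        u2, u3, pa, pg, pρ, pδ, mul_neg, neg_mul, smul_neg]
      abel

/-- The coefficients of the normalized solution. -/
def normalCoeffs (k₀ : ℂ) : Coeffs where
  a n := (normal k₀ n).a
  b n := (normal k₀ n).b
  c n := (1 / 2 : ℂ) • (normal k₀ n).g + (normal k₀ n).b
  ρ n := (normal k₀ n).ρ
  δ n := (normal k₀ n).δ

theorem normalCoeffs_g (k₀ : ℂ) : (normalCoeffs k₀).g = fun n => (normal k₀ n).g := by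
  funext n
  simp only [Coeffs.g, normalCoeffs, two_mul]
  module

theorem sum_antidiagonal_succ_eq {p q : ℕ → Alg} (hp : p 0 = 0) (hq : q 0 = 0) (n : ℕ) :
    ∑ x ∈ Finset.HasAntidiagonal.antidiagonal (n + 1), p x.1 * q x.2 = ∑ i : Fin n, p (i + 1) * q (n - i) := by
  rw [Finset.Nat.sum_antidiagonal_eq_sum_range_succ_mk, Finset.sum_range_succ',
    Finset.sum_range_succ]
  simp only [hp, zero_mul, add_zero, Nat.sub_self, hq, mul_zero]
  rw [Finset.sum_range fun i => p (i + 1) * q (n + 1 - (i + 1))]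
  simp only [Nat.add_sub_add_right]

/-- The quadratic invariant of the normalized solution is constant. -/
theorem normal_invariant {k₀ : ℂ} (hk₀ : k₀ ≠ 0) :
    (PowerSeries.mk (fun n => (normal k₀ n).a) * PowerSeries.mk (fun n => (normal k₀ n).a) +
      PowerSeries.mk (fun n => (normal k₀ n).b) * PowerSeries.mk (fun n => (normal k₀ n).g) +
      2 * (PowerSeries.mk (fun n => (normal k₀ n).ρ) * PowerSeries.mk (fun n => (normal k₀ n).δ)) :
        PS) = algebraMap ℂ PS k₀ * algebraMap ℂ PS k₀ := by
  rw [algebraMap_PS, ← map_mul]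
  ext n
  rw [map_add, map_add, coeff_two_mul, PowerSeries.coeff_mul, PowerSeries.coeff_mul,
    PowerSeries.coeff_mul]
  simp only [PowerSeries.coeff_mk]
  cases n with
  | zero => simp [normal]
  | succ n =>
    rw [PowerSeries.coeff_C, if_neg n.succ_ne_zero,
      sum_antidiagonal_succ_eq (p := fun n => (normal k₀ n).b) (q := fun n => (normal k₀ n).g)
        (by simp [normal]) (by simp [normal]),
      sum_antidiagonal_succ_eq (p := fun n => (normal k₀ n).ρ) (q := fun n => (normal k₀ n).δ)
        (by simp [normal]) (by simp [normal]),
      Finset.Nat.sum_antidiagonal_eq_sum_range_succ_mk, Finset.sum_range_succ',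
      Finset.sum_range_succ]
    rw [Finset.sum_range fun i => (normal k₀ (i + 1)).a * (normal k₀ (n + 1 - (i + 1))).a]
    have h0 : (normal k₀ 0).a = algebraMap ℂ Alg k₀ := by simp [normal]
    have h1 : (2 * k₀) • (normal k₀ (n + 1)).a = -∑ i : Fin n,
        ((normal k₀ (i + 1)).a * (normal k₀ (n - i)).a +
          (normal k₀ (i + 1)).b * (normal k₀ (n - i)).g +
          2 * ((normal k₀ (i + 1)).ρ * (normal k₀ (n - i)).δ)) := by
      rw [normal]
      dsimp only
      rw [smul_neg, smul_smul, mul_one_div_cancel (by simpa using hk₀), one_smul]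
    rw [Finset.sum_add_distrib, Finset.sum_add_distrib, ← Finset.mul_sum] at h1
    simp only [Nat.add_sub_add_right, Nat.sub_self, Nat.sub_zero, h0]
    rw [← Algebra.commutes, ← Algebra.smul_def]
    have h2 : k₀ • (normal k₀ (n + 1)).a + k₀ • (normal k₀ (n + 1)).a =
        (2 * k₀) • (normal k₀ (n + 1)).a := by module
    rw [add_assoc (∑ i : Fin n, _), h2, h1]
    abel

set_option synthInstance.maxHeartbeats 400000 in
set_option synthInstance.maxSize 100000 in
/-- The equation for `a` follows from the other ones and the quadratic invariant. -/
theorem eq_a_of_invariant {a b g ρ δ : PS} {k₀ : ℂ} (hk₀ : k₀ ≠ 0) (pa : par a = a)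
    (pb : par b = b) (pg : par g = g) (pρ : par ρ = -ρ) (pδ : par δ = -δ)
    (ha : PowerSeries.coeff 0 a = algebraMap ℂ Alg k₀)
    (hb : PowerSeries.X * Dx b = -(2 * b) + PowerSeries.X * (sv * b - 2 * a - 2 * (sα * ρ)))
    (hg : PowerSeries.X * Dx g =
      2 * g + PowerSeries.X * (-(4 * ((sw + 1) * a)) - sv * g + 2 * (sβ * δ)))
    (hρ : PowerSeries.X * Dx ρ =
      -ρ + PowerSeries.X * ((1 / 2 : ℂ) • (sv * ρ) + δ - a * sα - b * sβ))
    (hδ : PowerSeries.X * Dx δ =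
      δ + PowerSeries.X * (-(2 * ((sw + 1) * ρ)) - (1 / 2 : ℂ) • (sv * δ) - g * sα + a * sβ))
    (hn : a * a + b * g + 2 * (ρ * δ) = algebraMap ℂ PS k₀ * algebraMap ℂ PS k₀) :
    PowerSeries.X * Dx a = PowerSeries.X * (g + 2 * ((sw + 1) * b) + sα * δ + sβ * ρ) := by
  obtain ⟨u0, u1, u2, u3⟩ := hasKind_fields
  have hk : List.Forall₂ (HasKind Dx)
      [.const, .even, .even, .odd, .odd, .even, .even, .even, .odd, .odd]
      [PowerSeries.X, sv, sw, sα, sβ, a, b, g, ρ, δ] := by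
    simp only [List.forall₂_cons, List.forall₂_nil_left_iff, hasKind_X]
    exact ⟨trivial, u0, u1, u2, u3, pa, pb, pg, pρ, pδ, trivial⟩
  -- The quadratic form is conserved by the commutator equation, so its derivative is 2a times the
  -- defect of the a-equation plus multiples of the other defects, which vanish. The unit a can then
  -- be cancelled.
  have h1 : 2 * (a * (PowerSeries.X * Dx a -
        PowerSeries.X * (g + 2 * ((sw + 1) * b) + sα * δ + sβ * ρ))) =
      PowerSeries.X * Dx (a * a + b * g + 2 * (ρ * δ)) -
      (PowerSeries.X * Dx b - (-(2 * b) + PowerSeries.X * (sv * b - 2 * a - 2 * (sα * ρ)))) * g -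
      b * (PowerSeries.X * Dx g -
        (2 * g + PowerSeries.X * (-(4 * ((sw + 1) * a)) - sv * g + 2 * (sβ * δ)))) -
      2 * ((PowerSeries.X * Dx ρ -
        (-ρ + PowerSeries.X * ((1 / 2 : ℂ) • (sv * ρ) + δ - a * sα - b * sβ))) * δ) -
      2 * (ρ * (PowerSeries.X * Dx δ -
        (δ + PowerSeries.X * (-(2 * ((sw + 1) * ρ)) - (1 / 2 : ℂ) • (sv * δ) - g * sα +
          a * sβ)))) :=
    eq_of_check isEvenDer_Dx _ _ hk (by decide +kernel)
  have h2 : Dx (algebraMap ℂ PS k₀ * algebraMap ℂ PS k₀) = 0 := by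
    rw [← map_mul]
    exact (hasKind_algebraMap_PS _).2
  rw [hn, h2, hb, hg, hρ, hδ, sub_self, sub_self, sub_self, sub_self] at h1
  simp only [mul_zero, zero_mul, sub_zero] at h1
  have hu : IsUnit a := isUnit_of_constantCoeff hk₀ (by
    rwa [← PowerSeries.coeff_zero_eq_constantCoeff_apply])
  exact sub_eq_zero.1 (hu.mul_right_eq_zero.1 (eq_zero_of_two_mul h1))

theorem normalCoeffs_sol {k₀ : ℂ} (hk₀ : k₀ ≠ 0) : (normalCoeffs k₀).Sol := by
  have pa := mk_par_eq.2 fun n => (parity_normal k₀ n).1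
  have pb := mk_par_eq.2 fun n => (parity_normal k₀ n).2.1
  have pg := mk_par_eq.2 fun n => (parity_normal k₀ n).2.2.1
  have pρ := mk_par_neg.2 fun n => (parity_normal k₀ n).2.2.2.1
  have pδ := mk_par_neg.2 fun n => (parity_normal k₀ n).2.2.2.2
  have hb := (eq_b_iff (PowerSeries.mk fun n => (normal k₀ n).a)
    (PowerSeries.mk fun n => (normal k₀ n).b) (PowerSeries.mk fun n => (normal k₀ n).ρ)).2
      ⟨by simp [normal], fun m => by
        simp only [PowerSeries.coeff_mk]
        rw [normal.eq_2]
        simp only [two_mul]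
        module⟩
  have hg := (eq_g_iff (PowerSeries.mk fun n => (normal k₀ n).a)
    (PowerSeries.mk fun n => (normal k₀ n).g) (PowerSeries.mk fun n => (normal k₀ n).δ)).2
      ⟨by simp [normal], fun m => by
        simp only [PowerSeries.coeff_mk]
        rw [normal.eq_2]
        simp only [two_mul]
        module⟩
  have hρ := (eq_ρ_iff pa pb (PowerSeries.mk fun n => (normal k₀ n).ρ)
    (PowerSeries.mk fun n => (normal k₀ n).δ)).2
      ⟨by simp [normal], fun m => by
        simp only [PowerSeries.coeff_mk]
        rw [normal.eq_2]
        module⟩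
  have hδ := (eq_δ_iff pa pg (PowerSeries.mk fun n => (normal k₀ n).ρ)
    (PowerSeries.mk fun n => (normal k₀ n).δ)).2
      ⟨by simp [normal], fun m => by
        simp only [PowerSeries.coeff_mk]
        rw [normal.eq_2]
        module⟩
  have ha := eq_a_of_invariant hk₀ pa pb pg pρ pδ (by simp [normal]) hb hg hρ hδ
    (normal_invariant hk₀)
  unfold Coeffs.Sol
  rw [normalCoeffs_g]
  exact ⟨pa, pb, pg, pρ, pδ, ha, hb, hg, hρ, hδ⟩

theorem coeff_scal_mul (f : PowerSeries ℂ) (x : ℕ → Alg) (m : ℕ) :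
    PowerSeries.coeff m (scal f * PowerSeries.mk x) =
      ∑ j ∈ Finset.range (m + 1), PowerSeries.coeff j f • x (m - j) := by
  rw [PowerSeries.coeff_mul, Finset.Nat.sum_antidiagonal_eq_sum_range_succ_mk]
  refine Finset.sum_congr rfl fun j _ => ?_
  simp only [PowerSeries.coeff_map, PowerSeries.coeff_mk]
  rw [Algebra.smul_def]

/-- Any two solutions differ by a constant factor. -/
theorem Coeffs.IsSolution.exists_factor {N N' : Coeffs} {k₀ : ℂ} (hk₀ : k₀ ≠ 0)
    (h : N.IsSolution k₀) (h' : N'.IsSolution k₀) :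
    ∃ f : PowerSeries ℂ, PowerSeries.coeff 0 f = 1 ∧
      PowerSeries.mk N'.a = scal f * PowerSeries.mk N.a ∧
      PowerSeries.mk N'.b = scal f * PowerSeries.mk N.b ∧
      PowerSeries.mk N'.g = scal f * PowerSeries.mk N.g ∧
      PowerSeries.mk N'.ρ = scal f * PowerSeries.mk N.ρ ∧
      PowerSeries.mk N'.δ = scal f * PowerSeries.mk N.δ :=
  h.sol.exists_factor hk₀ h'.sol (by simpa using h.init.1) (by simpa using h'.init.1)

theorem mk_injective {x y : ℕ → Alg} (h : (PowerSeries.mk x : PS) = PowerSeries.mk y) : x = y := by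
  funext n
  simpa using congrArg (PowerSeries.coeff n) h

theorem Coeffs.eq_of_ser {N N' : Coeffs} (ha : PowerSeries.mk N.a = PowerSeries.mk N'.a)
    (hb : PowerSeries.mk N.b = PowerSeries.mk N'.b) (hg : PowerSeries.mk N.g = PowerSeries.mk N'.g)
    (hρ : PowerSeries.mk N.ρ = PowerSeries.mk N'.ρ) (hδ : PowerSeries.mk N.δ = PowerSeries.mk N'.δ) :
    N = N' := by
  have hc : ∀ (N : Coeffs) m, N.c m = (1 / 2 : ℂ) • N.g m + N.b m := fun N m => by
    simp only [Coeffs.g, two_mul]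
    module
  refine Coeffs.ext (mk_injective ha) (mk_injective hb) ?_ (mk_injective hρ) (mk_injective hδ)
  funext m
  rw [hc, hc, mk_injective hg, mk_injective hb]

theorem scal_injective : Function.Injective scal :=
  PowerSeries.map_injective _ algebraMap_injective

/-- Two solutions, one of which is normalized, agree if and only if the other one is normalized. -/
theorem Coeffs.IsSolution.factor_eq_one_iff {N N' : Coeffs} {k₀ : ℂ} (hk₀ : k₀ ≠ 0)
    (h : N.IsSolution k₀) (hn : N.IsNormalized k₀) (h' : N'.IsSolution k₀) {f : PowerSeries ℂ}
    (hf0 : PowerSeries.coeff 0 f = 1)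
    (ha : PowerSeries.mk N'.a = scal f * PowerSeries.mk N.a)
    (hb : PowerSeries.mk N'.b = scal f * PowerSeries.mk N.b)
    (hg : PowerSeries.mk N'.g = scal f * PowerSeries.mk N.g)
    (hρ : PowerSeries.mk N'.ρ = scal f * PowerSeries.mk N.ρ)
    (hδ : PowerSeries.mk N'.δ = scal f * PowerSeries.mk N.δ) :
    N'.IsNormalized k₀ ↔ f = 1 := by
  rw [h.sol.isNormalized_iff] at hn
  rw [h'.sol.isNormalized_iff, ha, hb, hg, hρ, hδ]
  have hc := fun x : PS => comm_of_even (scal f) x (hasKind_scal f).1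
  have h1 : ∀ x y : PS, scal f * x * (scal f * y) = scal (f * f) * (x * y) := fun x y => by
    rw [mul_assoc, ← mul_assoc x, ← hc x, map_mul]
    simp only [mul_assoc]
  have h2 : ∀ x : PS, 2 * (scal (f * f) * x) = scal (f * f) * (2 * x) := fun x => by
    rw [two_mul, two_mul, mul_add]
  rw [h1, h1, h1, h2, ← mul_add, ← mul_add, hn]
  constructor
  · intro h3
    have h4 : IsUnit (algebraMap ℂ PS k₀ * algebraMap ℂ PS k₀) := by
      rw [← map_mul]
      exact (isUnit_iff_ne_zero.2 (mul_ne_zero hk₀ hk₀)).map _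
    have h5 : scal (f * f) = scal 1 := by
      rw [map_one]
      exact h4.mul_right_cancel (by rw [h3, one_mul])
    have h6 := scal_injective h5
    -- ℂ[[z]] is a domain, so f² = 1 leaves f = ±1, and f(0) = 1 excludes -1.
    rcases mul_self_eq_one_iff.1 h6 with h7 | h7
    · exact h7
    · rw [h7] at hf0
      norm_num at hf0
  · rintro rfl
    rw [mul_one, map_one, one_mul]

theorem existsUnique_normalized {k₀ : ℂ} (hk₀ : k₀ ≠ 0) :
    ∃! N : Coeffs, N.IsSolution k₀ ∧ N.IsNormalized k₀ := by
  have hs := normalCoeffs_sol hk₀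
  have h0 : (normalCoeffs k₀).IsSolution k₀ := hs.isSolution (by simp [normalCoeffs, normal])
  have hn : (normalCoeffs k₀).IsNormalized k₀ := by
    rw [hs.isNormalized_iff, normalCoeffs_g]
    exact normal_invariant hk₀
  refine ⟨_, ⟨h0, hn⟩, fun N' ⟨h', hn'⟩ => ?_⟩
  obtain ⟨f, hf0, ha, hb, hg, hρ, hδ⟩ := h0.exists_factor hk₀ h'
  obtain rfl := (h0.factor_eq_one_iff hk₀ hn h' hf0 ha hb hg hρ hδ).1 hn'
  rw [map_one, one_mul] at ha hb hg hρ hδ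
  exact Coeffs.eq_of_ser ha hb hg hρ hδ

/-! ### The Riccati variables of a normalized solution -/

/-- The right-hand side of the Riccati equation for `s`. -/
abbrev riccS (s σ : PS) : PS :=
  2 * s + PowerSeries.X * (-(2 * (sw + 1)) - sv * s + sβ * σ - s * s - sα * σ * s)

/-- The right-hand side of the Riccati equation for `σ`. -/
abbrev riccσ (s σ : PS) : PS :=
  σ + PowerSeries.X * (sβ - sα * s - (1 / 2 : ℂ) • (sv * σ) - s * σ)

/-- A normalized solution `a`, `b`, `g`, `ρ`, `δ`, with `κ = k₀`, expressed by `b`, `ρ` and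
solutions `s`, `σ` of Riccati equations. -/
structure RiccatiForm (κ a b g ρ δ s σ : PS) : Prop where
  const_κ : HasKind Dx .const κ
  par_b : par b = b
  par_ρ : par ρ = -ρ
  par_s : par s = s
  par_σ : par σ = -σ
  a_eq : a = κ - b * s - ρ * σ
  δ_eq : δ = κ * σ + ρ * s
  g_eq : g = (κ + a) * s - δ * σ
  eq_b : PowerSeries.X * Dx b = -(2 * b) + PowerSeries.X * (sv * b - 2 * a - 2 * (sα * ρ))
  eq_ρ : PowerSeries.X * Dx ρ =
    -ρ + PowerSeries.X * ((1 / 2 : ℂ) • (sv * ρ) + δ - a * sα - b * sβ)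
  eq_s : PowerSeries.X * Dx s = riccS s σ
  eq_σ : PowerSeries.X * Dx σ = riccσ s σ

set_option synthInstance.maxHeartbeats 400000 in
set_option synthInstance.maxSize 100000 in
-- The formulas for a, δ and g say that (1, s, σ) is an eigenvector of N with eigenvalue κ. Because
-- N commutes with ∂ - M, this line is preserved by the spectral problem, and its affine coordinates
-- satisfy Riccati equations.
theorem SeriesSol.exists_riccatiForm {a b g ρ δ : PS} {k₀ : ℂ} (hk₀ : k₀ ≠ 0)
    (h : SeriesSol a b g ρ δ) (ha : PowerSeries.coeff 0 a = algebraMap ℂ Alg k₀)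
    (hn : a * a + b * g + 2 * (ρ * δ) = algebraMap ℂ PS k₀ * algebraMap ℂ PS k₀) :
    ∃ s σ, RiccatiForm (algebraMap ℂ PS k₀) a b g ρ δ s σ := by
  obtain ⟨pa, pb, pg, pρ, pδ⟩ := h.kinds
  obtain ⟨hb0, hb1⟩ := (eq_b_iff a b ρ).1 h.eq_b
  obtain ⟨hρ0, -⟩ := (eq_ρ_iff pa pb ρ δ).1 h.eq_ρ
  have kκ := hasKind_algebraMap_PS k₀
  have ki := hasKind_algebraMap_PS k₀⁻¹
  have hκi : algebraMap ℂ PS k₀ * algebraMap ℂ PS k₀⁻¹ = 1 := by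
    rw [← map_mul, mul_inv_cancel₀ hk₀, map_one]
  have ha' : PowerSeries.coeff 0 (algebraMap ℂ PS k₀) = PowerSeries.coeff 0 a := by
    rw [algebraMap_PS, PowerSeries.coeff_zero_C, ha]
  generalize algebraMap ℂ PS k₀ = κ at *
  generalize algebraMap ℂ PS k₀⁻¹ = i at *
  have hX : ∀ x y : PS, PowerSeries.X * x = PowerSeries.X * y → x = y := fun x y hxy => by
    ext n
    simpa [PowerSeries.coeff_succ_X_mul] using congrArg (PowerSeries.coeff (n + 1)) hxy
  obtain ⟨b₁, rfl⟩ := PowerSeries.X_dvd_iff.2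
    ((PowerSeries.coeff_zero_eq_constantCoeff_apply b).symm.trans hb0)
  -- The recursion gives b₁ = -k₀ for the coefficient of z, so b is z times a unit and can be
  -- cancelled.
  have hb₁ : IsUnit b₁ := by
    have h1 := hb1 0
    rw [hb0, hρ0, ha, map_zero, mul_zero, mul_zero, mul_zero, zero_sub, sub_zero, zero_add,
      PowerSeries.coeff_succ_X_mul, ← neg_add, ← mul_add, eq_comm, neg_eq_zero] at h1
    refine isUnit_of_constantCoeff (neg_ne_zero.2 hk₀) ?_
    rw [← PowerSeries.coeff_zero_eq_constantCoeff_apply, map_neg]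
    exact eq_neg_of_add_eq_zero_left (eq_zero_of_two_mul h1)
  have hcancel : ∀ x y : PS, PowerSeries.X * b₁ * x = PowerSeries.X * b₁ * y → x = y :=
    fun x y hxy => hb₁.mul_left_cancel (hX _ _ (by simpa only [mul_assoc] using hxy))
  obtain ⟨y, hy⟩ : PowerSeries.X ∣ κ - a - i * (ρ * δ) := by
    rw [PowerSeries.X_dvd_iff, ← PowerSeries.coeff_zero_eq_constantCoeff_apply, map_sub, map_sub,
      ha', sub_self, zero_sub, neg_eq_zero]
    simp [PowerSeries.coeff_mul, hρ0]
  -- The eigenvector equations want σ = (δ - ρs)/κ. Since ρ² = 0, this makes ρσ = ρδ/κ, so the first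
  -- row becomes an equation for s alone.
  obtain ⟨s, hs⟩ : ∃ s, PowerSeries.X * b₁ * s = κ - a - i * (ρ * δ) := by
    refine ⟨hb₁.unit⁻¹ * y, ?_⟩
    rw [hy, mul_assoc, ← mul_assoc b₁, IsUnit.mul_val_inv, one_mul]
  have hb := h.eq_b
  have hg := h.eq_g
  have ha := h.eq_a
  have hρ := h.eq_ρ
  have hδ := h.eq_δ
  clear hb1 hb0 h
  generalize PowerSeries.X * b₁ = b at *
  have ps : par s = s := by
    refine hcancel _ _ ?_
    have h1 : par (b * s) = b * s := by
      rw [hs, map_sub, map_sub, map_mul, map_mul, kκ.1, ki.1, show par a = a from pa,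
        show par ρ = -ρ from pρ, show par δ = -δ from pδ, neg_mul_neg]
    rwa [map_mul, show par b = b from pb] at h1
  have pσ : par (i * (δ - ρ * s)) = -(i * (δ - ρ * s)) := by
    rw [map_mul, map_sub, map_mul, ps, ki.1, show par ρ = -ρ from pρ, show par δ = -δ from pδ]
    noncomm_ring
  have hk₁ : List.Forall₂ (HasKind Dx) [.const, .even, .odd, .odd] [i, s, ρ, δ] := by
    simp only [List.forall₂_cons, List.forall₂_nil_left_iff]
    exact ⟨ki, ps, pρ, pδ, trivial⟩
  have hρσ : i * (ρ * δ) = ρ * (i * (δ - ρ * s)) :=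
    eq_of_check isEvenDer_Dx _ _ hk₁ (by decide +kernel)
  have hδσ : δ = κ * (i * (δ - ρ * s)) + ρ * s := by
    rw [← mul_assoc, hκi, one_mul, sub_add_cancel]
  generalize i * (δ - ρ * s) = σ at *
  obtain ⟨u0, u1, u2, u3⟩ := hasKind_fields
  have hk : List.Forall₂ (HasKind Dx)
      [.const, .even, .even, .odd, .odd, .even, .even, .odd, .odd, .const]
      [PowerSeries.X, sv, sw, sα, sβ, b, s, ρ, σ, κ] := by
    simp only [List.forall₂_cons, List.forall₂_nil_left_iff, hasKind_X]
    exact ⟨trivial, u0, u1, u2, u3, pb, ps, pρ, pσ, kκ, trivial⟩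
  have haσ : a = κ - b * s - ρ * σ := by
    rw [hs, ← hρσ]
    abel
  clear hs hρσ hk₁ hy ha' pa pδ
  subst δ
  subst a
  have hgσ : g = (κ + (κ - b * s - ρ * σ)) * s - (κ * σ + ρ * s) * σ := by
    refine hcancel _ _ ?_
    have h1 : b * g = κ * κ - (κ - b * s - ρ * σ) * (κ - b * s - ρ * σ) -
        2 * (ρ * (κ * σ + ρ * s)) := by
      rw [← hn]
      abel
    rw [h1]
    exact eq_of_check isEvenDer_Dx _ _ hk (by decide +kernel)
  clear hn hg pg
  subst g
  -- Let P and Q be the defects of the Riccati equations for σ and s. The equations for N yield κP +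
  -- ρQ = 0 and bQ + ρP = 0. As ρ² = 0 and κ is invertible, ρP = 0; hence Q = 0 by cancelling b, and
  -- then P = 0.
  have hPQ : κ * (PowerSeries.X * Dx σ - riccσ s σ) + ρ * (PowerSeries.X * Dx s - riccS s σ) = 0 := by
    have h1 : κ * (PowerSeries.X * Dx σ - riccσ s σ) + ρ * (PowerSeries.X * Dx s - riccS s σ) =
      (PowerSeries.X * Dx (κ * σ + ρ * s) -
        (κ * σ + ρ * s + PowerSeries.X * (-(2 * ((sw + 1) * ρ)) -
          (1 / 2 : ℂ) • (sv * (κ * σ + ρ * s)) -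
          ((κ + (κ - b * s - ρ * σ)) * s - (κ * σ + ρ * s) * σ) * sα +
          (κ - b * s - ρ * σ) * sβ))) -
      (PowerSeries.X * Dx ρ - (-ρ + PowerSeries.X * ((1 / 2 : ℂ) • (sv * ρ) + (κ * σ + ρ * s) -
        (κ - b * s - ρ * σ) * sα - b * sβ))) * s :=
      eq_of_check isEvenDer_Dx _ _ hk (by decide +kernel)
    rw [h1, hδ, hρ, sub_self, sub_self, zero_mul, sub_zero]
  have hPQ' : b * (PowerSeries.X * Dx s - riccS s σ) +
      ρ * (PowerSeries.X * Dx σ - riccσ s σ) = 0 := by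
    have h1 : b * (PowerSeries.X * Dx s - riccS s σ) + ρ * (PowerSeries.X * Dx σ - riccσ s σ) =
      -(PowerSeries.X * Dx (κ - b * s - ρ * σ) -
        PowerSeries.X * ((κ + (κ - b * s - ρ * σ)) * s - (κ * σ + ρ * s) * σ +
          2 * ((sw + 1) * b) + sα * (κ * σ + ρ * s) + sβ * ρ)) -
      (PowerSeries.X * Dx b - (-(2 * b) + PowerSeries.X * (sv * b - 2 * (κ - b * s - ρ * σ) -
        2 * (sα * ρ)))) * s -
      (PowerSeries.X * Dx ρ - (-ρ + PowerSeries.X * ((1 / 2 : ℂ) • (sv * ρ) + (κ * σ + ρ * s) -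
        (κ - b * s - ρ * σ) * sα - b * sβ))) * σ :=
      eq_of_check isEvenDer_Dx _ _ hk (by decide +kernel)
    rw [h1, ha, hb, hρ, sub_self, sub_self, sub_self, zero_mul, zero_mul, sub_zero, sub_zero,
      neg_zero]
  have hs0 : PowerSeries.X * Dx s - riccS s σ = 0 := by
    refine hcancel _ _ ?_
    have h1 : ρ * (PowerSeries.X * Dx σ - riccσ s σ) = 0 := by
      have h2 : ρ * (κ * (PowerSeries.X * Dx σ - riccσ s σ)) = 0 := by
        rw [eq_neg_of_add_eq_zero_left hPQ, mul_neg, ← mul_assoc, mul_self_of_odd pρ, zero_mul,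
          neg_zero]
      rw [← mul_assoc, ← comm_of_even _ _ kκ.1, mul_assoc] at h2
      have h3 := congrArg (i * ·) h2
      simp only [mul_zero] at h3
      rwa [← mul_assoc, comm_of_even _ _ ki.1, hκi, one_mul] at h3
    rw [mul_zero]
    rwa [h1, add_zero] at hPQ'
  have hσ0 : PowerSeries.X * Dx σ - riccσ s σ = 0 := by
    rw [hs0, mul_zero, add_zero] at hPQ
    have h3 := congrArg (i * ·) hPQ
    simp only [mul_zero] at h3
    rwa [← mul_assoc, comm_of_even _ _ ki.1, hκi, one_mul] at h3
  exact ⟨s, σ, kκ, pb, pρ, ps, pσ, rfl, rfl, rfl, hb, hρ, sub_eq_zero.1 hs0, sub_eq_zero.1 hσ0⟩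

/-- An even derivation commuting with `∂` and multiplying `z` by the constant `m`. -/
structure IsVariation (m : PS) (T : PS →ₗ[ℂ] PS) : Prop where
  der : IsEvenDer T
  comm : ∀ x, T (Dx x) = Dx (T x)
  apply_X : T PowerSeries.X = m * PowerSeries.X

set_option synthInstance.maxHeartbeats 400000 in
set_option synthInstance.maxSize 100000 in
/-- The variation of the invariant `½ v + s + α σ` is the one prescribed by `a`, `b`, `ρ`, `δ`, up to
total derivatives. -/
theorem RiccatiForm.variation {κ a b g ρ δ s σ m : PS} (h : RiccatiForm κ a b g ρ δ s σ)
    (hm : HasKind Dx .const m) {T : PS →ₗ[ℂ] PS} (hT : IsVariation m T) :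
    2 * (m * a) + PowerSeries.X * (a * T sv - 2 * (b * T sw) - 2 * (δ * T sα) + 2 * (ρ * T sβ)) -
      2 * (κ * (m + PowerSeries.X * ((1 / 2 : ℂ) • T sv + T s + T (sα * σ)))) =
    PowerSeries.X * Dx (b * T s + (2 * ρ + b * σ) * T σ) := by
  obtain ⟨kκ, pb, pρ, ps, pσ, rfl, rfl, -, hb, hρ, hs, hσ⟩ := h
  obtain ⟨u0, u1, u2, u3⟩ := hasKind_fields
  have even : ∀ {x : PS}, par x = x → par (T x) = T x := fun hx => by rw [hT.der.par, hx]
  have odd : ∀ {x : PS}, par x = -x → par (T x) = -T x := fun hx => by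
    rw [hT.der.par, hx, map_neg]
  have T1 : T 1 = 0 := hT.der.map_one
  have T2 : ∀ x, T (2 * x) = 2 * T x := fun x => by rw [two_mul, map_add, two_mul]
  -- The linearized Riccati equation; the terms with m arise because T may rescale z.
  have hTs : m * PowerSeries.X * Dx s + PowerSeries.X * Dx (T s) =
      2 * T s + (m * PowerSeries.X * (-(2 * (sw + 1)) - sv * s + sβ * σ - s * s - sα * σ * s) +
        PowerSeries.X * (-(2 * T sw) - (T sv * s + sv * T s) + (T sβ * σ + sβ * T σ) -
          (T s * s + s * T s) - ((T sα * σ + sα * T σ) * s + sα * σ * T s))) := by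
    have h1 := congrArg T hs
    rw [hT.der.leibniz, hT.apply_X, hT.comm] at h1
    rw [h1]
    simp only [riccS, map_add, map_sub, map_neg, T2, hT.der.leibniz, hT.apply_X, T1, add_zero]
  have hTσ : m * PowerSeries.X * Dx σ + PowerSeries.X * Dx (T σ) =
      T σ + (m * PowerSeries.X * (sβ - sα * s - (1 / 2 : ℂ) • (sv * σ) - s * σ) +
        PowerSeries.X * (T sβ - (T sα * s + sα * T s) - (1 / 2 : ℂ) • (T sv * σ + sv * T σ) -
          (T s * σ + s * T σ))) := by
    have h1 := congrArg T hσ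
    rw [hT.der.leibniz, hT.apply_X, hT.comm] at h1
    rw [h1]
    simp only [riccσ, map_add, map_sub, map_smul, hT.der.leibniz, hT.apply_X]
  have hk : List.Forall₂ (HasKind Dx)
      [.const, .even, .even, .odd, .odd, .even, .even, .odd, .odd, .const,
        .const, .even, .even, .odd, .odd, .even, .odd]
      [PowerSeries.X, sv, sw, sα, sβ, b, s, ρ, σ, κ, m, T sv, T sw, T sα, T sβ, T s, T σ] := by
    simp only [List.forall₂_cons, List.forall₂_nil_left_iff, hasKind_X]
    exact ⟨trivial, u0, u1, u2, u3, pb, ps, pρ, pσ, kκ, hm, even u0, even u1, odd u2, odd u3,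
      even ps, odd pσ, trivial⟩
  rw [← sub_eq_zero] at hb hρ hs hσ hTs hTσ
  rw [hT.der.leibniz sα σ, ← sub_eq_zero]
  generalize T sv = Tv at *
  generalize T sw = Tw at *
  generalize T sα = Tα at *
  generalize T sβ = Tβ at *
  generalize T s = Ts at *
  generalize T σ = Tσ at *
  -- With the variations as free atoms, the claim is a combination of the defects of the equations
  -- for b, ρ, s, σ and of the linearized Riccati equations. The latter carry the multipliers b and
  -- 2ρ + bσ, as in the total derivative of the statement.
  have key := eq_of_check isEvenDer_Dx _ _ hk (x :=
    (2 * (m * (κ - b * s - ρ * σ)) + PowerSeries.X * ((κ - b * s - ρ * σ) * Tv - 2 * (b * Tw) -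
        2 * ((κ * σ + ρ * s) * Tα) + 2 * (ρ * Tβ)) -
      2 * (κ * (m + PowerSeries.X * ((1 / 2 : ℂ) • Tv + Ts + (Tα * σ + sα * Tσ)))) -
      PowerSeries.X * Dx (b * Ts + (2 * ρ + b * σ) * Tσ))) (y :=
    -((PowerSeries.X * Dx b - (-(2 * b) + PowerSeries.X * (sv * b - 2 * (κ - b * s - ρ * σ) -
        2 * (sα * ρ)))) * (Ts + σ * Tσ) +
      b * ((m * PowerSeries.X * Dx s + PowerSeries.X * Dx Ts -
      (2 * Ts + (m * PowerSeries.X * (-(2 * (sw + 1)) - sv * s + sβ * σ - s * s - sα * σ * s) +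
        PowerSeries.X * (-(2 * Tw) - (Tv * s + sv * Ts) + (Tβ * σ + sβ * Tσ) -
          (Ts * s + s * Ts) - ((Tα * σ + sα * Tσ) * s + sα * σ * Ts))))) -
        m * (PowerSeries.X * Dx s - riccS s σ)) +
      (2 * (PowerSeries.X * Dx ρ - (-ρ + PowerSeries.X * ((1 / 2 : ℂ) • (sv * ρ) +
        (κ * σ + ρ * s) - (κ - b * s - ρ * σ) * sα - b * sβ))) +
        b * (PowerSeries.X * Dx σ - riccσ s σ)) * Tσ +
      (2 * ρ + b * σ) * ((m * PowerSeries.X * Dx σ + PowerSeries.X * Dx Tσ -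
      (Tσ + (m * PowerSeries.X * (sβ - sα * s - (1 / 2 : ℂ) • (sv * σ) - s * σ) +
        PowerSeries.X * (Tβ - (Tα * s + sα * Ts) - (1 / 2 : ℂ) • (Tv * σ + sv * Tσ) -
          (Ts * σ + s * Tσ))))) - m * (PowerSeries.X * Dx σ - riccσ s σ)))) (by decide +kernel)
  rw [key, hb, hρ, hs, hσ, hTs, hTσ]
  simp only [mul_zero, zero_mul, sub_zero, add_zero, neg_zero]

/-! ### The Hamiltonians -/

theorem zder_C (f : Alg) : zder (PowerSeries.C f) = 0 := by
  ext n
  rw [coeff_zder, PowerSeries.coeff_C, map_zero]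
  split_ifs with h
  · simp [h]
  · simp

theorem isVariation_zder : IsVariation 1 zder where
  der := isEvenDer_zder
  comm := zder_cmap dx
  apply_X := by
    ext n
    rw [coeff_zder, one_mul, PowerSeries.coeff_X]
    split_ifs with h <;> simp [h]

theorem isVariation_cmap_ev {X : Fin 4 → Alg} (hX : Typed X) : IsVariation 0 (cmap (ev X hX)) where
  der := isEvenDer_cmap ⟨ev_mul hX, fun f => ev_parity hX f⟩
  comm := cmap_comm (ev_D hX)
  apply_X := by
    ext n
    rw [coeff_cmap, zero_mul, PowerSeries.coeff_X, map_zero]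
    split_ifs
    · simpa using ev_algebraMap hX 1
    · exact map_zero _

theorem coeff_algebraMap_mul (c : ℂ) (n : ℕ) (f : PS) :
    PowerSeries.coeff n (algebraMap ℂ PS c * f) = c • PowerSeries.coeff n f := by
  rw [algebraMap_PS, PowerSeries.coeff_C_mul, Algebra.smul_def]

/-- The variation of `∫ 2 a_{n+1} dx` is `n ∫ G_nᵀ δu dx`. -/
theorem RiccatiForm.two_mul_ev_sub_mem {k₀ : ℂ} {a b g ρ δ s σ : PS}
    (h : RiccatiForm (algebraMap ℂ PS k₀) a b g ρ δ s σ) {X : Fin 4 → Alg} (hX : Typed X) (n : ℕ) :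
    (2 : ℂ) • ev X hX (PowerSeries.coeff (n + 1) a) - (n : ℂ) •
      (PowerSeries.coeff n a * X 0 - 2 * (PowerSeries.coeff n b * X 1) -
        2 * (PowerSeries.coeff n δ * X 2) + 2 * (PowerSeries.coeff n ρ * X 3)) ∈
      LinearMap.range dx := by
  have k1 : HasKind Dx .const (1 : PS) := by simpa using hasKind_algebraMap_PS 1
  have k0 : HasKind Dx .const (0 : PS) := by simpa using hasKind_algebraMap_PS 0
  -- Modulo ∂, `h1` says 2aₙ₊₁ = 2k₀n(s + ασ)ₙ, and `h2` says that the field variation of 2k₀(v/2 +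
  -- s + ασ)ₙ is Gₙ·X. Vary `h1` and insert n times `h2`.
  have h1 := congrArg (PowerSeries.coeff (n + 1)) (h.variation k1 isVariation_zder)
  have h2 := congrArg (PowerSeries.coeff (n + 1)) (h.variation k0 (isVariation_cmap_ev hX))
  simp only [zder_C, mul_zero, sub_zero, zero_mul, add_zero, zero_add, smul_zero, one_mul, map_sub,
    coeff_two_mul, coeff_algebraMap_mul, map_add, PowerSeries.coeff_succ_X_mul,
    PowerSeries.coeff_one, if_neg n.succ_ne_zero, coeff_cmap, coeff_zder, cmap_C, ev_field,
    PowerSeries.coeff_mul_C, PowerSeries.coeff_smul] at h1 h2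
  -- The term v/2 does not depend on z: it contributes only for n = 0, where the factor n kills it.
  have h0 : (n : ℂ) • PowerSeries.coeff n (PowerSeries.C (X 0)) = 0 := by
    rw [PowerSeries.coeff_C]
    split_ifs with h
    · simp [h]
    · simp
  generalize PowerSeries.coeff n ((2 * ρ + b * σ) * zder σ) = y₁ at h1
  generalize PowerSeries.coeff n ((2 * ρ + b * σ) * cmap (ev X hX) σ) = y₂ at h2
  have h3 := congrArg (ev X hX) h1
  simp only [two_mul, map_sub, map_add, map_smul, ev_D] at h3
  rw [two_mul (k₀ • _)] at h2
  generalize PowerSeries.coeff n a * X 0 - 2 * (PowerSeries.coeff n b * X 1) -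
        2 * (PowerSeries.coeff n δ * X 2) + 2 * (PowerSeries.coeff n ρ * X 3) = G at *
  refine ⟨ev X hX (PowerSeries.coeff n (b * zder s)) +
    ev X hX y₁ - (n : ℂ) • (PowerSeries.coeff n (b * cmap (ev X hX) s) + y₂), ?_⟩
  simp only [map_sub, map_add, map_smul]
  linear_combination (norm := module) -h3 + (n : ℂ) • h2 + k₀ • h0

theorem grad_smul (c : ℂ) (f : Alg) : grad (c • f) = c • grad f :=
  funext fun i => euler_smul i c f

theorem grad_add (f g : Alg) : grad (f + g) = grad f + grad g :=
  funext fun i => euler_add i f g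

/-- The variational gradient of `∫ 2 a_{n+1} dx`. -/
theorem two_smul_grad_a {N : Coeffs} {k₀ : ℂ} (hk₀ : k₀ ≠ 0) (h : N.IsSolution k₀)
    (hn : N.IsNormalized k₀) (n : ℕ) : (2 : ℂ) • grad (N.a (n + 1)) = (n : ℂ) • N.vec n := by
  obtain ⟨s, σ, hs⟩ := h.sol.exists_riccatiForm hk₀ (by simpa using h.init.1)
    ((h.sol.isNormalized_iff k₀).1 hn)
  rw [← sub_eq_zero]
  refine eq_zero_of_sum_mul_mem (odd := oddField) (j := 0) rfl fun X hX => ?_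
  have h1 := hs.two_mul_ev_sub_mem hX n
  have h2 := ev_sub_sum_grad_mem hX (N.a (n + 1))
  simp only [PowerSeries.coeff_mk] at h1
  convert sub_mem h1 (Submodule.smul_mem _ (2 : ℂ) h2) using 1
  simp only [Fin.sum_univ_four, Pi.sub_apply, Pi.smul_apply, Coeffs.vec, Matrix.cons_val, sub_mul,
    smul_mul_assoc, neg_mul, mul_assoc]
  module

theorem grad_field (i : Fin 4) : grad (field i) = Pi.single i 1 := by
  funext j
  have h : OrderLT 1 (field i) := fun z hz => by
    rw [field, pd_gen, if_neg]
    rintro rfl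
    exact absurd hz (by simp)
  rw [grad, euler_eq_sum h, Finset.sum_range_one, pow_zero, Module.End.one_apply, field, pd_gen]
  by_cases hij : i = j
  · subst hij; simp
  · rw [if_neg (by simpa using hij), Pi.single_apply, if_neg (Ne.symm hij)]

theorem grad_ham {N : Coeffs} {k₀ : ℂ} (hk₀ : k₀ ≠ 0) (h : N.IsSolution k₀)
    (hn : N.IsNormalized k₀) (n : ℕ) : grad (N.ham k₀ n) = N.vec n := by
  unfold Coeffs.ham
  split_ifs with hn0
  · subst hn0
    rw [grad_smul, grad_field]
    obtain ⟨h1, h2, -, h3, h4⟩ := h.init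
    rw [Coeffs.vec, h1, h2, h3, h4]
    funext i
    fin_cases i <;> simp [Algebra.smul_def]
  · have hn1 : (n : ℂ) ≠ 0 := Nat.cast_ne_zero.2 hn0
    rw [grad_smul, div_eq_inv_mul, mul_smul, two_smul_grad_a hk₀ h hn, smul_smul,
      inv_mul_cancel₀ hn1, one_smul]

/-! ### The super-trace identity -/

theorem coeff_dlam (f : Ser) (m : ℤ) :
    (dlam f).coeff m = -(((m - 1 : ℤ) : ℂ) • f.coeff (m - 1)) := by
  have h : m - 2 + (1 : ℕ) = m - 1 := by push_cast; ring
  rw [dlam, HahnSeries.coeff_neg, HahnSeries.coeff_single_mul, one_mul,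
    LaurentSeries.derivative_apply, LaurentSeries.hasseDeriv_coeff, Ring.choose_one_right, h,
    Int.cast_smul_eq_zsmul]

theorem dlam_add (f g : Ser) : dlam (f + g) = dlam f + dlam g := by
  simp only [dlam, map_add, mul_add, neg_add]

theorem dlam_neg (f : Ser) : dlam (-f) = -dlam f := by
  simp only [dlam, map_neg, mul_neg]

theorem dlam_con (f : Alg) : dlam (con f) = 0 := by
  ext m
  rw [coeff_dlam, HahnSeries.coeff_zero, HahnSeries.C_apply, HahnSeries.coeff_single]
  split_ifs with h
  · simp [h]
  · simp

theorem dlam_lam : dlam lam = 1 := by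
  ext m
  rw [coeff_dlam, lam, HahnSeries.coeff_single, HahnSeries.coeff_one]
  by_cases h : m = 0
  · subst h; simp
  · rw [if_neg (by omega), if_neg h, smul_zero, neg_zero]

theorem specM_map_dlam : specM.map dlam = !![-1, 0, 0; 0, 1, 0; 0, 0, 0] := by
  have h1 : dlam (1 : Ser) = 0 := by simpa using dlam_con 1
  have h0 : dlam (0 : Ser) = 0 := by simpa using dlam_con 0
  ext1 i j
  fin_cases i <;> fin_cases j <;>
    simp only [specM, Matrix.map_apply, Matrix.of_apply, Matrix.cons_val, Fin.zero_eta, Fin.mk_one,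
      Fin.reduceFinMk, Fin.isValue, sub_eq_add_neg (lam), dlam_add, dlam_neg, dlam_con, dlam_lam, h1,
      h0, neg_zero, add_zero]

theorem map_con (T : Alg →ₗ[ℂ] Alg) (f : Alg) : (con f).map T = con (T f) := by
  ext m
  rw [HahnSeries.map_coeff, HahnSeries.C_apply, HahnSeries.C_apply, HahnSeries.coeff_single,
    HahnSeries.coeff_single]
  split_ifs <;> simp

theorem ser_map_add (T : Alg →ₗ[ℂ] Alg) (f g : Ser) : (f + g).map T = f.map T + g.map T := by
  ext m
  simp

theorem ser_map_neg (T : Alg →ₗ[ℂ] Alg) (f : Ser) : (-f).map T = -f.map T := by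
  ext m
  simp

theorem map_lam {T : Alg →ₗ[ℂ] Alg} (hT : T 1 = 0) : lam.map T = 0 := by
  ext m
  rw [HahnSeries.map_coeff, lam, HahnSeries.coeff_single, HahnSeries.coeff_zero]
  split_ifs <;> simp [hT]

/-- The derivative of `M` along a map that kills the constants. -/
theorem mapCoeff_specM {T : Alg →ₗ[ℂ] Alg} (hT : T 1 = 0) : mapCoeff T specM =
    !![con ((1 / 2 : ℂ) • T fv), 0, con (T fα);
       con (-(2 * T fw)), -con ((1 / 2 : ℂ) • T fv), con (T fβ);
       con (T fβ), -con (T fα), 0] := by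
  have h1 : (1 : Ser).map T = 0 := by simpa [hT] using map_con T 1
  have h0 : (0 : Ser).map T = 0 := by simpa using map_con T 0
  have h2 : T 2 = 0 := by rw [← one_add_one_eq_two, map_add, hT, add_zero]
  ext1 i j
  fin_cases i <;> fin_cases j <;>
    simp only [mapCoeff, specM, Matrix.map_apply, Matrix.of_apply, Matrix.cons_val, Fin.zero_eta,
      Fin.mk_one, Fin.reduceFinMk, Fin.isValue, sub_eq_add_neg (lam), ser_map_add, ser_map_neg,
      map_con, map_lam hT, h1, h0, h2, two_mul, map_sub T, map_add T, map_neg T, map_smul, neg_zero,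
      zero_add, sub_zero]

/-- `Str (N ∂M/∂λ) = -2 a`. -/
theorem str_mul_dlam (N : Coeffs) :
    str (N.ser * specM.map dlam) = toSer (PowerSeries.mk fun m => -((2 : ℂ) • N.a m)) := by
  have h : (PowerSeries.mk fun m => -((2 : ℂ) • N.a m) : PS) =
      -PowerSeries.mk N.a - PowerSeries.mk N.a := by
    ext m
    simp only [PowerSeries.coeff_mk, map_sub, map_neg]
    module
  rw [h, specM_map_dlam, N.ser_eq]
  simp [str, Matrix.mul_apply, Fin.sum_univ_three, matN]
  abel

/-- `Str (N ∂M/∂u) = G`. -/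
theorem str_mul_pd (N : Coeffs) (i : Fin 4) :
    str (N.ser * mapCoeff (JetAlg.pd oddField (i, 0)) specM) =
      toSer (PowerSeries.mk fun m => N.vec m i) := by
  have h1 : JetAlg.pd oddField (i, 0) 1 = 0 := by
    simpa using pd_algebraMap (odd := oddField) (i, 0) 1
  have h2 : ∀ j, JetAlg.pd oddField (i, 0) (field j) = if j = i then 1 else 0 := fun j => by
    rw [field, pd_gen]
    simp
  have h3 : ∀ f : ℕ → Alg, (PowerSeries.mk fun m => -(2 * f m) : PS) =
      -PowerSeries.mk f - PowerSeries.mk f := fun f => by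
    ext m
    simp only [PowerSeries.coeff_mk, map_sub, map_neg, two_mul]
    abel
  have h4 : ∀ f : ℕ → Alg, (PowerSeries.mk fun m => 2 * f m : PS) =
      PowerSeries.mk f + PowerSeries.mk f := fun f => by
    ext m
    simp only [PowerSeries.coeff_mk, map_add, two_mul]
  have h5 : ∀ x : Ser, x * con ((1 / 2 : ℂ) • 1) + x * con ((1 / 2 : ℂ) • 1) = x := fun x => by
    rw [← mul_add, ← map_add, ← add_smul]
    norm_num
  have h6 : ∀ x : Ser, x * con (-2) = -x - x := fun x => by
    rw [← one_add_one_eq_two, neg_add, map_add, map_neg, map_one]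
    noncomm_ring
  rw [mapCoeff_specM h1, N.ser_eq, h2, h2, h2, h2]
  simp only [str, Matrix.mul_apply, Fin.sum_univ_three, matN, Matrix.map_apply, Matrix.of_apply,
    Matrix.cons_val, Fin.isValue, map_neg toSer, map_zero toSer, mul_zero, add_zero, zero_add,
    neg_mul_neg, Coeffs.vec]
  fin_cases i <;>
    simp only [Fin.zero_eta, Fin.mk_one, Fin.reduceFinMk, Fin.isValue, Fin.reduceEq, if_true,
      if_false, h3, h4, h5, h6, smul_zero, map_zero, mul_zero, add_zero, zero_add, sub_zero,
      neg_zero, map_one, mul_one, mul_neg, map_sub toSer, map_neg toSer, map_add toSer,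
      sub_neg_eq_add, Matrix.cons_val]

/-- The two supertraces are -2a and G. Since ∂/∂λ sends zⁿ to -n zⁿ⁺¹, the coefficient of zⁿ⁺¹ is
the gradient formula for 2aₙ₊₁; for m ≤ 0 both sides vanish, a₀ being constant. -/
theorem supertrace_identity {N : Coeffs} {k₀ : ℂ} (hk₀ : k₀ ≠ 0) (h : N.IsSolution k₀)
    (hn : N.IsNormalized k₀) (i : Fin 4) (m : ℤ) :
    JetAlg.euler oddField i ((str (N.ser * specM.map dlam)).coeff m) =
      (dlam (str (N.ser * mapCoeff (JetAlg.pd oddField (i, 0)) specM))).coeff m := by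
  rw [str_mul_dlam, str_mul_pd, coeff_dlam, PowerSeries.coeff_coe, PowerSeries.coeff_coe]
  rcases lt_trichotomy m 0 with h0 | rfl | h0
  · rw [if_pos h0, if_pos (by omega), smul_zero, neg_zero, ← map_zero (algebraMap ℂ Alg),
      euler_algebraMap]
    simp
  · rw [if_neg (by omega), if_pos (by omega), smul_zero, neg_zero, PowerSeries.coeff_mk,
      Int.natAbs_zero, h.init.1, ← neg_smul, euler_smul, euler_algebraMap, smul_zero]
  · obtain ⟨n, rfl⟩ : ∃ n : ℕ, m = n + 1 := ⟨(m - 1).toNat, by omega⟩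
    have h1 : ((n : ℤ) + 1).natAbs = n + 1 := by omega
    rw [if_neg (by omega), if_neg (by omega), PowerSeries.coeff_mk, PowerSeries.coeff_mk, h1,
      add_sub_cancel_right, Int.natAbs_natCast, Int.cast_natCast, ← neg_smul, euler_smul]
    have h2 := congrFun (two_smul_grad_a hk₀ h hn n) i
    simp only [Pi.smul_apply, grad] at h2
    rw [neg_smul, h2]

/-! ### The flows -/

/-- The recursion for the coefficients of a solution. -/
structure Coeffs.Rec (N : Coeffs) (m : ℕ) : Prop where
  even_a : IsEven (N.a m)
  even_b : IsEven (N.b m)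
  even_g : IsEven (N.g m)
  odd_ρ : IsOdd (N.ρ m)
  odd_δ : IsOdd (N.δ m)
  dx_a : dx (N.a m) = N.g m + 2 * ((fw + 1) * N.b m) + fα * N.δ m + fβ * N.ρ m
  b_succ : N.b (m + 1) = (1 / 2 : ℂ) • (fv * N.b m - 2 * N.a m - 2 * (fα * N.ρ m) - dx (N.b m))
  g_succ : N.g (m + 1) = (1 / 2 : ℂ) •
    (dx (N.g m) + 4 * ((fw + 1) * N.a m) + fv * N.g m - 2 * (fβ * N.δ m))
  ρ_succ : N.ρ (m + 1) = (1 / 2 : ℂ) • (fv * N.ρ m) + N.δ m - fα * N.a m - fβ * N.b m - dx (N.ρ m)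
  δ_succ : N.δ (m + 1) =
    dx (N.δ m) + 2 * ((fw + 1) * N.ρ m) + (1 / 2 : ℂ) • (fv * N.δ m) + fα * N.g m - fβ * N.a m

theorem Coeffs.Sol.recursion {N : Coeffs} (h : N.Sol) (m : ℕ) : N.Rec m := by
  have hA := h.coeff_a m
  have hB := ((eq_b_iff _ _ _).1 h.eq_b).2 m
  have hG := ((eq_g_iff _ _ _).1 h.eq_g).2 m
  have hR := ((eq_ρ_iff h.par_a h.par_b _ _).1 h.eq_ρ).2 m
  have hD := ((eq_δ_iff h.par_a h.par_g _ _).1 h.eq_δ).2 m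
  simp only [PowerSeries.coeff_mk] at hA hB hG hR hD
  refine ⟨mk_par_eq.1 h.par_a m, mk_par_eq.1 h.par_b m, mk_par_eq.1 h.par_g m,
    mk_par_neg.1 h.par_ρ m, mk_par_neg.1 h.par_δ m, hA, ?_, ?_, ?_, ?_⟩
  · rw [hB, two_mul (N.b (m + 1))]; module
  · rw [hG, two_mul (N.g (m + 1))]; module
  · rw [hR]; module
  · rw [hD]; module

theorem Coeffs.Rec.kinds {N : Coeffs} {m : ℕ} (h : N.Rec m) : List.Forall₂ (HasKind dx)
    [.even, .even, .odd, .odd, .even, .even, .even, .odd, .odd]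
    [fv, fw, fα, fβ, N.a m, N.b m, N.g m, N.ρ m, N.δ m] := by
  obtain ⟨u0, u1, u2, u3⟩ := typed_field.kinds
  simp only [List.forall₂_cons, List.forall₂_nil_left_iff]
  exact ⟨u0, u1, u2, u3, h.even_a, h.even_b, h.even_g, h.odd_ρ, h.odd_δ, trivial⟩

/-! ### Zero curvature in matrix form -/

/-- The coefficient of `λ` in `M`. -/
def matE : Matrix (Fin 3) (Fin 3) Alg := !![-1, 0, 0; 0, 1, 0; 0, 0, 0]

/-- The part of `M` that is constant in `λ`. -/
def matM : Matrix (Fin 3) (Fin 3) Alg :=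
  !![(1 / 2 : ℂ) • fv, 1, fα; -(2 * fw) - 2, -((1 / 2 : ℂ) • fv), fβ; fβ, -fα, 0]

theorem matE_comm (N : Coeffs) (m : ℕ) : matE * N.mat m - N.mat m * matE =
    !![0, -(2 * N.b m), -N.ρ m; 2 * N.g m, 0, N.δ m; N.δ m, N.ρ m, 0] := by
  ext1 i j
  fin_cases i <;> fin_cases j <;>
    simp [matE, Coeffs.mat, two_mul, Coeffs.g] <;> abel

set_option synthInstance.maxHeartbeats 400000 in
set_option synthInstance.maxSize 100000 in
-- With M = λE + M₀ this is the coefficient of λ⁻ᵐ in Nₓ = [M, N]. It makes the truncation of λⁿN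
-- telescope.
theorem Coeffs.Rec.matrix {N : Coeffs} {m : ℕ} (h : N.Rec m) : (N.mat m).map dx =
    (matE * N.mat (m + 1) - N.mat (m + 1) * matE) + (matM * N.mat m - N.mat m * matM) := by
  have hk := h.kinds
  have hg : N.mat m = !![N.a m, N.b m, N.ρ m; N.g m, -N.a m, N.δ m; N.δ m, -N.ρ m, 0] := rfl
  rw [matE_comm, hg]
  ext1 i j
  rw [Matrix.add_apply, h.b_succ, h.g_succ, h.ρ_succ, h.δ_succ]
  fin_cases i <;> fin_cases j <;>
    simp only [matM, Matrix.mul_apply, Matrix.sub_apply, Matrix.map_apply, Fin.sum_univ_three,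
      Matrix.of_apply, Matrix.cons_val, Fin.zero_eta, Fin.mk_one, Fin.reduceFinMk, Fin.isValue,
      map_neg dx, map_zero dx, h.dx_a] <;>
  exact eq_of_check (isEvenDer_D oddField) _ _ hk (by decide +kernel)

abbrev conM : Matrix (Fin 3) (Fin 3) Alg →+* Matrix (Fin 3) (Fin 3) Ser := con.mapMatrix

theorem specM_eq : specM = lam • conM matE + conM matM := by
  ext1 i j
  fin_cases i <;> fin_cases j <;> simp [specM, matE, matM, sub_eq_add_neg, -HahnSeries.C_apply]

theorem lam_mul (f : Ser) : lam * f = f * lam := by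
  ext n
  rw [lam, HahnSeries.coeff_single_mul, HahnSeries.coeff_mul_single, one_mul, mul_one]

theorem mul_lam_smul (A B : Matrix (Fin 3) (Fin 3) Ser) : A * lam • B = lam • (A * B) := by
  ext1 i j
  simp only [Matrix.mul_apply, Matrix.smul_apply, smul_eq_mul, Finset.mul_sum]
  refine Finset.sum_congr rfl fun k _ => ?_
  rw [← mul_assoc, ← lam_mul, mul_assoc]

theorem mapCoeff_add (T : Alg →ₗ[ℂ] Alg) (A B : Matrix (Fin 3) (Fin 3) Ser) :
    mapCoeff T (A + B) = mapCoeff T A + mapCoeff T B := by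
  ext1 i j
  exact ser_map_add T _ _

theorem mapCoeff_lam_smul (T : Alg →ₗ[ℂ] Alg) (A : Matrix (Fin 3) (Fin 3) Ser) :
    mapCoeff T (lam • A) = lam • mapCoeff T A := by
  ext i j n
  simp only [mapCoeff, Matrix.map_apply, Matrix.smul_apply, smul_eq_mul, HahnSeries.map_coeff, lam,
    HahnSeries.coeff_single_mul, one_mul]

theorem mapCoeff_conM (T : Alg →ₗ[ℂ] Alg) (A : Matrix (Fin 3) (Fin 3) Alg) :
    mapCoeff T (conM A) = conM (A.map T) := by
  ext1 i j
  exact map_con T _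

/-- The polynomial part of `λ^n N`. -/
def Coeffs.pos (N : Coeffs) (n : ℕ) : Matrix (Fin 3) (Fin 3) Ser :=
  Matrix.of fun i j =>
    ∑ m ∈ Finset.range (n + 1), HahnSeries.single ((m : ℤ) - (n : ℤ)) (N.mat m i j)

theorem Coeffs.pos_zero (N : Coeffs) : N.pos 0 = conM (N.mat 0) := by
  ext1 i j
  simp [Coeffs.pos]

theorem Coeffs.pos_succ (N : Coeffs) (n : ℕ) :
    N.pos (n + 1) = lam • N.pos n + conM (N.mat (n + 1)) := by
  ext1 i j
  rw [Matrix.add_apply, Matrix.smul_apply, Coeffs.pos, Coeffs.pos, Matrix.of_apply, Matrix.of_apply,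
    Finset.sum_range_succ, smul_eq_mul, Finset.mul_sum]
  congr 1
  · refine Finset.sum_congr rfl fun m _ => ?_
    have hm : ((m : ℤ) - ((n + 1 : ℕ) : ℤ)) = -1 + (m - n) := by push_cast; ring
    rw [lam, HahnSeries.single_mul_single, one_mul, hm]
  · simp

theorem specM_comm_conM (Q : Matrix (Fin 3) (Fin 3) Alg) : specM * conM Q - conM Q * specM =
    lam • conM (matE * Q - Q * matE) + conM (matM * Q - Q * matM) := by
  rw [specM_eq, add_mul, mul_add, mul_lam_smul, Matrix.smul_mul]
  simp only [map_sub, map_mul, smul_sub]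
  abel

/-- `[M, (λ^n N)₊] - ((λ^n N)₊)_x` does not depend on `λ`. -/
theorem Coeffs.IsSolution.pos_comm {N : Coeffs} {k₀ : ℂ} (h : N.IsSolution k₀) (n : ℕ) :
    specM * N.pos n - N.pos n * specM - mapCoeff dx (N.pos n) =
      -conM (matE * N.mat (n + 1) - N.mat (n + 1) * matE) := by
  have key : ∀ m, specM * conM (N.mat m) - conM (N.mat m) * specM - mapCoeff dx (conM (N.mat m)) =
      lam • conM (matE * N.mat m - N.mat m * matE) -
        conM (matE * N.mat (m + 1) - N.mat (m + 1) * matE) := fun m => by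
    rw [mapCoeff_conM, specM_comm_conM, (h.sol.recursion m).matrix, map_add]
    abel
  induction n with
  | zero =>
    have h0 : matE * N.mat 0 - N.mat 0 * matE = 0 := by
      obtain ⟨-, h1, h2, h3, h4⟩ := h.init
      rw [matE_comm, h1, h3, h4, Coeffs.g, h1, h2]
      ext1 i j
      fin_cases i <;> fin_cases j <;> simp
    rw [Coeffs.pos_zero, key, h0, map_zero, smul_zero, zero_sub]
  | succ n ih =>
    rw [Coeffs.pos_succ, mapCoeff_add, mapCoeff_lam_smul, mul_add, add_mul, mul_lam_smul,
      Matrix.smul_mul]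
    -- By induction the first group is -λ[E, Nₙ₊₁], which cancels the λ-part of the new summand and
    -- leaves -[E, Nₙ₊₂].
    have e1 : lam • (specM * N.pos n) + specM * conM (N.mat (n + 1)) -
        (lam • (N.pos n * specM) + conM (N.mat (n + 1)) * specM) -
        (lam • mapCoeff dx (N.pos n) + mapCoeff dx (conM (N.mat (n + 1)))) =
      lam • (specM * N.pos n - N.pos n * specM - mapCoeff dx (N.pos n)) +
        (specM * conM (N.mat (n + 1)) - conM (N.mat (n + 1)) * specM -
          mapCoeff dx (conM (N.mat (n + 1)))) := by
      simp only [smul_sub]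
      abel
    rw [e1, ih, key, smul_neg]
    abel

/-- The vector field of the `n`-th flow. -/
def Coeffs.flow (N : Coeffs) (n : ℕ) : Fin 4 → Alg :=
  ![2 * dx (N.b (n + 1)),
    -dx (N.a (n + 1)) + fα * N.δ (n + 1) + fβ * N.ρ (n + 1),
    fα * N.b (n + 1) - N.ρ (n + 1),
    -(fβ * N.b (n + 1)) + N.δ (n + 1)]

set_option synthInstance.maxHeartbeats 400000 in
set_option synthInstance.maxSize 100000 in
-- The whole expression is constant in λ. Entry 12 of M is the constant 1, so it must not move: the
-- bare truncation contributes 2bₙ₊₁ there, and the commutator of M with bₙ₊₁ diag(1, -1, 0)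
-- contributes -2bₙ₊₁. The remaining entries read off the four field derivatives.
theorem Coeffs.IsSolution.zeroCurvature_iff {N : Coeffs} {k₀ : ℂ} (h : N.IsSolution k₀) (n : ℕ)
    {T : Alg →ₗ[ℂ] Alg} (hT : ∀ f g, T (f * g) = T f * g + f * T g) :
    mapCoeff T specM - mapCoeff dx (N.aux n) + (specM * N.aux n - N.aux n * specM) = 0 ↔
      (fun i => T (field i)) = N.flow n := by
  have hT1 : T 1 = 0 := by simpa using hT 1 1
  have hr := h.sol.recursion (n + 1)
  let H : Matrix (Fin 3) (Fin 3) Alg := !![N.b (n + 1), 0, 0; 0, -N.b (n + 1), 0; 0, 0, 0]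
  let W : Matrix (Fin 3) (Fin 3) Alg :=
    !![(1 / 2 : ℂ) • T fv, 0, T fα; -(2 * T fw), -((1 / 2 : ℂ) • T fv), T fβ; T fβ, -T fα, 0]
  have haux : N.aux n = N.pos n + conM H := by
    rw [Coeffs.aux, Coeffs.pos]
    congr 1
    ext1 i j
    fin_cases i <;> fin_cases j <;> simp [H]
  have hW : mapCoeff T specM = conM W := by
    rw [mapCoeff_specM hT1]
    ext1 i j
    fin_cases i <;> fin_cases j <;> simp [W, -HahnSeries.C_apply]
  have hE : matE * H - H * matE = 0 := by
    ext1 i j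
    fin_cases i <;> fin_cases j <;> simp [matE, H]
  have h1 : mapCoeff T specM - mapCoeff dx (N.aux n) + (specM * N.aux n - N.aux n * specM) =
      conM (W + (-(matE * N.mat (n + 1) - N.mat (n + 1) * matE) - H.map dx +
        (matM * H - H * matM))) := by
    have h2 := specM_comm_conM H
    rw [hE, map_zero, smul_zero, zero_add] at h2
    rw [haux, hW, mapCoeff_add, mul_add, add_mul, mapCoeff_conM, map_add, map_add, map_sub, map_neg, ← h2,
      ← h.pos_comm n]
    abel
  have h2 : -(matE * N.mat (n + 1) - N.mat (n + 1) * matE) - H.map dx + (matM * H - H * matM) =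
      !![-((1 / 2 : ℂ) • N.flow n 0), 0, -N.flow n 2;
         2 * N.flow n 1, (1 / 2 : ℂ) • N.flow n 0, -N.flow n 3;
         -N.flow n 3, N.flow n 2, 0] := by
    have hk := hr.kinds
    rw [matE_comm]
    ext1 i j
    simp only [Coeffs.flow, Matrix.cons_val, hr.dx_a]
    fin_cases i <;> fin_cases j <;>
      simp only [H, matM, Matrix.mul_apply, Matrix.add_apply, Matrix.neg_apply, Matrix.sub_apply,
        Matrix.map_apply, Fin.sum_univ_three, Matrix.of_apply, Matrix.cons_val, Fin.zero_eta,
        Fin.mk_one, Fin.reduceFinMk, Fin.isValue] <;>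
    exact eq_of_check (isEvenDer_D oddField) _ _ hk (by decide +kernel)
  have hinj : Function.Injective conM := fun A B hAB => by
    ext i j
    exact HahnSeries.C_injective (congrFun (congrFun hAB i) j)
  rw [h1, h2, map_eq_zero_iff _ hinj]
  constructor
  · intro h3
    have e0 := congrFun (congrFun h3 0) 0
    have e1 := congrFun (congrFun h3 1) 0
    have e2 := congrFun (congrFun h3 0) 2
    have e3 := congrFun (congrFun h3 1) 2
    simp only [W, Matrix.add_apply, Matrix.of_apply, Matrix.cons_val, Matrix.zero_apply, Fin.isValue,
      ← sub_eq_add_neg, ← smul_sub] at e0 e1 e2 e3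
    rw [neg_add_eq_sub, ← mul_sub] at e1
    funext i
    fin_cases i
    · exact sub_eq_zero.1 ((smul_eq_zero.1 e0).resolve_left (by norm_num))
    · exact (sub_eq_zero.1 (eq_zero_of_two_mul e1)).symm
    · exact sub_eq_zero.1 e2
    · exact sub_eq_zero.1 e3
  · intro h3
    simp only [← h3]
    ext1 i j
    fin_cases i <;> fin_cases j <;> simp [W]

theorem Coeffs.IsSolution.typed_flow {N : Coeffs} {k₀ : ℂ} (h : N.IsSolution k₀) (n : ℕ) :
    Typed (N.flow n) := by
  have hr := h.sol.recursion (n + 1)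
  obtain ⟨u0, u1, u2, u3⟩ := typed_field.parity
  have ha := hr.even_a
  have hb := hr.even_b
  have hρ := hr.odd_ρ
  have hδ := hr.odd_δ
  unfold IsEven IsOdd at *
  intro i
  fin_cases i
  · refine hasParity_false.2 ?_
    simp [IsEven, Coeffs.flow, parity_D, hb, two_mul]
  · refine hasParity_false.2 ?_
    simp [IsEven, Coeffs.flow, parity_D, ha, hδ, hρ, u2, u3]
  · refine hasParity_true.2 ?_
    simp [IsOdd, Coeffs.flow, hb, hρ, u2]
    abel
  · refine hasParity_true.2 ?_
    simp [IsOdd, Coeffs.flow, hb, hδ, u3]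
    abel

/-- Zero curvature fixes T on the fields, and a derivation commuting with ∂ is determined by these
values. Existence needs that they have the parities of the fields. -/
theorem Coeffs.IsSolution.isFlow_iff {N : Coeffs} {k₀ : ℂ} (h : N.IsSolution k₀) (n : ℕ)
    (T : Alg →ₗ[ℂ] Alg) : N.IsFlow n T ↔ T = ev (N.flow n) (h.typed_flow n) := by
  have he := h.typed_flow n
  constructor
  · intro hT
    have h1 := (h.zeroCurvature_iff n hT.leibniz).1 hT.zeroCurvature
    refine eq_of_apply_field hT.leibniz (ev_mul he) hT.comm (ev_D he) fun i => ?_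
    exact (congrFun h1 i).trans (ev_field he i).symm
  · rintro rfl
    exact ⟨ev_mul he, ev_D he,
      (h.zeroCurvature_iff n (ev_mul he)).2 (funext fun i => ev_field he i)⟩

theorem Coeffs.IsSolution.existsUnique_flow {N : Coeffs} {k₀ : ℂ} (h : N.IsSolution k₀) (n : ℕ) :
    ∃! T, N.IsFlow n T :=
  ⟨_, (h.isFlow_iff n _).2 rfl, fun _ hT => (h.isFlow_iff n _).1 hT⟩

theorem Coeffs.IsSolution.flow_eq {N : Coeffs} {k₀ : ℂ} (h : N.IsSolution k₀) {n : ℕ}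
    {T : Alg →ₗ[ℂ] Alg} (hT : N.IsFlow n T) : (fun i => T (field i)) = N.flow n :=
  (h.zeroCurvature_iff n hT.leibniz).1 hT.zeroCurvature

/-! ### The bi-Hamiltonian form -/

theorem act_J (G : Fin 4 → Alg) : act J G =
    ![-dx (G 1), -dx (G 0) - (1 / 2 : ℂ) • (fα * G 2) + (1 / 2 : ℂ) • (fβ * G 3),
      -((1 / 2 : ℂ) • (fα * G 1)) - (1 / 2 : ℂ) • G 3,
      (1 / 2 : ℂ) • (fβ * G 1) - (1 / 2 : ℂ) • G 2] := by
  have h := act_pencil 1 0 G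
  simpa [pencilAct] using h

theorem Coeffs.act_J_vec (N : Coeffs) (n : ℕ) : act J (N.vec (n + 1)) = N.flow n := by
  rw [act_J]
  funext i
  fin_cases i <;> simp [Coeffs.vec, Coeffs.flow, two_mul, mul_add] <;> module

/-- J sees the first component only through ∂, so the constant left open by ∂⁻¹ in 𝓛 disappears. -/
theorem act_J_congr {G G' : Fin 4 → Alg} (h0 : dx (G 0) = dx (G' 0)) (h1 : G 1 = G' 1)
    (h2 : G 2 = G' 2) (h3 : G 3 = G' 3) : act J G = act J G' := by
  rw [act_J, act_J, h0, h1, h2, h3]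

theorem act_R (G : Fin 4 → Alg) : act R G = pencilAct 0 1 G := by
  simpa using act_pencil 0 1 G

set_option synthInstance.maxHeartbeats 400000 in
set_option synthInstance.maxSize 100000 in
-- Checked directly: the recursion expresses all quantities of index n + 1 in the flow by those of
-- index n, with no antiderivative involved.
theorem Coeffs.IsSolution.act_R_vec {N : Coeffs} {k₀ : ℂ} (h : N.IsSolution k₀) (n : ℕ) :
    act R (N.vec n) = N.flow n := by
  have hr := h.sol.recursion n
  have hk := hr.kinds
  rw [act_R, pencilAct]
  simp only [zero_smul, zero_add, one_smul, Coeffs.flow, Coeffs.vec, Matrix.cons_val,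
    (h.sol.recursion (n + 1)).dx_a, hr.b_succ, hr.g_succ, hr.ρ_succ, hr.δ_succ]
  funext i
  fin_cases i
  · simp only [Matrix.cons_val, Fin.zero_eta, Fin.isValue]
    exact eq_of_check (isEvenDer_D oddField) _ _ hk (by decide +kernel)
  all_goals
    simp only [Matrix.cons_val, Fin.mk_one, Fin.reduceFinMk, Fin.isValue, hr.dx_a]
    exact eq_of_check (isEvenDer_D oddField) _ _ hk (by decide +kernel)

/-- The differential part of the recursion operator. -/
theorem act_recLocal (G : Fin 4 → Alg) : act (recLocal (Algebra.lmul ℂ Alg) dx) G =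
    ![(1 / 2 : ℂ) • dx (G 0) + ((1 / 2 : ℂ) • (fw * G 1) + G 1) + (1 / 4 : ℂ) • (fα * G 2) -
        (1 / 4 : ℂ) • (fβ * G 3),
      2 * G 0 + (-((1 / 2 : ℂ) • dx (G 1)) + (1 / 2 : ℂ) • (fv * G 1)) + fα * G 3,
      2 * (fβ * G 0) - 2 * (fα * dx (G 0)) - 2 * (fα * ((fw + 1) * G 1)) + dx (G 2) +
        (1 / 2 : ℂ) • (fv * G 2) + (fα * (fβ * G 3) - 2 * (fw * G 3) - 2 * G 3),
      -(2 * (fα * G 0)) + fβ * G 1 - G 2 + (-dx (G 3) + (1 / 2 : ℂ) • (fv * G 3))] := by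
  funext i
  fin_cases i <;>
    simp [act, recLocal, Fin.sum_univ_four, two_mul, add_mul, mul_add] <;> module

theorem sum_recRow (G : Fin 4 → Alg) : ∑ j, recRow (Algebra.lmul ℂ Alg) dx j (G j) =
    (1 / 2 : ℂ) • (fv * dx (G 0)) + (1 / 2 : ℂ) • (fw * dx (G 1)) -
      (1 / 2 : ℂ) • (fα * dx (G 2)) - (1 / 2 : ℂ) • (fβ * dx (G 3)) := by
  simp [recRow, Fin.sum_univ_four]
  module

set_option synthInstance.maxHeartbeats 400000 in
set_option synthInstance.maxSize 100000 in
theorem Coeffs.IsSolution.recursionRel {N : Coeffs} {k₀ : ℂ} (h : N.IsSolution k₀) (n : ℕ) :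
    RecursionRel (N.vec n) (N.vec (n + 1)) := by
  have hr := h.sol.recursion n
  have hk := hr.kinds
  -- The antiderivative is dictated by the first entry aₙ₊₁ of Gₙ₊₁; it remains to differentiate it
  -- and insert the formula for ∂aₙ₊₁.
  refine ⟨N.a (n + 1) - act (recLocal (Algebra.lmul ℂ Alg) dx) (N.vec n) 0, ?_, ?_⟩
  · rw [sum_recRow, act_recLocal, map_sub]
    simp only [Coeffs.vec, Matrix.cons_val,
      (h.sol.recursion (n + 1)).dx_a, hr.b_succ, hr.g_succ, hr.ρ_succ, hr.δ_succ, hr.dx_a]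
    exact eq_of_check (isEvenDer_D oddField) _ _ hk (by decide +kernel)
  · rw [act_recLocal]
    funext i
    fin_cases i
    · simp [Coeffs.vec]
    all_goals
      simp only [Pi.add_apply, Matrix.cons_val, Fin.mk_one, Fin.reduceFinMk,
        Fin.isValue, Coeffs.vec, add_zero, hr.b_succ, hr.ρ_succ, hr.δ_succ, hr.dx_a]
      exact eq_of_check (isEvenDer_D oddField) _ _ hk (by decide +kernel)

/-- The values of the recursion operator differ by constants in the first entry. -/
theorem RecursionRel.act_J_eq {G G₁ G₂ : Fin 4 → Alg} (h₁ : RecursionRel G G₁)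
    (h₂ : RecursionRel G G₂) : act J G₁ = act J G₂ := by
  obtain ⟨s₁, hs₁, rfl⟩ := h₁
  obtain ⟨s₂, hs₂, rfl⟩ := h₂
  refine act_J_congr ?_ ?_ ?_ ?_ <;> simp [hs₁, hs₂]

theorem Coeffs.IsSolution.biHamiltonianForm {N : Coeffs} {k₀ : ℂ} (h : N.IsSolution k₀) {n : ℕ}
    {T : Alg →ₗ[ℂ] Alg} (hT : N.IsFlow n T) {h₀ h₁ : Alg} (g₀ : grad h₀ = N.vec n)
    (g₁ : grad h₁ = N.vec (n + 1)) : BiHamiltonianForm T h₀ h₁ := by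
  have hr := h.recursionRel n
  constructor
  · rw [h.flow_eq hT, g₁, N.act_J_vec]
  · rw [g₀, g₁]
    exact hr
  · intro G hG
    rw [g₀] at hG
    rw [h.flow_eq hT, ← N.act_J_vec, hr.act_J_eq hG]
  · rw [h.flow_eq hT, g₀, h.act_R_vec]

/-! ### Other integration constants -/

theorem grad_zero : grad 0 = 0 := by
  simpa using grad_smul 0 0

theorem grad_sum {κ : Type*} (s : Finset κ) (F : κ → Alg) :
    grad (∑ j ∈ s, F j) = ∑ j ∈ s, grad (F j) := by
  classical
  induction s using Finset.induction_on with
  | empty => simpa using grad_zero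
  | insert j s hj ih => rw [Finset.sum_insert hj, Finset.sum_insert hj, grad_add, ih]

theorem Coeffs.vec_eq_sum {N N' : Coeffs} {f : PowerSeries ℂ}
    (ha : PowerSeries.mk N'.a = scal f * PowerSeries.mk N.a)
    (hb : PowerSeries.mk N'.b = scal f * PowerSeries.mk N.b)
    (hρ : PowerSeries.mk N'.ρ = scal f * PowerSeries.mk N.ρ)
    (hδ : PowerSeries.mk N'.δ = scal f * PowerSeries.mk N.δ) (n : ℕ) :
    N'.vec n = ∑ j ∈ Finset.range (n + 1), PowerSeries.coeff j f • N.vec (n - j) := by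
  have e : ∀ {x y : ℕ → Alg}, PowerSeries.mk x = scal f * PowerSeries.mk y →
      x n = ∑ j ∈ Finset.range (n + 1), PowerSeries.coeff j f • y (n - j) := fun {x y} hxy => by
    rw [← coeff_scal_mul, ← hxy, PowerSeries.coeff_mk]
  funext i
  rw [Finset.sum_apply]
  fin_cases i <;>
    simp only [Coeffs.vec, Pi.smul_apply, Matrix.cons_val, Fin.zero_eta, Fin.mk_one,
      Fin.reduceFinMk, Fin.isValue, e ha, e hb, e hρ, e hδ, Finset.mul_sum, mul_smul_comm, smul_neg,
      Finset.sum_neg_distrib]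

theorem Coeffs.mat_eq_sum {N N' : Coeffs} {f : PowerSeries ℂ}
    (ha : PowerSeries.mk N'.a = scal f * PowerSeries.mk N.a)
    (hb : PowerSeries.mk N'.b = scal f * PowerSeries.mk N.b)
    (hg : PowerSeries.mk N'.g = scal f * PowerSeries.mk N.g)
    (hρ : PowerSeries.mk N'.ρ = scal f * PowerSeries.mk N.ρ)
    (hδ : PowerSeries.mk N'.δ = scal f * PowerSeries.mk N.δ) (n : ℕ) :
    N'.mat n = ∑ j ∈ Finset.range (n + 1), PowerSeries.coeff j f • N.mat (n - j) := by
  have e : ∀ {x y : ℕ → Alg}, PowerSeries.mk x = scal f * PowerSeries.mk y →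
      x n = ∑ j ∈ Finset.range (n + 1), PowerSeries.coeff j f • y (n - j) := fun {x y} hxy => by
    rw [← coeff_scal_mul, ← hxy, PowerSeries.coeff_mk]
  have hm : ∀ (N : Coeffs) (m : ℕ),
      N.mat m = !![N.a m, N.b m, N.ρ m; N.g m, -N.a m, N.δ m; N.δ m, -N.ρ m, 0] :=
    fun _ _ => rfl
  ext1 i j
  rw [Matrix.sum_apply]
  fin_cases i <;> fin_cases j <;>
    simp only [hm, Matrix.smul_apply, Matrix.of_apply, Matrix.cons_val, Fin.zero_eta, Fin.mk_one,
      Fin.reduceFinMk, Fin.isValue, e ha, e hb, e hg, e hρ, e hδ, smul_neg, smul_zero,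
      Finset.sum_neg_distrib, Finset.sum_const_zero]

/-- The formula `δH̃ₙ/δu = Gₙ` characterizes the normalized solution. -/
theorem Coeffs.IsSolution.factor_eq_one {N N' : Coeffs} {k₀ : ℂ} (hk₀ : k₀ ≠ 0)
    (h : N.IsSolution k₀) (hn : N.IsNormalized k₀) {f : PowerSeries ℂ}
    (hf0 : PowerSeries.coeff 0 f = 1)
    (ha : PowerSeries.mk N'.a = scal f * PowerSeries.mk N.a)
    (hvec : ∀ n, N'.vec n = ∑ j ∈ Finset.range (n + 1), PowerSeries.coeff j f • N.vec (n - j))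
    (hgrad : ∀ n, grad (N'.ham k₀ n) = N'.vec n) : f = 1 := by
  have grad0 : grad (N.a 0) = 0 := by
    rw [h.init.1]
    exact funext fun i => euler_algebraMap i k₀
  -- Twice the gradient of a'ₙ₊₁ is ∑ fⱼ(n - j)Gₙ₋ⱼ by the normalized case, while the assumed
  -- formula makes it n∑ fⱼGₙ₋ⱼ; the difference is ∑ j fⱼGₙ₋ⱼ. The end term a₀ is constant and has
  -- zero gradient.
  have key : ∀ n ≠ 0, ∑ j ∈ Finset.range (n + 1),
      ((j : ℂ) * PowerSeries.coeff j f) • N.vec (n - j) = 0 := fun n hn0 => by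
    have hn1 : (n : ℂ) ≠ 0 := Nat.cast_ne_zero.2 hn0
    have h1 : (2 : ℂ) • grad (N'.a (n + 1)) = (n : ℂ) • N'.vec n := by
      rw [← hgrad n, Coeffs.ham, if_neg hn0, grad_smul, smul_smul, mul_div_cancel₀ _ hn1]
    have h2 : N'.a (n + 1) =
        ∑ j ∈ Finset.range (n + 1 + 1), PowerSeries.coeff j f • N.a (n + 1 - j) := by
      rw [← coeff_scal_mul, ← ha, PowerSeries.coeff_mk]
    rw [h2, grad_sum, Finset.sum_range_succ, Nat.sub_self, grad_smul, grad0, smul_zero, add_zero,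
      hvec, Finset.smul_sum, Finset.smul_sum, ← sub_eq_zero, ← Finset.sum_sub_distrib] at h1
    rw [← neg_eq_zero, ← Finset.sum_neg_distrib, ← h1]
    refine Finset.sum_congr rfl fun j hj => ?_
    obtain ⟨m, rfl⟩ := Nat.exists_eq_add_of_le (Nat.lt_succ_iff.1 (Finset.mem_range.1 hj))
    have h3 := two_smul_grad_a hk₀ h hn m
    rw [show j + m + 1 - j = m + 1 by omega, show j + m - j = m by omega, grad_smul,
      smul_comm (2 : ℂ), h3]
    push_cast
    module
  -- By induction only the summand n fₙG₀ survives, and the first entry of G₀ is k₀ ≠ 0.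
  have hzero : ∀ n, n ≠ 0 → PowerSeries.coeff n f = 0 := by
    intro n
    induction n using Nat.strongRec with
    | ind n ih =>
    intro hn0
    have h1 := key n hn0
    rw [Finset.sum_range_succ, Finset.sum_eq_zero, zero_add, Nat.sub_self] at h1
    · have h2 := congrFun h1 0
      simp only [Pi.smul_apply, Coeffs.vec, Matrix.cons_val, h.init.1, Pi.zero_apply] at h2
      rw [Algebra.smul_def, ← map_mul, ← map_zero (algebraMap ℂ Alg)] at h2
      have h3 := algebraMap_injective h2
      simpa [hn0, hk₀] using h3
    · intro j hj
      by_cases hj0 : j = 0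
      · simp [hj0]
      · rw [ih j (Finset.mem_range.1 hj) hj0, mul_zero, zero_smul]
  ext n
  rw [PowerSeries.coeff_one]
  split_ifs with hn0
  · rw [hn0, hf0]
  · exact hzero n hn0

/-- Gradients are linear, so the convolution of f with the normalized Hamiltonians has gradient G'ₙ.
Recursion and flows hold for every solution, and only these gradients were missing for the
bi-Hamiltonian form. -/
theorem hierarchy_of_factor {N N' : Coeffs} {k₀ : ℂ} (hk₀ : k₀ ≠ 0)
    (h : N.IsSolution k₀) (hn : N.IsNormalized k₀) (h' : N'.IsSolution k₀) :
    ((∀ n, grad (N'.ham k₀ n) = N'.vec n) ↔ N'.IsNormalized k₀) ∧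
      ∃ f : ℕ → ℂ, f 0 = 1 ∧
        (∀ m, N'.mat m = ∑ j ∈ Finset.range (m + 1), f j • N.mat (m - j)) ∧
        ∀ n : ℕ, grad (∑ j ∈ Finset.range (n + 1), f j • N.ham k₀ (n - j)) = N'.vec n ∧
          (∃! T, N'.IsFlow n T) ∧
          ∀ T, N'.IsFlow n T →
            BiHamiltonianForm T (∑ j ∈ Finset.range (n + 1), f j • N.ham k₀ (n - j))
              (∑ j ∈ Finset.range (n + 2), f j • N.ham k₀ (n + 1 - j)) := by
  obtain ⟨f, hf0, ha, hb, hg, hρ, hδ⟩ := h.exists_factor hk₀ h'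
  have hvec := Coeffs.vec_eq_sum ha hb hρ hδ
  have hgrad : ∀ n, grad (∑ j ∈ Finset.range (n + 1), PowerSeries.coeff j f • N.ham k₀ (n - j)) =
      N'.vec n := fun n => by
    rw [grad_sum, hvec]
    refine Finset.sum_congr rfl fun j _ => ?_
    rw [grad_smul, grad_ham hk₀ h hn]
  refine ⟨⟨fun hN => ?_, fun hN => grad_ham hk₀ h' hN⟩, fun j => PowerSeries.coeff j f, hf0,
    Coeffs.mat_eq_sum ha hb hg hρ hδ, fun n => ⟨hgrad n, h'.existsUnique_flow n, fun T hT => ?_⟩⟩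
  · exact (h.factor_eq_one_iff hk₀ hn h' hf0 ha hb hg hρ hδ).2
      (h.factor_eq_one hk₀ hn hf0 ha hvec hN)
  · exact h'.biHamiltonianForm hT (hgrad n) (hgrad (n + 1))

end
end SuperGBK

open SuperGBK in
theorem mainTheorem2 (k₀ : ℂ) (hk₀ : k₀ ≠ 0) :
    -- `R = J𝓛` in every algebra of operators with `∂ f = f ∂ + f_x` and an inverse of `∂`
    (∀ (E : Type) [Ring E] [Algebra ℂ E] (mul : Alg →ₐ[ℂ] E) (d dinv : E),
      (∀ f, d * mul f = mul f * d + mul (dx f)) → d * dinv = 1 → dinv * d = 1 →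
        opJ mul d * opL mul d dinv = opR mul d) ∧
    -- `J` and `R` form a pair of compatible super-Hamiltonian operators
    (∀ c₁ c₂ : ℂ, IsSuperHamiltonian (c₁ • J + c₂ • R)) ∧
    -- integration constants with `Str N²` independent of `λ` exist and are unique
    (∃! N : Coeffs, N.IsSolution k₀ ∧ N.IsNormalized k₀) ∧
    ∀ N : Coeffs, N.IsSolution k₀ → N.IsNormalized k₀ →
      -- the super-trace identity with `γ = 0`
      (∀ (i : Fin 4) (m : ℤ),
        JetAlg.euler oddField i ((str (N.ser * specM.map dlam)).coeff m) =
          (dlam (str (N.ser * mapCoeff (JetAlg.pd oddField (i, 0)) specM))).coeff m) ∧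
      -- the Hamiltonians and the hierarchy
      (∀ n : ℕ, grad (N.ham k₀ n) = N.vec n ∧
        (∃! T, N.IsFlow n T) ∧
        ∀ T, N.IsFlow n T →
          (fun i => T (field i)) =
            ![2 * dx (N.b (n + 1)),
              -dx (N.a (n + 1)) + fα * N.δ (n + 1) + fβ * N.ρ (n + 1),
              fα * N.b (n + 1) - N.ρ (n + 1),
              -(fβ * N.b (n + 1)) + N.δ (n + 1)] ∧
          BiHamiltonianForm T (N.ham k₀ n) (N.ham k₀ (n + 1))) ∧
      -- all other choices of the integration constants
      (∀ N' : Coeffs, N'.IsSolution k₀ →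
        ((∀ n, grad (N'.ham k₀ n) = N'.vec n) ↔ N'.IsNormalized k₀) ∧
        ∃ f : ℕ → ℂ, f 0 = 1 ∧
          (∀ m, N'.mat m = ∑ j ∈ Finset.range (m + 1), f j • N.mat (m - j)) ∧
          ∀ n : ℕ, grad (∑ j ∈ Finset.range (n + 1), f j • N.ham k₀ (n - j)) = N'.vec n ∧
            (∃! T, N'.IsFlow n T) ∧
            ∀ T, N'.IsFlow n T →
              BiHamiltonianForm T (∑ j ∈ Finset.range (n + 1), f j • N.ham k₀ (n - j))
                (∑ j ∈ Finset.range (n + 2), f j • N.ham k₀ (n + 1 - j))) := by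
  refine ⟨fun E _ _ mul d dinv hd h₁ h₂ => ?_, isSuperHamiltonian_pencil,
    existsUnique_normalized hk₀, fun N h hn => ⟨supertrace_identity hk₀ h hn, fun n => ?_,
      fun N' h' => hierarchy_of_factor hk₀ h hn h'⟩⟩
  · exact opJ_mul_opL mul d dinv hd h₁
  · exact ⟨grad_ham hk₀ h hn n, h.existsUnique_flow n, fun T hT => ⟨h.flow_eq hT,
      h.biHamiltonianForm hT (grad_ham hk₀ h hn n) (grad_ham hk₀ h hn (n + 1))⟩⟩
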